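/- Let $m,q\ge 2$ be integers. Let $I_0,\dots,I_{m-1}\subset[0,1]$ be closed intervals with pairwise disjoint interiors, and let $T$ be the piecewise linear map on $\bigcup_i I_i$ which maps each $I_i$ bijectively onto $[0,1]$, linearly with slope $e^{\lambda_i}$, $\lambda_i>0$ (at a common endpoint of two intervals, one of the two intervals is chosen once and for all, and the point is attributed to it). Let $J_T$ be the Cookie-Cutter set, i.e. the set of points all of whose iterates under $T$ are defined. Let $\varphi$ be a real function of two variables which is constant, equal to $\varphi(i,j)$, on the pairs $(x,y)$ with $x$ attributed to $I_i$ and $y$ to $I_j$. For $\alpha\in\mathbb R$ put $$L_\varphi(\alpha)=\Big\{x\in J_T:\ \lim_{n\to\infty}\frac1n\sum_{k=1}^n\varphi(T^kx,T^{qk}x)=\alpha\Big\}.$$ For all $s,r\in\mathbb R$ the system $$t_i^q=\sum_{j=0}^{m-1}e^{s\varphi(i,j)-r\lambda_i}\,t_j\qquad(0\le i\le m-1)$$ has a unique strictly positive solution $(t_i(s,r))_i$, and the pressure $P(s,r)=(q-1)\log\sum_j t_j(s,r)$ is differentiable in $s$. Moreover, the set of values of $\partial P/\partial s$ on $\mathbb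 R^2$ is bounded, and with $A$ and $B$ its infimum and supremum: (1) $\{\alpha\in\mathbb R: L_\varphi(\alpha)\neq\emptyset\}=[A,B]$. (2) If $\varphi(\cdot,\cdot)$ is not constant, then $A<B$; for each $\alpha\in(A,B)$ the system $$P(s,r)=\alpha s,\qquad \frac{\partial P}{\partial s}(s,r)=\alpha$$ has a unique solution $(s(\alpha),r(\alpha))\in\mathbb R^2$; the limits $r(A)=\lim_{\alpha\downarrow A}r(\alpha)$ and $r(B)=\lim_{\alpha\uparrow B}r(\alpha)$ exist in $\mathbb R$; and for every $\alpha\in[A,B]$ one has $r(\alpha)\ge 0$ and $$\dim_H L_\varphi(\alpha)=\frac{r(\alpha)}{q}.$$ (3) If $\varphi(\cdot,\cdot)$ is constant, equal to $c$, then $A=B=c$; there is a unique real $r$ such that the solutions of $P(s',r')=cs'$, $\frac{\partial P}{\partial s}(s',r')=c$ are exactly the pairs $(s',r)$ with $s'\in\mathbb R$; and $r\ge0$, $\dim_H L_\varphi(c)=r/q$. -/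

import Mathlib

open Set Filter Topology

noncomputable section

/-- A linear Cookie-Cutter map with `m` branches: closed intervals
`I i = [lower i, lower i + exp (-lam i)] ⊆ [0,1]` with pairwise disjoint interiors, the branch on
`I i` being the increasing affine bijection of `I i` onto `[0,1]`, of slope `exp (lam i)`.
Two of the closed intervals may share an endpoint; `index` says to which interval a
point of their union is attributed (it is forced except at common endpoints). -/
structure LinearCookieCutter (m : ℕ) where
  /-- logarithms of the slopes -/
  lam : Fin m → ℝ
  /-- left endpoints of the intervals -/
  lower : Fin m → ℝ
  /-- index of the interval to which a point is attributed -/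
  index : ℝ → Fin m
  lam_pos : ∀ i, 0 < lam i
  lower_nonneg : ∀ i, 0 ≤ lower i
  upper_le_one : ∀ i, lower i + Real.exp (-lam i) ≤ 1
  disjoint_interiors : ∀ i j, i ≠ j →
    Disjoint (Ioo (lower i) (lower i + Real.exp (-lam i)))
      (Ioo (lower j) (lower j + Real.exp (-lam j)))
  mem_index : ∀ i x, x ∈ Icc (lower i) (lower i + Real.exp (-lam i)) →
    x ∈ Icc (lower (index x)) (lower (index x) + Real.exp (-lam (index x)))

namespace LinearCookieCutter

variable {m : ℕ} (C : LinearCookieCutter m)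

/-- The closed interval `I i`. -/
def I (i : Fin m) : Set ℝ := Icc (C.lower i) (C.lower i + Real.exp (-C.lam i))

/-- The affine branch on `I i`. -/
def branch (i : Fin m) (x : ℝ) : ℝ := Real.exp (C.lam i) * (x - C.lower i)

/-- The domain of the map: the union of the intervals. -/
def domain : Set ℝ := ⋃ i, C.I i

/-- The piecewise linear map (meaningful on `C.domain`). -/
def T (x : ℝ) : ℝ := C.branch (C.index x) x

/-- The Cookie-Cutter set: the points all of whose iterates exist. -/
def J : Set ℝ := {x | ∀ n : ℕ, C.T^[n] x ∈ C.domain}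

theorem bijOn_branch (i : Fin m) : BijOn (C.branch i) (C.I i) (Icc 0 1) := by
  have hp := Real.exp_pos (C.lam i)
  have he : Real.exp (C.lam i) * Real.exp (-C.lam i) = 1 := by
    rw [← Real.exp_add]; simp
  refine ⟨fun x hx => ?_, fun x _ y _ h => ?_, fun y hy => ?_⟩
  · obtain ⟨h1, h2⟩ := hx
    refine ⟨mul_nonneg hp.le (by linarith), ?_⟩
    have : Real.exp (C.lam i) * (x - C.lower i)
        ≤ Real.exp (C.lam i) * Real.exp (-C.lam i) :=
      mul_le_mul_of_nonneg_left (by linarith) hp.le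
    unfold branch
    linarith
  · have := mul_left_cancel₀ hp.ne' h
    linarith
  · have hn := Real.exp_pos (-C.lam i)
    refine ⟨C.lower i + Real.exp (-C.lam i) * y, ⟨?_, ?_⟩, ?_⟩
    · have := mul_nonneg hn.le hy.1
      linarith
    · have := mul_le_mul_of_nonneg_left hy.2 hn.le
      linarith
    · unfold branch
      rw [add_sub_cancel_left, ← mul_assoc, he, one_mul]

/-- `φ` is constant, with value `Φ i j`, on the set of pairs `(x, y)` for which `x` is attributed
to `I i` and `y` to `I j`. -/
def LocallyConstantWith (φ : ℝ → ℝ → ℝ) (Φ : Fin m → Fin m → ℝ) : Prop :=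
  ∀ x ∈ C.domain, ∀ y ∈ C.domain, φ x y = Φ (C.index x) (C.index y)

/-- The level set of the multiple ergodic averages of `φ` along `(T^k, T^{qk})`. -/
def levelSet (q : ℕ) (φ : ℝ → ℝ → ℝ) (α : ℝ) : Set ℝ :=
  {x | x ∈ C.J ∧
    Tendsto (fun n : ℕ => (1 / (n : ℝ)) *
        ∑ k ∈ Finset.Icc 1 n, φ (C.T^[k] x) (C.T^[q * k] x))
      atTop (𝓝 α)}

end LinearCookieCutter

variable {m : ℕ}

/-- `t` is a strictly positive solution of `t_i ^ q = ∑_j exp (s Φ(i,j) - r λ_i) t_j`. -/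
def IsTransferSolution (q : ℕ) (lam : Fin m → ℝ) (Φ : Fin m → Fin m → ℝ) (s r : ℝ)
    (t : Fin m → ℝ) : Prop :=
  (∀ i, 0 < t i) ∧ ∀ i, t i ^ q = ∑ j, Real.exp (s * Φ i j - r * lam i) * t j

open Classical in
/-- The strictly positive solution of the transfer system (`0` if there were none). -/
def transferSolution (q : ℕ) (lam : Fin m → ℝ) (Φ : Fin m → Fin m → ℝ) (s r : ℝ) : Fin m → ℝ :=
  if h : ∃ t, IsTransferSolution q lam Φ s r t then h.choose else 0

/-- The pressure `P(s,r) = (q - 1) log ∑_j t_j(s,r)`. -/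
def pressure (q : ℕ) (lam : Fin m → ℝ) (Φ : Fin m → Fin m → ℝ) (s r : ℝ) : ℝ :=
  ((q : ℝ) - 1) * Real.log (∑ j, transferSolution q lam Φ s r j)

/-- The partial derivative `∂P/∂s (s,r)`. -/
def pressureDeriv (q : ℕ) (lam : Fin m → ℝ) (Φ : Fin m → Fin m → ℝ) (s r : ℝ) : ℝ :=
  deriv (fun s' => pressure q lam Φ s' r) s

/-- The set of values of `∂P/∂s`. -/
def slopeSet (q : ℕ) (lam : Fin m → ℝ) (Φ : Fin m → Fin m → ℝ) : Set ℝ :=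
  {a | ∃ s r, pressureDeriv q lam Φ s r = a}

/-- `(s, r)` solves `P(s,r) = α s`, `∂P/∂s (s,r) = α`. -/
def IsCritical (q : ℕ) (lam : Fin m → ℝ) (Φ : Fin m → Fin m → ℝ) (α s r : ℝ) : Prop :=
  pressure q lam Φ s r = α * s ∧ pressureDeriv q lam Φ s r = α

end

/-!
A point of the Cookie-Cutter set is coded by a sequence `ω`, and the averages in question are
`(1/n) ∑_{k ≤ n} Φ (ω_k) (ω_{qk})`: they only couple the symbols of `ω` along the progressions
`i, iq, iq², ...` with `q ∤ i`. The measures that realise the values of the averages are therefore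
the laws of sequences whose restrictions to these progressions are independent copies of a Markov
chain.

*Pressure.* For `t = exp y` the transfer system reads `q y_i = log ∑_j exp (a_ij + y_j)`, with
`a_ij = s Φ(i,j) - r λ_i`, which is a fixed point problem for a contraction of ratio `1/q`. The
comparison principle `le_of_sub_super` gives uniqueness, Lipschitz bounds and convexity of the
pressure; the equality case of the convexity of log-sum-exp gives strict convexity in `s` unless
`Φ` is constant. The solution defines a Markov chain, the Gibbs chain, with initial law
`t_i / ∑ t` and transition probabilities `exp (a_ij) t_j / t_i ^ q`. The derivative `∂P/∂s` is the
mean of `Φ` under this chain (`hasDerivAt_pressure`), and its entropy per unit of length, times `q`,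
is `P - s ∂P/∂s + r λ̄`, with `λ̄` the mean of `λ` (`entropyRate_gibbs`).

*Upper bound.* If `P(s,r) ≤ α s` and `ω` has average `α`, compute the weight that the Gibbs measure
gives to the prefix of `ω` of length `q^(l+1)`. It is at least the diameter of the corresponding
interval raised to the power `r/q`, up to a factor `exp (o(q^l))` and a factor which depends on the
increment from `l` to `l + 1` of a bounded sequence, and such an increment cannot be bounded above
by a fixed negative number for all large `l`. So this weight is infinitely often at least
`diam ^ (r/q)` up to `exp (-ε q^(l+1))` (`frequently_le_wordWeight`). As the weights of the words of a
given length have bounded sum, covering by these intervals gives `dim_H L(α) ≤ r/q`; and as weights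
are at most `1`, `L(α) ≠ ∅` forces `r ≥ 0`.

*Lower bound.* For any Markov chain the strong law of large numbers shows that almost every
interleaved sequence has the mean of `Φ` as average and that the weights of its prefixes decay at
the rate of the entropy. The mass distribution principle then gives
`dim_H L(α) ≥ entropy / λ̄` (`le_dimH_levelSet`), which is `r/q` for the Gibbs chain at a critical
point.

*Critical points.* By convexity, `(s, r)` is critical for `α` exactly when the line of slope `α`
through the origin is tangent to `P(·, r)` at `s`. For `α` strictly between `A` and `B` such an `r`
exists because `P` grows faster than `α s` at both ends, and it is
`touchingValue P α = inf {r | ∃ s, P(s,r) ≤ α s}`. This function is continuous at the end points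
`A` and `B`; the pairs `(α, r)` realised by Markov chains form a closed set, since the chains form a
compact one (`isClosed_chainSpectrum`). So `(A, r(A))` and `(B, r(B))` are realised too, which gives
the lower bound there, while the upper bound only uses the definition of `touchingValue`.
-/

open MeasureTheory ProbabilityTheory

/-! ### The transfer system in logarithmic coordinates -/

/-- The log-sum-exp function `log ∑ exp v_j`. -/
noncomputable def logSumExp {m : ℕ} (v : Fin m → ℝ) : ℝ := Real.log (∑ j, Real.exp (v j))

section LogSumExp

variable {m : ℕ} [NeZero m]

theorem sum_exp_pos (v : Fin m → ℝ) : 0 < ∑ j, Real.exp (v j) :=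
  Finset.sum_pos (fun _ _ => Real.exp_pos _) Finset.univ_nonempty

theorem exp_logSumExp (v : Fin m → ℝ) : Real.exp (logSumExp v) = ∑ j, Real.exp (v j) :=
  Real.exp_log (sum_exp_pos v)

theorem logSumExp_eq_iff (v : Fin m → ℝ) (c : ℝ) :
    logSumExp v = c ↔ Real.exp c = ∑ j, Real.exp (v j) := by
  rw [← exp_logSumExp]
  exact ⟨fun h => by rw [h], fun h => (Real.exp_injective h).symm⟩

theorem logSumExp_le_add {v w : Fin m → ℝ} {c : ℝ} (h : ∀ j, v j ≤ w j + c) :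
    logSumExp v ≤ logSumExp w + c := by
  rw [← Real.exp_le_exp, Real.exp_add, exp_logSumExp, exp_logSumExp, Finset.sum_mul]
  exact Finset.sum_le_sum fun j _ => by
    rw [← Real.exp_add]
    exact Real.exp_le_exp.2 (h j)

theorem sum_exp_sub_logSumExp (v : Fin m → ℝ) : ∑ j, Real.exp (v j - logSumExp v) = 1 := by
  simp_rw [Real.exp_sub, exp_logSumExp, ← Finset.sum_div]
  exact div_self (sum_exp_pos v).ne'

theorem logSumExp_convex (v w : Fin m → ℝ) {θ : ℝ} (h0 : 0 ≤ θ) (h1 : θ ≤ 1) :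
    logSumExp (fun j => θ * v j + (1 - θ) * w j) ≤ θ * logSumExp v + (1 - θ) * logSumExp w := by
  set c := θ * logSumExp v + (1 - θ) * logSumExp w
  have key : ∑ j, Real.exp (θ * v j + (1 - θ) * w j - c) ≤ 1 := by
    calc ∑ j, Real.exp (θ * v j + (1 - θ) * w j - c)
        ≤ ∑ j, (θ * Real.exp (v j - logSumExp v) + (1 - θ) * Real.exp (w j - logSumExp w)) := by
          refine Finset.sum_le_sum fun j _ => ?_
          have := convexOn_exp.2 (mem_univ (v j - logSumExp v)) (mem_univ (w j - logSumExp w))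
            h0 (sub_nonneg.2 h1) (by ring)
          simp only [smul_eq_mul] at this
          convert this using 2
          simp only [c]; ring
      _ = 1 := by
          rw [Finset.sum_add_distrib, ← Finset.mul_sum, ← Finset.mul_sum,
            sum_exp_sub_logSumExp, sum_exp_sub_logSumExp]
          ring
  rw [← Real.exp_le_exp, exp_logSumExp]
  simp_rw [Real.exp_sub, ← Finset.sum_div] at key
  rwa [div_le_one (Real.exp_pos _)] at key

/-- The equality case in the convexity of `logSumExp`. -/
theorem sub_eq_of_logSumExp_eq {v w : Fin m → ℝ} {θ : ℝ} (h0 : 0 < θ) (h1 : θ < 1)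
    (h : θ * logSumExp v + (1 - θ) * logSumExp w
      ≤ logSumExp (fun j => θ * v j + (1 - θ) * w j)) (j : Fin m) :
    v j - logSumExp v = w j - logSumExp w := by
  by_contra hne
  set c := θ * logSumExp v + (1 - θ) * logSumExp w with hc
  have key : ∑ j, Real.exp (θ * v j + (1 - θ) * w j - c) < 1 := by
    calc ∑ j, Real.exp (θ * v j + (1 - θ) * w j - c)
        < ∑ j, (θ * Real.exp (v j - logSumExp v) + (1 - θ) * Real.exp (w j - logSumExp w)) := by
          refine Finset.sum_lt_sum (fun j _ => ?_) ⟨j, Finset.mem_univ j, ?_⟩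
          · have := convexOn_exp.2 (mem_univ (v j - logSumExp v)) (mem_univ (w j - logSumExp w))
              h0.le (sub_nonneg.2 h1.le) (by ring)
            simp only [smul_eq_mul] at this
            convert this using 2
            simp only [c]; ring
          · have := strictConvexOn_exp.2 (mem_univ (v j - logSumExp v))
              (mem_univ (w j - logSumExp w)) hne h0 (sub_pos.2 h1) (by ring)
            simp only [smul_eq_mul] at this
            convert this using 2
            simp only [c]; ring
      _ = 1 := by
          rw [Finset.sum_add_distrib, ← Finset.mul_sum, ← Finset.mul_sum,
            sum_exp_sub_logSumExp, sum_exp_sub_logSumExp]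
          ring
  simp_rw [Real.exp_sub, ← Finset.sum_div] at key
  rw [div_lt_one (Real.exp_pos _), ← exp_logSumExp, Real.exp_lt_exp] at key
  exact absurd h (not_le.2 key)

end LogSumExp

/-- `y` solves `q y_i = log ∑_j exp (a_ij + y_j)`; equivalently `exp ∘ y` is a positive
solution of `t_i ^ q = ∑_j exp (a_ij) t_j`. -/
def IsLogSolution {m : ℕ} (q : ℕ) (a : Fin m → Fin m → ℝ) (y : Fin m → ℝ) : Prop :=
  ∀ i, q * y i = logSumExp (fun j => a i j + y j)

section Solution

variable {m : ℕ} [NeZero m] {q : ℕ}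

/-- Comparison principle: a subsolution for `a` lies below a supersolution for `b`, up to
`c / (q - 1)`, if `a ≤ b + c`. -/
theorem le_of_sub_super (hq : 2 ≤ q) {a b : Fin m → Fin m → ℝ} {y z : Fin m → ℝ} {c : ℝ}
    (hab : ∀ i j, a i j ≤ b i j + c) (hy : ∀ i, q * y i ≤ logSumExp (fun j => a i j + y j))
    (hz : ∀ i, logSumExp (fun j => b i j + z j) ≤ q * z i) (i : Fin m) :
    y i ≤ z i + c / (q - 1) := by
  have hq' : (2 : ℝ) ≤ q := by exact_mod_cast hq
  obtain ⟨k, -, hk⟩ := Finset.exists_max_image Finset.univ (fun i => y i - z i)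
    Finset.univ_nonempty
  have h1 : logSumExp (fun j => a k j + y j) ≤
      logSumExp (fun j => b k j + z j) + (c + (y k - z k)) :=
    logSumExp_le_add fun j => by
      have := hk j (Finset.mem_univ j)
      have := hab k j
      linarith
  have h2 : y k - z k ≤ c / (q - 1) := by
    rw [le_div_iff₀ (by linarith)]
    have := hy k
    have := hz k
    linarith
  have := hk i (Finset.mem_univ i)
  linarith

theorem exists_isLogSolution (hq : 2 ≤ q) (a : Fin m → Fin m → ℝ) : ∃ y, IsLogSolution q a y := by
  have hq' : (2 : ℝ) ≤ q := by exact_mod_cast hq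
  have hq0 : (0 : ℝ) < q := by linarith
  set F : (Fin m → ℝ) → (Fin m → ℝ) := fun y i => logSumExp (fun j => a i j + y j) / q with hF
  have hc : ContractingWith (1 / 2) F := by
    refine ⟨by rw [← NNReal.coe_lt_coe]; norm_num, LipschitzWith.of_dist_le_mul fun y z => ?_⟩
    have hd : ∀ y z : Fin m → ℝ, ∀ i, F y i - F z i ≤ 1 / 2 * dist y z := by
      intro y z i
      have h1 : logSumExp (fun j => a i j + y j) ≤ logSumExp (fun j => a i j + z j) + dist y z :=
        logSumExp_le_add fun j => by
          have := (le_abs_self _).trans (dist_le_pi_dist y z j)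
          linarith
      simp only [hF]
      rw [← sub_div, div_le_iff₀ hq0]
      nlinarith [dist_nonneg (x := y) (y := z)]
    rw [dist_pi_le_iff (by positivity)]
    intro i
    rw [Real.dist_eq, abs_le]
    have h1 := hd y z i
    have h2 := hd z y i
    rw [dist_comm] at h2
    push_cast
    constructor <;> linarith
  refine ⟨hc.fixedPoint F, fun i => ?_⟩
  have := congrFun hc.fixedPoint_isFixedPt i
  simp only [hF] at this ⊢
  rw [div_eq_iff hq0.ne'] at this
  linarith

theorem IsLogSolution.unique (hq : 2 ≤ q) {a : Fin m → Fin m → ℝ} {y z : Fin m → ℝ}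
    (hy : IsLogSolution q a y) (hz : IsLogSolution q a z) : y = z := by
  funext i
  have h1 := le_of_sub_super (c := 0) hq (fun i j => (add_zero (a i j)).ge)
    (fun i => (hy i).le) (fun i => (hz i).ge) i
  have h2 := le_of_sub_super (c := 0) hq (fun i j => (add_zero (a i j)).ge)
    (fun i => (hz i).le) (fun i => (hy i).ge) i
  simp only [zero_div, add_zero] at h1 h2
  exact le_antisymm h1 h2

end Solution

open Classical in
/-- The solution of `q y_i = log ∑_j exp (a_ij + y_j)`, which exists and is unique if `2 ≤ q`. -/
noncomputable def logSolution {m : ℕ} (q : ℕ) (a : Fin m → Fin m → ℝ) : Fin m → ℝ :=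
  if h : ∃ y, IsLogSolution q a y then h.choose else 0

/-- The pressure `(q - 1) log ∑_j t_j` of a weight matrix `a`, where `t_i ^ q = ∑_j exp (a_ij) t_j`. -/
noncomputable def matrixPressure {m : ℕ} (q : ℕ) (a : Fin m → Fin m → ℝ) : ℝ :=
  (q - 1) * logSumExp (logSolution q a)

section MatrixPressure

variable {m : ℕ} [NeZero m] {q : ℕ}

theorem isLogSolution_logSolution (hq : 2 ≤ q) (a : Fin m → Fin m → ℝ) :
    IsLogSolution q a (logSolution q a) := by
  have h := exists_isLogSolution hq a
  rw [logSolution, dif_pos h]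
  exact h.choose_spec

theorem logSolution_le_add (hq : 2 ≤ q) {a b : Fin m → Fin m → ℝ} {c : ℝ}
    (hab : ∀ i j, a i j ≤ b i j + c) (i : Fin m) :
    logSolution q a i ≤ logSolution q b i + c / (q - 1) :=
  le_of_sub_super hq hab (fun i => (isLogSolution_logSolution hq a i).le)
    (fun i => (isLogSolution_logSolution hq b i).ge) i

theorem matrixPressure_le_add (hq : 2 ≤ q) {a b : Fin m → Fin m → ℝ} {c : ℝ}
    (hab : ∀ i j, a i j ≤ b i j + c) : matrixPressure q a ≤ matrixPressure q b + c := by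
  have hq' : (2 : ℝ) ≤ q := by exact_mod_cast hq
  have h := mul_le_mul_of_nonneg_left (logSumExp_le_add (logSolution_le_add hq hab))
    (by linarith : (0 : ℝ) ≤ q - 1)
  rwa [mul_add, mul_div_cancel₀ _ (by linarith : (q : ℝ) - 1 ≠ 0)] at h

theorem logSolution_convex (hq : 2 ≤ q) (a b : Fin m → Fin m → ℝ) {θ : ℝ} (h0 : 0 ≤ θ)
    (h1 : θ ≤ 1) (i : Fin m) :
    logSolution q (fun i j => θ * a i j + (1 - θ) * b i j) i ≤
      θ * logSolution q a i + (1 - θ) * logSolution q b i := by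
  have := le_of_sub_super (c := 0) (b := fun i j => θ * a i j + (1 - θ) * b i j)
    (z := fun i => θ * logSolution q a i + (1 - θ) * logSolution q b i) hq
    (fun i j => (add_zero _).ge)
    (fun i => (isLogSolution_logSolution hq (fun i j => θ * a i j + (1 - θ) * b i j) i).le)
    (fun i => ?_) i
  · simpa using this
  · have h := logSumExp_convex (fun j => a i j + logSolution q a j)
      (fun j => b i j + logSolution q b j) h0 h1
    rw [← isLogSolution_logSolution hq a i, ← isLogSolution_logSolution hq b i] at h
    refine (le_of_eq ?_).trans (h.trans (le_of_eq (by ring)))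
    congr 1; funext j; ring

theorem matrixPressure_convex (hq : 2 ≤ q) (a b : Fin m → Fin m → ℝ) {θ : ℝ} (h0 : 0 ≤ θ)
    (h1 : θ ≤ 1) :
    matrixPressure q (fun i j => θ * a i j + (1 - θ) * b i j) ≤
      θ * matrixPressure q a + (1 - θ) * matrixPressure q b := by
  have hq' : (2 : ℝ) ≤ q := by exact_mod_cast hq
  have h := (logSumExp_le_add (c := 0)
    (fun i => (logSolution_convex hq a b h0 h1 i).trans (add_zero _).ge)).trans
      ((add_zero _).le.trans (logSumExp_convex _ _ h0 h1))
  have := mul_le_mul_of_nonneg_left h (by linarith : (0 : ℝ) ≤ q - 1)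
  unfold matrixPressure
  linarith

/-- The pressure is strictly convex on segments whose direction is not a constant matrix. -/
theorem sub_eq_const_of_matrixPressure_eq (hq : 2 ≤ q) (a b : Fin m → Fin m → ℝ) {θ : ℝ}
    (h0 : 0 < θ) (h1 : θ < 1)
    (h : θ * matrixPressure q a + (1 - θ) * matrixPressure q b ≤
      matrixPressure q (fun i j => θ * a i j + (1 - θ) * b i j)) :
    ∃ c, ∀ i j, a i j - b i j = c := by
  have hq' : (2 : ℝ) ≤ q := by exact_mod_cast hq
  set y := logSolution q a
  set z := logSolution q b
  set x := logSolution q (fun i j => θ * a i j + (1 - θ) * b i j)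
  have hxle : ∀ i, x i ≤ θ * y i + (1 - θ) * z i := logSolution_convex hq a b h0.le h1.le
  have hle : θ * logSumExp y + (1 - θ) * logSumExp z ≤ logSumExp x := by
    unfold matrixPressure at h
    have : ((q : ℝ) - 1) * (θ * logSumExp y + (1 - θ) * logSumExp z) ≤
      (q - 1) * logSumExp x := by linarith
    exact le_of_mul_le_mul_left this (by linarith)
  have hxz : logSumExp x ≤ logSumExp (fun j => θ * y j + (1 - θ) * z j) := by
    simpa using logSumExp_le_add (c := 0) (fun j => (hxle j).trans (add_zero _).ge)
  have hyz := sub_eq_of_logSumExp_eq h0 h1 (hle.trans hxz)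
  have hxeq : ∀ i, x i = θ * y i + (1 - θ) * z i := by
    have hs : ∑ j, Real.exp (x j) = ∑ j, Real.exp (θ * y j + (1 - θ) * z j) := by
      rw [← exp_logSumExp, ← exp_logSumExp,
        le_antisymm hxz ((logSumExp_convex y z h0.le h1.le).trans hle)]
    intro i
    exact Real.exp_injective ((Finset.sum_eq_sum_iff_of_le
      (fun i _ => Real.exp_le_exp.2 (hxle i))).1 hs i (Finset.mem_univ i))
  refine ⟨(q - 1) * (logSumExp y - logSumExp z), fun i j => ?_⟩
  have hrow := sub_eq_of_logSumExp_eq (v := fun j => a i j + y j) (w := fun j => b i j + z j)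
    h0 h1 (by
      rw [← isLogSolution_logSolution hq a i, ← isLogSolution_logSolution hq b i]
      have := isLogSolution_logSolution hq (fun i j => θ * a i j + (1 - θ) * b i j) i
      change q * x i = logSumExp (fun j => _ + x j) at this
      have e : (fun j => θ * (a i j + y j) + (1 - θ) * (b i j + z j)) =
          fun j => θ * a i j + (1 - θ) * b i j + x j := by
        funext j; rw [hxeq]; ring
      rw [e, ← this, hxeq]
      exact le_of_eq (by ring)) j
  rw [← isLogSolution_logSolution hq a i, ← isLogSolution_logSolution hq b i] at hrow
  have h3 := hyz i
  have h4 := hyz j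
  change a i j + y j - q * y i = b i j + z j - q * z i at hrow
  have h5 : y i = z i + (logSumExp y - logSumExp z) := by linarith
  rw [h5] at hrow
  linarith

/-- The transition probabilities `exp (a_ij + y_j - q y_i)` attached to a weight matrix. -/
noncomputable def gibbsTrans {m : ℕ} (q : ℕ) (a : Fin m → Fin m → ℝ) (i j : Fin m) : ℝ :=
  Real.exp (a i j + logSolution q a j - q * logSolution q a i)

/-- The initial distribution `t_i / ∑_j t_j` attached to a weight matrix. -/
noncomputable def gibbsInit {m : ℕ} (q : ℕ) (a : Fin m → Fin m → ℝ) (i : Fin m) : ℝ :=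
  Real.exp (logSolution q a i - logSumExp (logSolution q a))

theorem gibbsInit_mem (q : ℕ) (a : Fin m → Fin m → ℝ) :
    gibbsInit q a ∈ stdSimplex ℝ (Fin m) :=
  ⟨fun _ => (Real.exp_pos _).le, sum_exp_sub_logSumExp _⟩

theorem gibbsTrans_mem (hq : 2 ≤ q) (a : Fin m → Fin m → ℝ) (i : Fin m) :
    gibbsTrans q a i ∈ stdSimplex ℝ (Fin m) := by
  refine ⟨fun _ => (Real.exp_pos _).le, ?_⟩
  unfold gibbsTrans
  rw [isLogSolution_logSolution hq a i]
  exact sum_exp_sub_logSumExp _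

/-- A strictly substochastic system has only the trivial solution. -/
theorem eq_zero_of_mul_eq_sum (hq : 2 ≤ q) {p : Fin m → Fin m → ℝ}
    (hp : ∀ i, p i ∈ stdSimplex ℝ (Fin m)) {v : Fin m → ℝ}
    (hv : ∀ i, q * v i = ∑ j, p i j * v j) : v = 0 := by
  have hq' : (2 : ℝ) ≤ q := by exact_mod_cast hq
  obtain ⟨k, -, hk⟩ := Finset.exists_max_image Finset.univ (fun i => |v i|)
    Finset.univ_nonempty
  have h1 : q * |v k| ≤ |v k| := by
    calc q * |v k| = |∑ j, p k j * v j| := by rw [← hv, abs_mul, Nat.abs_cast]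
      _ ≤ ∑ j, |p k j * v j| := Finset.abs_sum_le_sum_abs _ _
      _ ≤ ∑ j, p k j * |v k| := Finset.sum_le_sum fun j _ => by
          rw [abs_mul, abs_of_nonneg ((hp k).1 j)]
          exact mul_le_mul_of_nonneg_left (hk j (Finset.mem_univ j)) ((hp k).1 j)
      _ = |v k| := by rw [← Finset.sum_mul, (hp k).2, one_mul]
  have h2 : |v k| ≤ 0 := by nlinarith [abs_nonneg (v k)]
  funext i
  exact abs_eq_zero.1 (le_antisymm ((hk i (Finset.mem_univ i)).trans h2) (abs_nonneg _))

/-- The solution depends differentiably on the weights along a line, by the implicit function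
theorem; the derivative solves the linearised system. -/
theorem exists_hasDerivAt_logSolution (hq : 2 ≤ q) (b f : Fin m → Fin m → ℝ) (s : ℝ) :
    ∃ w : Fin m → ℝ, HasDerivAt (fun s => logSolution q (fun i j => b i j + s * f i j)) w s ∧
      ∀ i, q * w i = ∑ j, gibbsTrans q (fun i j => b i j + s * f i j) i j * (f i j + w j) := by
  have hq' : (2 : ℝ) ≤ q := by exact_mod_cast hq
  set Y : ℝ → Fin m → ℝ := fun s => logSolution q (fun i j => b i j + s * f i j) with hY
  set p := gibbsTrans q (fun i j => b i j + s * f i j) with hp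
  have hpe : ∀ i j, p i j = Real.exp (b i j + s * f i j + Y s j - q * Y s i) := fun i j => rfl
  -- the map whose zero set is the graph of `Y`
  set G : ℝ × (Fin m → ℝ) → (Fin m → ℝ) := fun u i =>
    ∑ j, Real.exp (b i j + u.1 * f i j + u.2 j - q * u.2 i) with hG
  have hGiff : ∀ s' y, G (s', y) = (fun _ => 1) ↔ y = Y s' := by
    intro s' y
    have h1 : ∀ i, G (s', y) i = 1 ↔ q * y i = logSumExp (fun j => b i j + s' * f i j + y j) := by
      intro i
      rw [eq_comm (a := (q : ℝ) * y i), logSumExp_eq_iff]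
      simp only [hG, Real.exp_sub, ← Finset.sum_div]
      rw [div_eq_one_iff_eq (Real.exp_pos _).ne', eq_comm]
    constructor
    · intro h
      exact IsLogSolution.unique hq (fun i => (h1 i).1 (congrFun h i))
        (isLogSolution_logSolution hq _)
    · rintro rfl
      funext i
      exact (h1 i).2 (isLogSolution_logSolution hq _ i)
  have hcd : ContDiff ℝ 1 G := by
    rw [contDiff_pi]
    intro i
    simp only [hG]
    fun_prop
  have hst : HasStrictFDerivAt G (fderiv ℝ G (s, Y s)) (s, Y s) :=
    hcd.contDiffAt.hasStrictFDerivAt one_ne_zero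
  -- directional derivatives of `G`
  have hdir : ∀ c (v : Fin m → ℝ) i, fderiv ℝ G (s, Y s) (c, v) i =
      ∑ j, p i j * (c * f i j + v j) - q * v i := by
    intro c v i
    have h1 : HasDerivAt (fun τ : ℝ => ((s, Y s) + τ • (c, v) : ℝ × (Fin m → ℝ))) (c, v) 0 := by
      simpa using ((hasDerivAt_id (0 : ℝ)).smul_const ((c, v) : ℝ × (Fin m → ℝ))).const_add
        ((s, Y s) : ℝ × (Fin m → ℝ))
    have h3 : HasDerivAt (fun τ : ℝ => G ((s, Y s) + τ • (c, v))) (fderiv ℝ G (s, Y s) (c, v)) 0 :=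
      hst.hasFDerivAt.comp_hasDerivAt_of_eq (0 : ℝ) h1 (by simp)
    have h4 := (hasDerivAt_pi.1 h3) i
    have h5 : HasDerivAt (fun τ : ℝ => G ((s, Y s) + τ • (c, v)) i)
        (∑ j, p i j * (c * f i j + v j - q * v i)) 0 := by
      simp only [hG]
      refine HasDerivAt.fun_sum fun j _ => ?_
      have h6 : HasDerivAt (fun τ : ℝ => b i j + (s + τ * c) * f i j + (Y s j + τ * v j)
          - q * (Y s i + τ * v i)) (c * f i j + v j - q * v i) 0 := by
        have hl : ∀ x : ℝ, HasDerivAt (fun τ : ℝ => τ * x) x 0 := fun x => by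
          simpa using (hasDerivAt_id (0 : ℝ)).mul_const x
        exact (((((hl c).const_add s).mul_const (f i j)).const_add (b i j)).add
          ((hl (v j)).const_add (Y s j))).sub (((hl (v i)).const_add (Y s i)).const_mul (q : ℝ))
      have h7 := h6.exp
      rw [hpe]
      simpa using h7
    rw [h4.unique h5]
    simp_rw [mul_sub, Finset.sum_sub_distrib, ← Finset.sum_mul]
    rw [(gibbsTrans_mem hq _ i).2, one_mul]
  have hinv : (fderiv ℝ G (s, Y s) ∘L .inr ℝ ℝ (Fin m → ℝ)).IsInvertible := by
    set D := fderiv ℝ G (s, Y s) ∘L .inr ℝ ℝ (Fin m → ℝ) with hD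
    have hinj : Function.Injective (D : (Fin m → ℝ) →ₗ[ℝ] (Fin m → ℝ)) := by
      rw [← LinearMap.ker_eq_bot, LinearMap.ker_eq_bot']
      intro v hv
      refine eq_zero_of_mul_eq_sum hq (gibbsTrans_mem hq (fun i j => b i j + s * f i j)) fun i => ?_
      have h1 := congrFun hv i
      have h2 := hdir 0 v i
      simp only [zero_mul, zero_add] at h2
      have h3 : (D : (Fin m → ℝ) →ₗ[ℝ] (Fin m → ℝ)) v i = fderiv ℝ G (s, Y s) (0, v) i := rfl
      rw [h3, h2] at h1
      simp only [Pi.zero_apply] at h1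
      linarith
    refine ⟨(LinearEquiv.ofInjectiveEndo _ hinj).toContinuousLinearEquiv, ?_⟩
    ext v i
    rfl
  have hev : (hst.implicitFunctionOfProdDomain hinv) =ᶠ[𝓝 s] Y := by
    filter_upwards [hst.eventually_apply_implicitFunctionOfProdDomain hinv] with s' hs'
    exact (hGiff _ _).1 (hs'.trans ((hGiff _ _).2 rfl))
  have hdY : HasDerivAt Y (deriv Y s) s := by
    have h1 := (hst.hasStrictFDerivAt_implicitFunctionOfProdDomain hinv).hasFDerivAt
    exact (h1.congr_of_eventuallyEq hev.symm).differentiableAt.hasDerivAt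
  refine ⟨deriv Y s, hdY, fun i => ?_⟩
  have h1 : HasDerivAt (fun s' => G (s', Y s')) (fderiv ℝ G (s, Y s) (1, deriv Y s)) s :=
    HasFDerivAt.comp_hasDerivAt (f := fun s' : ℝ => ((s', Y s') : ℝ × (Fin m → ℝ))) s
      hst.hasFDerivAt ((hasDerivAt_id s).prodMk hdY)
  have h2 : (fun s' => G (s', Y s')) = fun _ => (fun _ => 1) := by
    funext s'
    exact (hGiff _ _).2 rfl
  rw [h2] at h1
  have h3 := congrFun (h1.unique (hasDerivAt_const s _)) i
  rw [hdir] at h3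
  simp only [one_mul, Pi.zero_apply] at h3
  linarith

theorem hasDerivAt_matrixPressure {Y : ℝ → Fin m → Fin m → ℝ} {w : Fin m → ℝ} {s : ℝ}
    (h : HasDerivAt (fun s => logSolution q (Y s)) w s) :
    HasDerivAt (fun s => matrixPressure q (Y s)) ((q - 1) * ∑ i, gibbsInit q (Y s) i * w i) s := by
  have h1 : HasDerivAt (fun s => ∑ j, Real.exp (logSolution q (Y s) j))
      (∑ j, Real.exp (logSolution q (Y s) j) * w j) s :=
    HasDerivAt.fun_sum fun j _ => (hasDerivAt_pi.1 h j).exp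
  have h2 := (h1.log (sum_exp_pos _).ne').const_mul ((q : ℝ) - 1)
  refine h2.congr_deriv ?_
  rw [Finset.sum_div]
  congr 1
  refine Finset.sum_congr rfl fun j _ => ?_
  rw [gibbsInit, Real.exp_sub, exp_logSumExp]
  ring

end MatrixPressure

/-! ### Critical points of a pressure function -/

/-- The least `r` for which `P(·, r)` touches the line of slope `α` through the origin from
below. -/
noncomputable def touchingValue (P : ℝ → ℝ → ℝ) (α : ℝ) : ℝ := sInf {r | ∃ s, P s r ≤ α * s}

section Touching

variable {P : ℝ → ℝ → ℝ} {c C : ℝ}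

theorem le_of_touching (hc : 0 < c) (hlo : ∀ s r r', r ≤ r' → P s r' ≤ P s r - c * (r' - r))
    {α r : ℝ} (h : ∀ s, α * s ≤ P s r) {s' r' : ℝ} (h' : P s' r' ≤ α * s') : r ≤ r' := by
  by_contra hr
  push Not at hr
  have := hlo s' r' r hr.le
  have := h s'
  nlinarith

theorem touchingValue_eq (hc : 0 < c) (hlo : ∀ s r r', r ≤ r' → P s r' ≤ P s r - c * (r' - r))
    {α s r : ℝ} (h0 : P s r ≤ α * s) (h : ∀ s, α * s ≤ P s r) : touchingValue P α = r :=
  IsLeast.csInf_eq ⟨⟨s, h0⟩, fun _ ⟨_, hs'⟩ => le_of_touching hc hlo h hs'⟩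

/-- A line whose slope lies strictly between the asymptotic slopes of the pressure is a tangent
of `P(·, r)` for some `r`, obtained by minimising `r` on the compact sublevel set. -/
theorem exists_touching (hc : 0 < c) (hC : 0 < C) (hP : Continuous fun u : ℝ × ℝ => P u.1 u.2)
    (hlo : ∀ s r r', r ≤ r' → P s r' ≤ P s r - c * (r' - r))
    (hhi : ∀ s r r', r ≤ r' → P s r ≤ P s r' + C * (r' - r))
    {α α₁ α₂ c₁ c₂ : ℝ} (h1 : α₁ < α) (h2 : α < α₂) (hl1 : ∀ s, α₁ * s - c₁ ≤ P s 0)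
    (hl2 : ∀ s, α₂ * s - c₂ ≤ P s 0) :
    ∃ s r, P s r = α * s ∧ ∀ s', α * s' ≤ P s' r := by
  set r₁ := max (P 0 0 / c) 0 with hr₁
  have hr₁0 : 0 ≤ r₁ := le_max_right _ _
  have hP0 : P 0 r₁ ≤ 0 := by
    have h := hlo 0 0 r₁ hr₁0
    have : P 0 0 ≤ c * r₁ := by
      rw [← div_le_iff₀' hc]; exact le_max_left _ _
    linarith
  set δ := min (α₂ - α) (α - α₁) with hδ
  have hδ0 : 0 < δ := lt_min (by linarith) (by linarith)
  set K := max (max c₁ c₂) 0 with hK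
  have hK0 : 0 ≤ K := le_max_right _ _
  have hcoer : ∀ s, δ * |s| - K ≤ P s 0 - α * s := by
    intro s
    have hc₁ : c₁ ≤ K := (le_max_left _ _).trans (le_max_left _ _)
    have hc₂ : c₂ ≤ K := (le_max_right _ _).trans (le_max_left _ _)
    have hd1 : δ ≤ α₂ - α := min_le_left _ _
    have hd2 : δ ≤ α - α₁ := min_le_right _ _
    rcases le_total 0 s with hs | hs
    · rw [abs_of_nonneg hs]
      nlinarith [hl2 s]
    · rw [abs_of_nonpos hs]
      nlinarith [hl1 s]
  set S : Set (ℝ × ℝ) := {u | P u.1 u.2 ≤ α * u.1 ∧ u.2 ≤ r₁} with hS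
  have hSc : IsClosed S :=
    (isClosed_le hP (continuous_const.mul continuous_fst)).inter
      (isClosed_le continuous_snd continuous_const)
  have hSsub : S ⊆ Icc (-((K + C * r₁) / δ)) ((K + C * r₁) / δ) ×ˢ Icc (-(K / c)) r₁ := by
    rintro ⟨s, r⟩ ⟨hu1, hu2⟩
    simp only at hu1 hu2
    have h3 := hcoer s
    have hCr : 0 ≤ C * r₁ := by positivity
    have hs0 : 0 ≤ δ * |s| := by positivity
    have key : δ * |s| ≤ K + C * r₁ ∧ -(K / c) ≤ r := by
      have e : -(K / c) = -K / c := by ring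
      rw [e, div_le_iff₀ hc]
      rcases le_total 0 r with hr | hr
      · have := hhi s 0 r hr
        have : C * r ≤ C * r₁ := by gcongr
        constructor
        · linarith
        · nlinarith
      · have := hlo s r 0 hr
        constructor
        · nlinarith
        · nlinarith
    have h4 : |s| ≤ (K + C * r₁) / δ := by
      rw [le_div_iff₀ hδ0]; linarith [key.1]
    exact ⟨abs_le.1 h4, key.2, hu2⟩
  have hScomp : IsCompact S := (isCompact_Icc.prod isCompact_Icc).of_isClosed_subset hSc hSsub
  obtain ⟨⟨s₀, r₀⟩, hmem, hmin⟩ := hScomp.exists_isMinOn (f := Prod.snd)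
    ⟨(0, r₁), by simpa using hP0, le_rfl⟩ continuous_snd.continuousOn
  have htan : ∀ s', α * s' ≤ P s' r₀ := by
    intro s'
    by_contra hlt
    push Not at hlt
    set ε := (α * s' - P s' r₀) / C with hε
    have hε0 : 0 < ε := div_pos (by linarith) hC
    have h3 := hhi s' (r₀ - ε) r₀ (by linarith)
    have h4 : C * ε = α * s' - P s' r₀ := by rw [hε]; field_simp
    have h5 : (s', r₀ - ε) ∈ S := ⟨by simp only; linarith, by have := hmem.2; simp only at this ⊢; linarith⟩
    have h6 : r₀ ≤ r₀ - ε := hmin h5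
    linarith
  exact ⟨s₀, r₀, le_antisymm hmem.1 (htan s₀), htan⟩

/-- The touching value is left continuous at the right end of the interval of slopes. -/
theorem tendsto_touchingValue_left (hc : 0 < c) (hC : 0 < C)
    (hlo : ∀ s r r', r ≤ r' → P s r' ≤ P s r - c * (r' - r))
    (hhi : ∀ s r r', r ≤ r' → P s r ≤ P s r' + C * (r' - r))
    {A B : ℝ} (hAB : A < B)
    (hnn : ∀ α ∈ Icc A B, ∀ s r, P s r ≤ α * s → 0 ≤ r)
    (hex : ∀ α ∈ Ioo A B, ∃ s r, P s r = α * s ∧ ∀ s', α * s' ≤ P s' r) :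
    Tendsto (touchingValue P) (𝓝[<] B) (𝓝 (touchingValue P B)) := by
  have hbdd : ∀ α ∈ Icc A B, BddBelow {r | ∃ s, P s r ≤ α * s} := fun α hα =>
    ⟨0, fun r ⟨s, hs⟩ => hnn α hα s r hs⟩
  have hBm : B ∈ Icc A B := ⟨hAB.le, le_rfl⟩
  have hne : {r | ∃ s, P s r ≤ B * s}.Nonempty := by
    refine ⟨max (P 0 0 / c) 0, 0, ?_⟩
    have h := hlo 0 0 _ (le_max_right (P 0 0 / c) 0)
    have : P 0 0 ≤ c * max (P 0 0 / c) 0 := by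
      rw [← div_le_iff₀' hc]; exact le_max_left _ _
    linarith
  have hupper : ∀ ε > 0, ∀ᶠ α in 𝓝[<] B, touchingValue P α ≤ touchingValue P B + ε := by
    intro ε hε
    obtain ⟨r, ⟨s, hs⟩, hr⟩ := exists_lt_of_csInf_lt hne
      (lt_add_of_pos_right (touchingValue P B) (half_pos hε))
    have h1 : P s (r + ε / 2) < B * s := by
      have := hlo s r (r + ε / 2) (by linarith)
      have : 0 < c * (r + ε / 2 - r) := by
        rw [add_sub_cancel_left]; positivity
      linarith
    have h2 : ∀ᶠ α in 𝓝[<] B, P s (r + ε / 2) < α * s :=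
      (((continuous_id.mul continuous_const).tendsto' B (B * s) rfl).mono_left
        nhdsWithin_le_nhds).eventually_const_lt h1
    filter_upwards [h2, Ioo_mem_nhdsLT hAB] with α hα hαm
    have := csInf_le (hbdd α (Ioo_subset_Icc_self hαm)) ⟨s, hα.le⟩
    change touchingValue P α ≤ _ at this
    linarith
  have hlower : ∀ ε > 0, ∀ᶠ α in 𝓝[<] B, touchingValue P B ≤ touchingValue P α + ε := by
    intro ε hε
    -- a tangent of slope smaller than those considered bounds the contact points from the left
    obtain ⟨α₁, hα₁, hα₁B⟩ := exists_between hAB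
    obtain ⟨α₂, hα₂, hα₂B⟩ := exists_between hα₁B
    obtain ⟨s₁, r₁, -, htan⟩ := hex α₁ ⟨hα₁, hα₁B⟩
    set R := |touchingValue P B| + 1 + |r₁| with hR
    set M := C * R / (α₂ - α₁) with hM
    have hM0 : 0 ≤ M := by
      apply div_nonneg (by positivity) (by linarith)
    have h3 : ∀ᶠ α in 𝓝[<] B, (B - α) * M < c * ε := by
      have : Tendsto (fun α => (B - α) * M) (𝓝 B) (𝓝 0) :=
        ((continuous_const.sub continuous_id).mul continuous_const).tendsto' _ _ (by simp)
      exact (this.mono_left nhdsWithin_le_nhds).eventually_lt_const (by positivity)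
    filter_upwards [h3, hupper 1 one_pos, Ioo_mem_nhdsLT hα₂B] with α hα hup hαm
    have hαI : α ∈ Ioo A B := ⟨by linarith [hαm.1], hαm.2⟩
    obtain ⟨s, r, hsr, ht⟩ := hex α hαI
    have hr := touchingValue_eq hc hlo hsr.le ht
    have hr0 : 0 ≤ r := hnn α (Ioo_subset_Icc_self hαI) s r hsr.le
    rw [hr] at hup ⊢
    refine csInf_le (hbdd B hBm) ⟨s, ?_⟩
    have h4 := hlo s r (r + ε) (by linarith)
    rw [add_sub_cancel_left] at h4
    rcases le_total 0 s with hs | hs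
    · have : α * s ≤ B * s := mul_le_mul_of_nonneg_right hαm.2.le hs
      have : 0 < c * ε := by positivity
      linarith
    · have hdiff : α₁ * s - C * R ≤ P s r := by
        have h5 := htan s
        have h6 : r - r₁ ≤ R := by
          have := le_abs_self (touchingValue P B)
          have := neg_abs_le r₁
          linarith
        have hR0 : 0 ≤ C * R := by positivity
        rcases le_total r r₁ with h | h
        · have h7 := hlo s r r₁ h
          have : 0 ≤ c * (r₁ - r) := mul_nonneg hc.le (by linarith)
          linarith
        · have h7 := hhi s r₁ r h
          have : C * (r - r₁) ≤ C * R := by gcongr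
          linarith
      have hsM : -s ≤ M := by
        rw [hM, le_div_iff₀ (by linarith)]
        have : 0 ≤ (α - α₂) * (-s) := mul_nonneg (by linarith [hαm.1]) (by linarith)
        nlinarith
      have : (B - α) * (-s) ≤ (B - α) * M :=
        mul_le_mul_of_nonneg_left hsM (by linarith [hαm.2])
      nlinarith
  rw [Metric.tendsto_nhds]
  intro ε hε
  filter_upwards [hupper (ε / 2) (half_pos hε), hlower (ε / 2) (half_pos hε)] with α h1 h2
  rw [Real.dist_eq, abs_lt]
  constructor <;> linarith

theorem touchingValue_neg (P : ℝ → ℝ → ℝ) (α : ℝ) :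
    touchingValue (fun s r => P (-s) r) (-α) = touchingValue P α := by
  unfold touchingValue
  congr 1
  ext r
  exact ⟨fun ⟨s, hs⟩ => ⟨-s, by simpa using hs⟩, fun ⟨s, hs⟩ => ⟨-s, by simpa using hs⟩⟩

/-- The touching value is right continuous at the left end of the interval of slopes. -/
theorem tendsto_touchingValue_right (hc : 0 < c) (hC : 0 < C)
    (hlo : ∀ s r r', r ≤ r' → P s r' ≤ P s r - c * (r' - r))
    (hhi : ∀ s r r', r ≤ r' → P s r ≤ P s r' + C * (r' - r))
    {A B : ℝ} (hAB : A < B)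
    (hnn : ∀ α ∈ Icc A B, ∀ s r, P s r ≤ α * s → 0 ≤ r)
    (hex : ∀ α ∈ Ioo A B, ∃ s r, P s r = α * s ∧ ∀ s', α * s' ≤ P s' r) :
    Tendsto (touchingValue P) (𝓝[>] A) (𝓝 (touchingValue P A)) := by
  have h := tendsto_touchingValue_left (P := fun s r => P (-s) r) hc hC
    (fun s => hlo (-s)) (fun s => hhi (-s)) (neg_lt_neg hAB)
    (fun α hα s r hs => hnn (-α) ⟨by linarith [hα.2], by linarith [hα.1]⟩ (-s) r (by linarith))
    (fun α hα => by
      obtain ⟨s, r, h1, h2⟩ := hex (-α) ⟨by linarith [hα.2], by linarith [hα.1]⟩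
      exact ⟨-s, r, by simp [h1], fun s' => by have := h2 (-s'); linarith⟩)
  rw [touchingValue_neg] at h
  have h2 := h.comp (tendsto_neg_nhdsGT (a := A))
  refine h2.congr fun α => ?_
  simp [touchingValue_neg]

end Touching

/-! ### Markov chains on the symbols -/

/-- Pairs consisting of a probability vector and a stochastic matrix. -/
def markovPairs (m : ℕ) : Set ((Fin m → ℝ) × (Fin m → Fin m → ℝ)) :=
  stdSimplex ℝ (Fin m) ×ˢ Set.univ.pi fun _ => stdSimplex ℝ (Fin m)

/-- The law of the `j`-th state of the Markov chain with initial law `z.1` and transition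
matrix `z.2`. -/
def marginal {m : ℕ} (z : (Fin m → ℝ) × (Fin m → Fin m → ℝ)) : ℕ → Fin m → ℝ
  | 0 => z.1
  | j + 1 => fun b => ∑ a, marginal z j a * z.2 a b

/-- The discounted mean `(1 - 1/q) ∑_j q⁻ʲ E[g(X_j)]` along the Markov chain `X` given by `z`. -/
noncomputable def stateMean {m : ℕ} (q : ℕ) (z : (Fin m → ℝ) × (Fin m → Fin m → ℝ))
    (g : Fin m → ℝ) : ℝ :=
  (1 - 1 / q) * ∑' j, (1 / (q : ℝ)) ^ j * ∑ a, marginal z j a * g a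

/-- The discounted mean `(1 - 1/q) ∑_j q⁻ʲ E[f(X_j, X_{j+1})]`: the almost sure limit of
`(1/n) ∑_{k ≤ n} f(ω_k, ω_{qk})` when the sequences `(ω_{i qʲ})_j`, `q ∤ i`, are independent
copies of the chain. -/
noncomputable def pairMean {m : ℕ} (q : ℕ) (z : (Fin m → ℝ) × (Fin m → Fin m → ℝ))
    (f : Fin m → Fin m → ℝ) : ℝ :=
  stateMean q z fun a => ∑ b, z.2 a b * f a b

/-- The entropy, per unit of length, of the random sequence whose subsequences `(ω_{i qʲ})_j`,
`q ∤ i`, are independent copies of the Markov chain given by `z`. -/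
noncomputable def entropyRate {m : ℕ} (q : ℕ) (z : (Fin m → ℝ) × (Fin m → Fin m → ℝ)) : ℝ :=
  -((1 - 1 / q) * ∑ a, z.1 a * Real.log (z.1 a) +
    1 / q * pairMean q z fun a b => Real.log (z.2 a b))

section Markov

variable {m : ℕ} {q : ℕ} {z : (Fin m → ℝ) × (Fin m → Fin m → ℝ)}

theorem marginal_mem (hz : z ∈ markovPairs m) (j : ℕ) : marginal z j ∈ stdSimplex ℝ (Fin m) := by
  induction j with
  | zero => exact hz.1
  | succ j ih =>
    refine ⟨fun b => Finset.sum_nonneg fun a _ => mul_nonneg (ih.1 a) ((hz.2 a trivial).1 b), ?_⟩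
    simp only [marginal]
    rw [Finset.sum_comm]
    simp_rw [← Finset.mul_sum, (hz.2 _ trivial).2, mul_one]
    exact ih.2

theorem abs_sum_mul_le_of_mem_stdSimplex {v : Fin m → ℝ} (hv : v ∈ stdSimplex ℝ (Fin m))
    {g : Fin m → ℝ} {M : ℝ} (hg : ∀ a, |g a| ≤ M) : |∑ a, v a * g a| ≤ M := by
  calc |∑ a, v a * g a| ≤ ∑ a, |v a * g a| := Finset.abs_sum_le_sum_abs _ _
    _ ≤ ∑ a, v a * M := Finset.sum_le_sum fun a _ => by
        rw [abs_mul, abs_of_nonneg (hv.1 a)]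
        exact mul_le_mul_of_nonneg_left (hg a) (hv.1 a)
    _ = M := by rw [← Finset.sum_mul, hv.2, one_mul]

theorem summable_stateMean (hq : 2 ≤ q) (hz : z ∈ markovPairs m) (g : Fin m → ℝ) :
    Summable fun j => (1 / (q : ℝ)) ^ j * ∑ a, marginal z j a * g a := by
  have hq' : (2 : ℝ) ≤ q := by exact_mod_cast hq
  have hs : Summable fun j => (1 / (q : ℝ)) ^ j * ‖g‖ :=
    (summable_geometric_of_lt_one (by positivity)
      (by rw [div_lt_one] <;> linarith)).mul_right _
  refine Summable.of_norm_bounded hs fun j => ?_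
  rw [norm_mul, norm_pow, Real.norm_of_nonneg (by positivity : (0 : ℝ) ≤ 1 / q)]
  gcongr
  exact abs_sum_mul_le_of_mem_stdSimplex (marginal_mem hz j) fun a => norm_le_pi_norm g a

theorem stateMean_add (hq : 2 ≤ q) (hz : z ∈ markovPairs m) (g h : Fin m → ℝ) :
    stateMean q z (fun a => g a + h a) = stateMean q z g + stateMean q z h := by
  unfold stateMean
  rw [← mul_add, ← (summable_stateMean hq hz g).tsum_add (summable_stateMean hq hz h)]
  simp_rw [mul_add, Finset.sum_add_distrib, mul_add]

theorem stateMean_const_mul (c : ℝ) (g : Fin m → ℝ) :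
    stateMean q z (fun a => c * g a) = c * stateMean q z g := by
  unfold stateMean
  rw [mul_left_comm c, ← tsum_mul_left (a := c)]
  congr 2
  funext j
  rw [mul_left_comm c, Finset.mul_sum (a := c)]
  congr 1
  exact Finset.sum_congr rfl fun a _ => by ring

theorem pairMean_add (hq : 2 ≤ q) (hz : z ∈ markovPairs m) (f g : Fin m → Fin m → ℝ) :
    pairMean q z (fun a b => f a b + g a b) = pairMean q z f + pairMean q z g := by
  unfold pairMean
  rw [← stateMean_add hq hz]
  simp_rw [mul_add, Finset.sum_add_distrib]

theorem pairMean_const_mul (c : ℝ) (f : Fin m → Fin m → ℝ) :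
    pairMean q z (fun a b => c * f a b) = c * pairMean q z f := by
  unfold pairMean
  rw [← stateMean_const_mul]
  congr 1
  funext a
  rw [Finset.mul_sum]
  exact Finset.sum_congr rfl fun b _ => by ring

/-- The discounted mean of `q w(X_j) - w(X_{j+1})` telescopes. -/
theorem pairMean_eq_of_telescoping (hq : 2 ≤ q) (hz : z ∈ markovPairs m)
    {f : Fin m → Fin m → ℝ} {w : Fin m → ℝ}
    (h : ∀ a, q * w a = ∑ b, z.2 a b * (f a b + w b)) :
    pairMean q z f = (q - 1) * ∑ a, z.1 a * w a := by
  have hq' : (2 : ℝ) ≤ q := by exact_mod_cast hq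
  have hq0 : (q : ℝ) ≠ 0 := by linarith
  set x : ℕ → ℝ := fun j => ∑ a, marginal z j a * w a with hx
  have hterm : ∀ j, (1 / (q : ℝ)) ^ j * ∑ a, marginal z j a * ∑ b, z.2 a b * f a b =
      q * ((1 / (q : ℝ)) ^ j * x j) - q * ((1 / (q : ℝ)) ^ (j + 1) * x (j + 1)) := by
    intro j
    have h1 : x (j + 1) = ∑ a, marginal z j a * ∑ b, z.2 a b * w b := by
      simp only [hx, marginal, Finset.sum_mul, Finset.mul_sum]
      rw [Finset.sum_comm]
      exact Finset.sum_congr rfl fun a _ => Finset.sum_congr rfl fun b _ => by ring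
    have h2 : ∑ a, marginal z j a * ∑ b, z.2 a b * f a b = q * x j - x (j + 1) := by
      rw [h1]
      simp only [hx, Finset.mul_sum (a := (q : ℝ))]
      rw [← Finset.sum_sub_distrib]
      refine Finset.sum_congr rfl fun a _ => ?_
      have h3 := h a
      simp_rw [mul_add, Finset.sum_add_distrib] at h3
      rw [eq_sub_of_add_eq h3.symm]
      ring
    rw [h2, pow_succ]
    field_simp
  have hsx : Summable fun j => q * ((1 / (q : ℝ)) ^ j * x j) :=
    (summable_stateMean hq hz w).mul_left _
  unfold pairMean stateMean
  simp_rw [hterm]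
  have hsx' : Summable fun j => q * ((1 / (q : ℝ)) ^ (j + 1) * x (j + 1)) :=
    (summable_nat_add_iff 1).2 hsx
  rw [hsx.tsum_sub hsx', hsx.tsum_eq_zero_add]
  simp only [hx, marginal]
  field_simp
  ring

/-- For a chain that is Gibbs for `s Φ - r λ`, the entropy is `(P - s ⟨Φ⟩ + r ⟨λ⟩) / q`. -/
theorem entropyRate_gibbs [NeZero m] (hq : 2 ≤ q) (lam : Fin m → ℝ) (Φ : Fin m → Fin m → ℝ)
    (s r : ℝ) {a : Fin m → Fin m → ℝ} (ha : a = fun i j => -(r * lam i) + s * Φ i j) :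
    q * entropyRate q (gibbsInit q a, gibbsTrans q a) = matrixPressure q a -
      s * pairMean q (gibbsInit q a, gibbsTrans q a) Φ +
      r * pairMean q (gibbsInit q a, gibbsTrans q a) (fun i _ => lam i) := by
  have hq' : (2 : ℝ) ≤ q := by exact_mod_cast hq
  have hq0 : (q : ℝ) ≠ 0 := by linarith
  set z : (Fin m → ℝ) × (Fin m → Fin m → ℝ) := (gibbsInit q a, gibbsTrans q a) with hz
  have hzm : z ∈ markovPairs m := ⟨gibbsInit_mem q a, fun i _ => gibbsTrans_mem hq a i⟩
  set y := logSolution q a with hy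
  have h1 : pairMean q z (fun i j => Real.log (z.2 i j)) = s * pairMean q z Φ +
      -r * pairMean q z (fun i _ => lam i) + (q - 1) * ∑ i, z.1 i * -(y i) := by
    have h2 : pairMean q z (fun i j => y j + -(q * y i)) = (q - 1) * ∑ i, z.1 i * -(y i) := by
      refine pairMean_eq_of_telescoping hq hzm fun i => ?_
      have := (hzm.2 i trivial).2
      have e : ∀ j, y j + -(q * y i) + -y j = -(q * y i) := fun j => by ring
      simp_rw [e, ← Finset.sum_mul, this]
      ring
    rw [← pairMean_const_mul, ← pairMean_const_mul, ← h2, ← pairMean_add hq hzm,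
      ← pairMean_add hq hzm]
    congr 1
    funext i j
    have haij : a i j = -(r * lam i) + s * Φ i j := by rw [ha]
    simp only [hz, gibbsTrans, Real.log_exp, haij, hy]
    ring
  have h2 : ∑ i, z.1 i * Real.log (z.1 i) = ∑ i, z.1 i * y i - logSumExp y := by
    have : ∀ i, z.1 i * Real.log (z.1 i) = z.1 i * y i - z.1 i * logSumExp y := fun i => by
      simp only [hz, gibbsInit, Real.log_exp]
      ring
    simp_rw [this, Finset.sum_sub_distrib, ← Finset.sum_mul, hzm.1.2, one_mul]
  rw [entropyRate, h1, h2, matrixPressure, ← hy]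
  simp_rw [mul_neg, Finset.sum_neg_distrib]
  field_simp
  ring

theorem isCompact_markovPairs : IsCompact (markovPairs m) :=
  (isCompact_stdSimplex ℝ (Fin m)).prod (isCompact_univ_pi fun _ => isCompact_stdSimplex ℝ (Fin m))

theorem continuous_marginal (j : ℕ) :
    Continuous fun z : (Fin m → ℝ) × (Fin m → Fin m → ℝ) => marginal z j := by
  induction j with
  | zero => exact continuous_fst
  | succ j ih =>
    simp only [marginal]
    fun_prop

theorem continuousOn_stateMean (hq : 2 ≤ q)
    {g : (Fin m → ℝ) × (Fin m → Fin m → ℝ) → Fin m → ℝ} (hg : Continuous g) :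
    ContinuousOn (fun z => stateMean q z (g z)) (markovPairs m) := by
  have hq' : (2 : ℝ) ≤ q := by exact_mod_cast hq
  obtain ⟨M, hM⟩ := (isCompact_markovPairs (m := m)).exists_bound_of_continuousOn hg.continuousOn
  unfold stateMean
  refine continuousOn_const.mul (continuousOn_tsum (u := fun j => (1 / (q : ℝ)) ^ j * M)
    (fun j => ?_) ?_ fun j z hz => ?_)
  · have := continuous_marginal (m := m) j
    exact Continuous.continuousOn (by fun_prop)
  · exact (summable_geometric_of_lt_one (by positivity)
      (by rw [div_lt_one] <;> linarith)).mul_right _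
  · rw [norm_mul, norm_pow, Real.norm_of_nonneg (by positivity : (0 : ℝ) ≤ 1 / q)]
    gcongr
    exact abs_sum_mul_le_of_mem_stdSimplex (marginal_mem hz j) fun a =>
      (norm_le_pi_norm (g z) a).trans (hM z hz)

theorem continuousOn_pairMean (hq : 2 ≤ q) (f : Fin m → Fin m → ℝ) :
    ContinuousOn (fun z => pairMean q z f) (markovPairs m) :=
  continuousOn_stateMean hq (by fun_prop)

theorem continuousOn_entropyRate (hq : 2 ≤ q) :
    ContinuousOn (fun z => entropyRate q z) (markovPairs m) := by
  unfold entropyRate pairMean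
  refine ((continuousOn_const.mul (Continuous.continuousOn ?_)).add
    (continuousOn_const.mul (continuousOn_stateMean hq ?_))).neg
  · exact continuous_finsetSum _ fun a _ => Real.continuous_mul_log.comp (by fun_prop)
  · exact continuous_pi fun a => continuous_finsetSum _ fun b _ =>
      Real.continuous_mul_log.comp (by fun_prop)

/-- The pairs `(α, r)` for which some Markov chain has mean `α` for `Φ` and quotient `r / q` of
entropy by Lyapunov exponent. -/
def chainSpectrum (q : ℕ) (lam : Fin m → ℝ) (Φ : Fin m → Fin m → ℝ) : Set (ℝ × ℝ) :=
  {u | ∃ z ∈ markovPairs m, pairMean q z Φ = u.1 ∧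
    q * entropyRate q z = u.2 * pairMean q z fun i _ => lam i}

theorem isClosed_chainSpectrum (hq : 2 ≤ q) (lam : Fin m → ℝ) (Φ : Fin m → Fin m → ℝ) :
    IsClosed (chainSpectrum q lam Φ) := by
  refine IsSeqClosed.isClosed fun u v hu huv => ?_
  choose z hz hz1 hz2 using hu
  obtain ⟨w, hw, ψ, hψ, hlim⟩ := isCompact_markovPairs.tendsto_subseq hz
  have hlim' : Tendsto (z ∘ ψ) atTop (𝓝[markovPairs m] w) :=
    tendsto_nhdsWithin_iff.2 ⟨hlim, Eventually.of_forall fun n => hz (ψ n)⟩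
  have huψ := huv.comp hψ.tendsto_atTop
  have h1 := ((continuousOn_pairMean hq Φ) w hw).tendsto.comp hlim'
  have h2 := ((continuousOn_entropyRate hq) w hw).tendsto.comp hlim'
  have h3 := ((continuousOn_pairMean hq fun i _ => lam i) w hw).tendsto.comp hlim'
  refine ⟨w, hw, tendsto_nhds_unique h1 ?_, tendsto_nhds_unique (h2.const_mul (q : ℝ)) ?_⟩
  · exact ((continuous_fst.tendsto v).comp huψ).congr fun n => (hz1 (ψ n)).symm
  · exact (((continuous_snd.tendsto v).comp huψ).mul h3).congr fun n => (hz2 (ψ n)).symm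

theorem le_pairMean (hq : 2 ≤ q) (hz : z ∈ markovPairs m) {lam : Fin m → ℝ} {c : ℝ}
    (h : ∀ i, c ≤ lam i) : c ≤ pairMean q z fun i _ => lam i := by
  have hq' : (2 : ℝ) ≤ q := by exact_mod_cast hq
  have e : ∀ i, ∑ b, z.2 i b * lam i = lam i := fun i => by
    rw [← Finset.sum_mul, (hz.2 i trivial).2, one_mul]
  have hg : (1 / (q : ℝ)) < 1 := by rw [div_lt_one] <;> linarith
  unfold pairMean stateMean
  simp_rw [e]
  have h1 : ∑' j : ℕ, (1 / (q : ℝ)) ^ j * c ≤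
      ∑' j, (1 / (q : ℝ)) ^ j * ∑ a, marginal z j a * lam a := by
    refine Summable.tsum_le_tsum (fun j => ?_)
      ((summable_geometric_of_lt_one (by positivity) hg).mul_right _)
      (summable_stateMean hq hz lam)
    gcongr
    calc c = ∑ a, marginal z j a * c := by
          rw [← Finset.sum_mul, (marginal_mem hz j).2, one_mul]
      _ ≤ _ := Finset.sum_le_sum fun a _ =>
          mul_le_mul_of_nonneg_left (h a) ((marginal_mem hz j).1 a)
  rw [tsum_mul_right, tsum_geometric_of_lt_one (by positivity) hg] at h1
  calc c = (1 - 1 / (q : ℝ)) * ((1 - 1 / (q : ℝ))⁻¹ * c) := by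
        rw [mul_inv_cancel_left₀]; linarith
    _ ≤ _ := mul_le_mul_of_nonneg_left h1 (by linarith)

end Markov

/-! ### The law of a Markov chain -/

/-- The probability measure on the symbols with weights `v`. -/
noncomputable def symbolMeasure {m : ℕ} (v : stdSimplex ℝ (Fin m)) : Measure (Fin m) :=
  ∑ a, ENNReal.ofReal (v.1 a) • Measure.dirac a

theorem symbolMeasure_singleton {m : ℕ} (v : stdSimplex ℝ (Fin m)) (a : Fin m) :
    symbolMeasure v {a} = ENNReal.ofReal (v.1 a) := by
  simp [symbolMeasure, Set.indicator]

instance {m : ℕ} (v : stdSimplex ℝ (Fin m)) : IsProbabilityMeasure (symbolMeasure v) where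
  measure_univ := by
    simp only [symbolMeasure, Measure.coe_finsetSum, Measure.coe_smul, Finset.sum_apply,
      Pi.smul_apply, measure_univ, smul_eq_mul, mul_one]
    rw [← ENNReal.ofReal_sum_of_nonneg fun a _ => v.2.1 a, v.2.2, ENNReal.ofReal_one]

/-- The law of the `n`-th random self-map of the symbols in the construction of the Markov chain
by iterated random maps; the values at the different symbols are independent. -/
noncomputable def randomMapLaw {m : ℕ} (z : markovPairs m) : ℕ → Measure (Fin m → Fin m)
  | 0 => Measure.pi fun _ => symbolMeasure ⟨z.1.1, z.2.1⟩
  | _ + 1 => Measure.pi fun a => symbolMeasure ⟨z.1.2 a, z.2.2 a trivial⟩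

instance {m : ℕ} (z : markovPairs m) : ∀ n, IsProbabilityMeasure (randomMapLaw z n)
  | 0 => by unfold randomMapLaw; infer_instance
  | _ + 1 => by unfold randomMapLaw; infer_instance

/-- The orbit `X_0 = g_0(0)`, `X_{n+1} = g_{n+1}(X_n)` of a sequence of self-maps. -/
def randomOrbit {m : ℕ} [NeZero m] (g : ℕ → Fin m → Fin m) : ℕ → Fin m
  | 0 => g 0 0
  | n + 1 => g (n + 1) (randomOrbit g n)

section RandomMap

variable {m : ℕ}

theorem randomMapLaw_zero_eval (z : markovPairs m) (a b : Fin m) :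
    randomMapLaw z 0 {g | g a = b} = ENNReal.ofReal (z.1.1 b) := by
  have h := (measurePreserving_eval (fun _ : Fin m => symbolMeasure ⟨z.1.1, z.2.1⟩) a).measure_preimage
    (MeasurableSet.of_discrete (s := {b})).nullMeasurableSet
  rw [symbolMeasure_singleton] at h
  exact h

theorem randomMapLaw_succ_eval (z : markovPairs m) (n : ℕ) (a b : Fin m) :
    randomMapLaw z (n + 1) {g | g a = b} = ENNReal.ofReal (z.1.2 a b) := by
  have h := (measurePreserving_eval
    (fun a : Fin m => symbolMeasure ⟨z.1.2 a, z.2.2 a trivial⟩) a).measure_preimage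
    (MeasurableSet.of_discrete (s := {b})).nullMeasurableSet
  rw [symbolMeasure_singleton] at h
  exact h

end RandomMap

section Chain

variable {m : ℕ} [NeZero m]

theorem measurable_randomOrbit : Measurable (randomOrbit (m := m)) := by
  rw [measurable_pi_iff]
  intro n
  induction n with
  | zero =>
    exact (measurable_pi_apply (0 : Fin m)).comp (measurable_pi_apply (0 : ℕ))
  | succ n ih =>
    have h : Measurable fun u : (Fin m → Fin m) × Fin m => u.1 u.2 := Measurable.of_discrete
    exact h.comp ((measurable_pi_apply (n + 1)).prodMk ih)

/-- The law on sequences of symbols of the Markov chain given by `z`. -/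
noncomputable def chainLaw (z : markovPairs m) : Measure (ℕ → Fin m) :=
  (Measure.infinitePi (randomMapLaw z)).map randomOrbit

instance (z : markovPairs m) : IsProbabilityMeasure (chainLaw z) :=
  Measure.isProbabilityMeasure_map measurable_randomOrbit.aemeasurable

theorem chainLaw_cylinder (z : markovPairs m) (u : ℕ → Fin m) (l : ℕ) :
    chainLaw z {x | ∀ j ≤ l, x j = u j} =
      ENNReal.ofReal (z.1.1 (u 0) * ∏ j ∈ Finset.range l, z.1.2 (u j) (u (j + 1))) := by
  set prev : ℕ → Fin m := fun j => if j = 0 then 0 else u (j - 1) with hprev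
  have hmeas : MeasurableSet {x : ℕ → Fin m | ∀ j ≤ l, x j = u j} := by
    simp only [ofPred_forall]
    exact MeasurableSet.iInter fun j => MeasurableSet.iInter fun _ =>
      measurableSet_eq_fun (measurable_pi_apply j) measurable_const
  have hset : randomOrbit ⁻¹' {x : ℕ → Fin m | ∀ j ≤ l, x j = u j} =
      Set.pi (Finset.range (l + 1) : Set ℕ) fun j => {g : Fin m → Fin m | g (prev j) = u j} := by
    ext g
    simp only [mem_preimage, mem_ofPred_eq, Set.mem_pi, Finset.coe_range, mem_Iio,
      Order.lt_add_one_iff]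
    constructor
    · intro h j hj
      rcases j with _ | j
      · simpa [hprev, randomOrbit] using h 0 hj
      · have h1 := h (j + 1) hj
        rw [randomOrbit, h j (by lia)] at h1
        simpa [hprev] using h1
    · intro h j
      induction j with
      | zero => intro hj; simpa [hprev, randomOrbit] using h 0 hj
      | succ j ih =>
        intro hj
        have h1 := h (j + 1) hj
        rw [randomOrbit, ih (by lia)]
        simpa [hprev] using h1
  rw [chainLaw, Measure.map_apply measurable_randomOrbit hmeas, hset,
    Measure.infinitePi_pi _ fun i _ => MeasurableSet.of_discrete, Finset.prod_range_succ',
    ENNReal.ofReal_mul (z.2.1.1 _), ENNReal.ofReal_prod_of_nonneg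
      fun j _ => (z.2.2 _ trivial).1 _, mul_comm]
  congr 1
  · exact randomMapLaw_zero_eval z _ _
  · refine Finset.prod_congr rfl fun j _ => ?_
    rw [randomMapLaw_succ_eval]
    simp [hprev]

theorem randomOrbit_congr {g h : ℕ → Fin m → Fin m} {n : ℕ} (hgh : ∀ i ≤ n, g i = h i) :
    randomOrbit g n = randomOrbit h n := by
  induction n with
  | zero => simp [randomOrbit, hgh 0 le_rfl]
  | succ n ih => rw [randomOrbit, randomOrbit, ih fun i hi => hgh i (by lia), hgh _ le_rfl]

theorem indepFun_randomOrbit (z : markovPairs m) (n : ℕ) :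
    IndepFun (fun g => randomOrbit g n) (fun g : ℕ → Fin m → Fin m => g (n + 1))
      (Measure.infinitePi (randomMapLaw z)) := by
  have h1 : iIndepFun (fun (i : ℕ) (g : ℕ → Fin m → Fin m) => g i)
      (Measure.infinitePi (randomMapLaw z)) :=
    iIndepFun_infinitePi (X := fun _ x => x) fun _ => measurable_id
  have h2 := h1.indepFun_finset (Finset.range (n + 1)) {n + 1} (by simp)
    fun i => measurable_pi_apply i
  have h3 := h2.comp (φ := fun y : (i : Finset.range (n + 1)) → Fin m → Fin m =>
      randomOrbit (fun i => if hi : i ∈ Finset.range (n + 1) then y ⟨i, hi⟩ else fun _ => 0) n)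
    (ψ := fun y : (i : ({n + 1} : Finset ℕ)) → Fin m → Fin m => y ⟨n + 1, by simp⟩)
    Measurable.of_discrete Measurable.of_discrete
  have h4 : (fun g : ℕ → Fin m → Fin m => randomOrbit g n) = fun g => randomOrbit
      (fun i => if hi : i ∈ Finset.range (n + 1) then g i else fun _ => 0) n := by
    funext g
    refine randomOrbit_congr fun i hi => ?_
    simp [Nat.lt_succ_of_le hi]
  rw [h4]
  exact h3

theorem randomOrbit_step (z : markovPairs m) (n : ℕ) (a b : Fin m) :
    Measure.infinitePi (randomMapLaw z) {g | randomOrbit g n = a ∧ randomOrbit g (n + 1) = b} =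
      Measure.infinitePi (randomMapLaw z) {g | randomOrbit g n = a} *
        ENNReal.ofReal (z.1.2 a b) := by
  have h := (indepFun_randomOrbit z n).measure_inter_preimage_eq_mul {a} {g | g a = b}
    MeasurableSet.of_discrete MeasurableSet.of_discrete
  have h2 : Measure.infinitePi (randomMapLaw z)
      ((fun g : ℕ → Fin m → Fin m => g (n + 1)) ⁻¹' {g | g a = b}) =
      ENNReal.ofReal (z.1.2 a b) := by
    rw [(measurePreserving_eval_infinitePi (randomMapLaw z) (n + 1)).measure_preimage
      MeasurableSet.of_discrete.nullMeasurableSet, randomMapLaw_succ_eval]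
  rw [h2] at h
  rw [show {g : ℕ → Fin m → Fin m | randomOrbit g n = a} =
    (fun g => randomOrbit g n) ⁻¹' {a} from rfl, ← h]
  congr 1
  ext g
  simp only [mem_ofPred_eq, mem_inter_iff, mem_preimage, mem_singleton_iff, randomOrbit]
  constructor <;> rintro ⟨rfl, hb⟩ <;> exact ⟨rfl, hb⟩

theorem randomOrbit_marginal (z : markovPairs m) (n : ℕ) (a : Fin m) :
    Measure.infinitePi (randomMapLaw z) {g | randomOrbit g n = a} =
      ENNReal.ofReal (marginal z.1 n a) := by
  induction n generalizing a with
  | zero =>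
    have := (measurePreserving_eval_infinitePi (randomMapLaw z) 0).measure_preimage
      (MeasurableSet.of_discrete (s := {g : Fin m → Fin m | g 0 = a})).nullMeasurableSet
    rw [randomMapLaw_zero_eval] at this
    exact this
  | succ n ih =>
    have hU : {g : ℕ → Fin m → Fin m | randomOrbit g (n + 1) = a} =
        ⋃ b ∈ Finset.univ, {g | randomOrbit g n = b ∧ randomOrbit g (n + 1) = a} := by
      ext g; simp
    have hm : ∀ k c, MeasurableSet {g : ℕ → Fin m → Fin m | randomOrbit g k = c} := fun k c =>
      measurableSet_eq_fun ((measurable_pi_apply k).comp measurable_randomOrbit) measurable_const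
    rw [hU, measure_biUnion_finset]
    · simp_rw [randomOrbit_step, ih, marginal]
      rw [ENNReal.ofReal_sum_of_nonneg fun b _ =>
        mul_nonneg ((marginal_mem z.2 n).1 b) ((z.2.2 b trivial).1 a)]
      exact Finset.sum_congr rfl fun b _ =>
        (ENNReal.ofReal_mul ((marginal_mem z.2 n).1 b)).symm
    · intro b _ c _ hbc
      exact Set.disjoint_left.2 fun g hg hg' => hbc (hg.1.symm.trans hg'.1)
    · exact fun b _ => (hm n b).inter (hm (n + 1) a)

theorem integral_chainLaw (z : markovPairs m) (f : Fin m → Fin m → ℝ) (n : ℕ) :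
    ∫ x, f (x n) (x (n + 1)) ∂(chainLaw z) =
      ∑ a, marginal z.1 n a * ∑ b, z.1.2 a b * f a b := by
  set X : (ℕ → Fin m → Fin m) → Fin m × Fin m :=
    fun g => (randomOrbit g n, randomOrbit g (n + 1)) with hX
  have hXm : Measurable X := ((measurable_pi_apply n).comp measurable_randomOrbit).prodMk
    ((measurable_pi_apply (n + 1)).comp measurable_randomOrbit)
  have hfm : Measurable fun x : ℕ → Fin m => f (x n) (x (n + 1)) :=
    Measurable.comp (g := fun u : Fin m × Fin m => f u.1 u.2)
      (f := fun x : ℕ → Fin m => (x n, x (n + 1))) Measurable.of_discrete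
      ((measurable_pi_apply n).prodMk (measurable_pi_apply (n + 1)))
  have : IsProbabilityMeasure ((Measure.infinitePi (randomMapLaw z)).map X) :=
    Measure.isProbabilityMeasure_map hXm.aemeasurable
  rw [chainLaw, integral_map measurable_randomOrbit.aemeasurable hfm.aestronglyMeasurable]
  change ∫ g, (fun u : Fin m × Fin m => f u.1 u.2) (X g) ∂_ = _
  rw [← integral_map (f := fun u : Fin m × Fin m => f u.1 u.2) hXm.aemeasurable
      Measurable.of_discrete.aestronglyMeasurable,
    integral_fintype Integrable.of_finite, Fintype.sum_prod_type]
  refine Finset.sum_congr rfl fun a _ => ?_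
  rw [Finset.mul_sum]
  refine Finset.sum_congr rfl fun b _ => ?_
  have hpre : X ⁻¹' {(a, b)} = {g | randomOrbit g n = a ∧ randomOrbit g (n + 1) = b} := by
    ext g; simp [hX]
  rw [Measure.real, Measure.map_apply hXm (measurableSet_singleton _), hpre, randomOrbit_step,
    randomOrbit_marginal, ENNReal.toReal_mul, ENNReal.toReal_ofReal ((marginal_mem z.2 n).1 a),
    ENNReal.toReal_ofReal ((z.2.2 a trivial).1 b), smul_eq_mul, mul_assoc]

end Chain

/-! ### Independent chains along the geometric progressions of ratio `q` -/

/-- The sequence whose restriction to `{i qʲ : j ≥ 0}` is `ξ i`, for every `i` not divisible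
by `q`. -/
def interleave {m : ℕ} (q : ℕ) (ξ : ℕ → ℕ → Fin m) (k : ℕ) : Fin m :=
  ξ (k.divMaxPow q) (padicValNat q k)

theorem divMaxPow_mul_pow {q i : ℕ} (hq : 2 ≤ q) (hi : ¬ q ∣ i) (j : ℕ) :
    (i * q ^ j).divMaxPow q = i ∧ padicValNat q (i * q ^ j) = j := by
  have hi0 : i ≠ 0 := fun h => hi (h ▸ dvd_zero q)
  rw [mul_comm, Nat.divMaxPow_base_pow_mul (by lia), padicValNat_base_pow_mul (by lia) hi0]
  have h1 : padicValNat q i = 0 := by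
    by_contra h
    have h2 := (Nat.pow_dvd_iff_le_padicValNat (p := q) (k := 1) (by lia) hi0).2 (by lia)
    rw [pow_one] at h2
    exact hi h2
  have h2 := Nat.divMaxPow_mul_pow_padicValNat q i
  rw [h1, pow_zero, mul_one] at h2
  exact ⟨h2, by rw [h1, zero_add]⟩

theorem interleave_mul_pow {m q i : ℕ} (hq : 2 ≤ q) (hi : ¬ q ∣ i) (ξ : ℕ → ℕ → Fin m) (j : ℕ) :
    interleave q ξ (i * q ^ j) = ξ i j := by
  obtain ⟨h1, h2⟩ := divMaxPow_mul_pow hq hi j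
  rw [interleave, h1, h2]

theorem measurable_interleave {m q : ℕ} : Measurable (interleave (m := m) q) :=
  measurable_pi_iff.2 fun k =>
    (measurable_pi_apply (padicValNat q k)).comp (measurable_pi_apply (k.divMaxPow q))

theorem sum_filter_dvd {M : Type*} [AddCommMonoid M] {q : ℕ} (hq : 0 < q) (n : ℕ) (f : ℕ → M) :
    ∑ k ∈ Finset.Icc 1 n with q ∣ k, f k = ∑ k ∈ Finset.Icc 1 (n / q), f (q * k) := by
  symm
  refine Finset.sum_nbij' (fun k => q * k) (fun k => k / q) ?_ ?_ ?_ ?_ ?_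
  · intro k hk
    rw [Finset.mem_Icc] at hk
    rw [Finset.mem_filter, Finset.mem_Icc]
    refine ⟨⟨Nat.mul_pos hq hk.1, ?_⟩, dvd_mul_right _ _⟩
    rw [mul_comm]
    exact (Nat.le_div_iff_mul_le hq).1 hk.2
  · intro k hk
    rw [Finset.mem_filter, Finset.mem_Icc] at hk
    rw [Finset.mem_Icc]
    exact ⟨Nat.div_pos (Nat.le_of_dvd (by lia) hk.2) hq, Nat.div_le_div_right hk.1.2⟩
  · intro k _
    exact Nat.mul_div_cancel_left k hq
  · intro k hk
    rw [Finset.mem_filter] at hk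
    exact Nat.mul_div_cancel' hk.2
  · intro k _
    rfl

/-- The probability of the word `u_1 ... u_n` under the interleaving of independent copies of the
Markov chain given by `z`. -/
noncomputable def wordWeight {m : ℕ} (q : ℕ) (z : (Fin m → ℝ) × (Fin m → Fin m → ℝ)) (n : ℕ)
    (u : ℕ → Fin m) : ℝ :=
  (∏ k ∈ Finset.Icc 1 n with ¬ q ∣ k, z.1 (u k)) *
    ∏ k ∈ Finset.Icc 1 (n / q), z.2 (u k) (u (q * k))

/-- The product over the positions up to `n / q` regrouped along the progressions `i qʲ`. -/
theorem prod_regroup {M : Type*} [CommMonoid M] {q : ℕ} (hq : 2 ≤ q) (n : ℕ) (f : ℕ → M) :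
    ∏ i ∈ Finset.Icc 1 n with ¬ q ∣ i, ∏ j ∈ Finset.range (Nat.log q (n / i)), f (i * q ^ j) =
      ∏ k ∈ Finset.Icc 1 (n / q), f k := by
  have hlt : ∀ i j, 1 ≤ i → i ≤ n → (j < Nat.log q (n / i) ↔ i * q ^ j ≤ n / q) := by
    intro i j hi hin
    rw [Nat.lt_iff_add_one_le, Nat.le_log_iff_pow_le (by lia) (Nat.div_pos hin hi).ne',
      Nat.le_div_iff_mul_le hi, Nat.le_div_iff_mul_le (by lia), pow_succ]
    rw [show q ^ j * q * i = i * q ^ j * q by ring]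
  rw [Finset.prod_sigma']
  refine Finset.prod_nbij' (fun x => x.1 * q ^ x.2)
    (fun k => ⟨k.divMaxPow q, padicValNat q k⟩) ?_ ?_ ?_ ?_ ?_
  · rintro ⟨i, j⟩ h
    simp only [Finset.mem_sigma, Finset.mem_filter, Finset.mem_Icc, Finset.mem_range] at h ⊢
    exact ⟨Nat.mul_pos (by lia) (by positivity), (hlt i j h.1.1.1 h.1.1.2).1 h.2⟩
  · intro k hk
    simp only [Finset.mem_sigma, Finset.mem_filter, Finset.mem_Icc, Finset.mem_range] at hk ⊢
    have h1 := Nat.divMaxPow_mul_pow_padicValNat q k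
    have h2 : ¬ q ∣ k.divMaxPow q := Nat.not_dvd_divMaxPow (by lia) (by lia)
    have h3 : 1 ≤ k.divMaxPow q := Nat.one_le_iff_ne_zero.2 fun h => h2 (h ▸ dvd_zero q)
    have h4 : k.divMaxPow q ≤ n :=
      ((Nat.le_mul_of_pos_right _ (by positivity)).trans h1.le).trans
        (hk.2.trans (Nat.div_le_self n q))
    exact ⟨⟨⟨h3, h4⟩, h2⟩, (hlt _ _ h3 h4).2 (h1.le.trans hk.2)⟩
  · rintro ⟨i, j⟩ h
    simp only [Finset.mem_sigma, Finset.mem_filter] at h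
    obtain ⟨h1, h2⟩ := divMaxPow_mul_pow hq h.1.2 j
    simp only [h1, h2]
  · intro k _
    exact Nat.divMaxPow_mul_pow_padicValNat q k
  · intro x _
    rfl

section Product

variable {m : ℕ} [NeZero m] {q : ℕ}

/-- The law of a sequence of independent copies of the Markov chain given by `z`. -/
noncomputable def chainsLaw (z : markovPairs m) : Measure (ℕ → ℕ → Fin m) :=
  Measure.infinitePi fun _ => chainLaw z

instance (z : markovPairs m) : IsProbabilityMeasure (chainsLaw z) := by
  unfold chainsLaw; infer_instance

theorem chainsLaw_cylinder (hq : 2 ≤ q) (z : markovPairs m) (u : ℕ → Fin m) (n : ℕ) :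
    chainsLaw z {ξ | ∀ k ∈ Finset.Icc 1 n, interleave q ξ k = u k} =
      ENNReal.ofReal (wordWeight q z.1 n u) := by
  have hset : {ξ | ∀ k ∈ Finset.Icc 1 n, interleave q ξ k = u k} =
      Set.pi ((Finset.Icc 1 n).filter fun i => ¬ q ∣ i : Finset ℕ) fun i =>
        {x : ℕ → Fin m | ∀ j ≤ Nat.log q (n / i), x j = u (i * q ^ j)} := by
    ext ξ
    simp only [mem_ofPred_eq, Set.mem_pi, Finset.coe_filter, Finset.mem_Icc]
    have hle : ∀ i j, 1 ≤ i → i ≤ n → (j ≤ Nat.log q (n / i) ↔ i * q ^ j ≤ n) := by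
      intro i j hi hin
      rw [Nat.le_log_iff_pow_le (by lia) (Nat.div_pos hin hi).ne',
        Nat.le_div_iff_mul_le hi, mul_comm]
    constructor
    · rintro h i ⟨⟨hi, hin⟩, hqi⟩ j hj
      rw [← h _ ⟨Nat.mul_pos hi (by positivity), (hle i j hi hin).1 hj⟩,
        interleave_mul_pow hq hqi]
    · rintro h k ⟨hk, hkn⟩
      have h1 := Nat.divMaxPow_mul_pow_padicValNat q k
      have h2 : ¬ q ∣ k.divMaxPow q := Nat.not_dvd_divMaxPow (by lia) (by lia)
      have h3 : 1 ≤ k.divMaxPow q := Nat.one_le_iff_ne_zero.2 fun h => h2 (h ▸ dvd_zero q)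
      have h4 : k.divMaxPow q ≤ n :=
        ((Nat.le_mul_of_pos_right _ (by positivity)).trans h1.le).trans hkn
      have := h _ ⟨⟨h3, h4⟩, h2⟩ (padicValNat q k) ((hle _ _ h3 h4).2 (h1.le.trans hkn))
      rw [h1] at this
      exact this
  have hmeas : ∀ i, MeasurableSet
      {x : ℕ → Fin m | ∀ j ≤ Nat.log q (n / i), x j = u (i * q ^ j)} := fun i => by
    simp only [ofPred_forall]
    exact MeasurableSet.iInter fun j => MeasurableSet.iInter fun _ =>
      measurableSet_eq_fun (measurable_pi_apply j) measurable_const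
  rw [hset, chainsLaw, Measure.infinitePi_pi _ fun i _ => hmeas i]
  have h1 : ∀ i, chainLaw z {x : ℕ → Fin m | ∀ j ≤ Nat.log q (n / i), x j = u (i * q ^ j)} =
      ENNReal.ofReal (z.1.1 (u i) * ∏ j ∈ Finset.range (Nat.log q (n / i)),
        z.1.2 (u (i * q ^ j)) (u (q * (i * q ^ j)))) := fun i => by
    rw [chainLaw_cylinder z fun j => u (i * q ^ j)]
    simp only [pow_zero, mul_one, pow_succ]
    congr 2
    exact Finset.prod_congr rfl fun j _ => by rw [show i * (q ^ j * q) = q * (i * q ^ j) by ring]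
  simp_rw [h1]
  rw [← ENNReal.ofReal_prod_of_nonneg fun i _ => mul_nonneg (z.2.1.1 _)
    (Finset.prod_nonneg fun j _ => (z.2.2 _ trivial).1 _), Finset.prod_mul_distrib,
    prod_regroup hq n fun k => z.1.2 (u k) (u (q * k))]
  rfl

/-- The strong law of large numbers for the `j`-th steps of the chains with indices `e 0, e 1, …`. -/
theorem ae_tendsto_average_step (z : markovPairs m) (f : Fin m → Fin m → ℝ) (j : ℕ) {e : ℕ → ℕ}
    (he : Function.Injective e) :
    ∀ᵐ ξ ∂(chainsLaw z), Tendsto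
      (fun n : ℕ => (∑ i ∈ Finset.range n, f (ξ (e i) j) (ξ (e i) (j + 1))) / n) atTop
      (𝓝 (∑ a, marginal z.1 j a * ∑ b, z.1.2 a b * f a b)) := by
  set h : (ℕ → Fin m) → ℝ := fun x => f (x j) (x (j + 1)) with hh
  have hm : Measurable h := Measurable.comp (g := fun u : Fin m × Fin m => f u.1 u.2)
      (f := fun x : ℕ → Fin m => (x j, x (j + 1))) Measurable.of_discrete
      ((measurable_pi_apply j).prodMk (measurable_pi_apply (j + 1)))
  have hmp : ∀ i, MeasurePreserving (Function.eval i) (chainsLaw z) (chainLaw z) := fun i =>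
    measurePreserving_eval_infinitePi _ i
  have hident : ∀ i, IdentDistrib (fun ξ : ℕ → ℕ → Fin m => h (ξ i)) h (chainsLaw z)
      (chainLaw z) := fun i =>
    ⟨(hm.comp (measurable_pi_apply i)).aemeasurable, hm.aemeasurable, by
      rw [← (hmp i).map_eq, Measure.map_map hm (measurable_pi_apply i)]
      rfl⟩
  have hind : iIndepFun (fun (i : ℕ) (ξ : ℕ → ℕ → Fin m) => h (ξ i)) (chainsLaw z) :=
    iIndepFun_infinitePi (X := fun _ x => h x) fun _ => hm
  obtain ⟨M, hM⟩ := (Set.finite_range fun u : Fin m × Fin m => f u.1 u.2).isBounded.exists_norm_le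
  have hint : Integrable h (chainLaw z) :=
    Integrable.of_bound hm.aestronglyMeasurable M
      (Eventually.of_forall fun x => hM _ ⟨(x j, x (j + 1)), rfl⟩)
  have := strong_law_ae_real (fun i (ξ : ℕ → ℕ → Fin m) => h (ξ (e i)))
    ((hident (e 0)).integrable_iff.2 hint)
    (fun i k hik => hind.indepFun (he.ne hik))
    (fun i => (hident (e i)).trans (hident (e 0)).symm)
  have hval : ∫ ξ, h (ξ (e 0)) ∂(chainsLaw z) = ∑ a, marginal z.1 j a * ∑ b, z.1.2 a b * f a b := by
    rw [(hident (e 0)).integral_eq]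
    exact integral_chainLaw z f j
  rw [hval] at this
  exact this

end Product

theorem tendsto_natDiv_div {c : ℕ} (hc : 0 < c) :
    Tendsto (fun n : ℕ => ((n / c : ℕ) : ℝ) / n) atTop (𝓝 (1 / c)) := by
  have h := (tendsto_nat_floor_mul_div_atTop (R := ℝ) (a := 1 / c) (by positivity)).comp
    tendsto_natCast_atTop_atTop
  refine h.congr fun n => ?_
  simp only [Function.comp]
  rw [one_div, inv_mul_eq_div, Nat.floor_div_eq_div]

theorem natDiv_tendsto_atTop {c : ℕ} (hc : 0 < c) : Tendsto (fun n : ℕ => n / c) atTop atTop :=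
  tendsto_atTop_atTop.2 fun b => ⟨b * c, fun _ hn => (Nat.le_div_iff_mul_le hc).2 hn⟩

theorem tendsto_comp_natDiv {c : ℕ} (hc : 0 < c) {x : ℕ → ℝ} {l : ℝ}
    (hx : Tendsto (fun n : ℕ => x n / n) atTop (𝓝 l)) :
    Tendsto (fun n : ℕ => x (n / c) / n) atTop (𝓝 (l * (1 / c))) := by
  refine ((hx.comp (natDiv_tendsto_atTop hc)).mul (tendsto_natDiv_div hc)).congr' ?_
  filter_upwards [(natDiv_tendsto_atTop hc).eventually_gt_atTop 0] with n hn
  have h : ((n / c : ℕ) : ℝ) ≠ 0 := by exact_mod_cast hn.ne'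
  simp only [Function.comp]
  field_simp

/-- Averages obeying the renormalisation `F_j(n) = U_j(n) + F_{j+1}(n / q)` converge as soon as the
averages of the `U_j` do. -/
theorem tendsto_of_renormalisation {q : ℕ} (hq : 2 ≤ q) {F U : ℕ → ℕ → ℝ} {v : ℕ → ℝ} {M : ℝ}
    (hF0 : ∀ j, F j 0 = 0) (hrec : ∀ j n, F j n = U j n + F (j + 1) (n / q))
    (hU : ∀ j n, |U j n| ≤ M * n) (hlim : ∀ j, Tendsto (fun n : ℕ => U j n / n) atTop (𝓝 (v j))) :
    Tendsto (fun n : ℕ => F 0 n / n) atTop (𝓝 (∑' j, (1 / (q : ℝ)) ^ j * v j)) := by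
  have hq' : (2 : ℝ) ≤ q := by exact_mod_cast hq
  have hg : (1 / (q : ℝ)) < 1 := by rw [div_lt_one] <;> linarith
  have hM : 0 ≤ M := by simpa using (abs_nonneg _).trans (hU 0 1)
  have hU0 : ∀ j, U j 0 = 0 := fun j => by simpa using hU j 0
  have hsum : ∀ n J, F 0 n = ∑ j ∈ Finset.range J, U j (n / q ^ j) + F J (n / q ^ J) := by
    intro n J
    induction J with
    | zero => simp
    | succ J ih =>
      rw [ih, hrec J, Finset.sum_range_succ, Nat.div_div_eq_div_mul, pow_succ, add_assoc]
  have hts : ∀ n : ℕ, F 0 n / n = ∑' j, U j (n / q ^ j) / n := by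
    intro n
    have hz : ∀ j, n ≤ j → n / q ^ j = 0 := fun j hj =>
      Nat.div_eq_of_lt ((Nat.lt_pow_self (by lia)).trans_le (Nat.pow_le_pow_right (by lia) hj))
    rw [hsum n n, hz n le_rfl, hF0, add_zero, Finset.sum_div, tsum_eq_sum]
    intro j hj
    rw [hz j (by simpa using hj), hU0, zero_div]
  simp_rw [hts]
  refine tendsto_tsum_of_dominated_convergence (bound := fun j => (1 / (q : ℝ)) ^ j * M)
    ((summable_geometric_of_lt_one (by positivity) hg).mul_right _) (fun j => ?_)
    (Eventually.of_forall fun n j => ?_)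
  · have := tendsto_comp_natDiv (c := q ^ j) (by positivity) (hlim j)
    refine this.congr' (Eventually.of_forall fun n => rfl) |>.trans (le_of_eq ?_)
    congr 1
    push_cast
    rw [one_div_pow, mul_comm]
  · rw [norm_div, Real.norm_eq_abs, Real.norm_natCast]
    rcases Nat.eq_zero_or_pos n with rfl | hn
    · simp; positivity
    · rw [div_le_iff₀ (by exact_mod_cast hn)]
      refine (hU j _).trans ?_
      have h1 : ((n / q ^ j : ℕ) : ℝ) ≤ n / (q : ℝ) ^ j := by
        simpa using (Nat.cast_div_le (α := ℝ) (m := n) (n := q ^ j))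
      calc M * ((n / q ^ j : ℕ) : ℝ) ≤ M * (n / (q : ℝ) ^ j) := by gcongr
        _ = (1 / (q : ℝ)) ^ j * M * n := by rw [one_div_pow]; ring

section LawOfLargeNumbers

variable {m : ℕ} [NeZero m] {q : ℕ}

theorem sum_filter_not_dvd (hq : 0 < q) (n : ℕ) (f : ℕ → ℝ) :
    ∑ k ∈ Finset.Icc 1 n with ¬ q ∣ k, f k =
      ∑ k ∈ Finset.Icc 1 n, f k - ∑ k ∈ Finset.Icc 1 (n / q), f (q * k) := by
  rw [← sum_filter_dvd hq, ← Finset.sum_filter_add_sum_filter_not (Finset.Icc 1 n) (q ∣ ·)]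
  ring

theorem sum_Icc_one_eq_sum_range (n : ℕ) (f : ℕ → ℝ) :
    ∑ k ∈ Finset.Icc 1 n, f k = ∑ k ∈ Finset.range n, f (k + 1) := by
  rw [Finset.range_eq_Ico, Finset.sum_Ico_add' f 0 n 1]
  rfl

/-- Averages over the chains whose index is not divisible by `q`. -/
theorem ae_tendsto_average_not_dvd (hq : 2 ≤ q) (z : markovPairs m) (f : Fin m → Fin m → ℝ)
    (j : ℕ) :
    ∀ᵐ ξ ∂(chainsLaw z), Tendsto
      (fun n : ℕ => (∑ i ∈ Finset.Icc 1 n with ¬ q ∣ i, f (ξ i j) (ξ i (j + 1))) / n) atTop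
      (𝓝 ((1 - 1 / q) * ∑ a, marginal z.1 j a * ∑ b, z.1.2 a b * f a b)) := by
  have h1 := ae_tendsto_average_step z f j (e := fun i => i + 1) (add_left_injective 1)
  have h2 := ae_tendsto_average_step z f j (e := fun i => q * (i + 1))
    fun a b hab => by
      have := Nat.eq_of_mul_eq_mul_left (by lia) hab
      lia
  filter_upwards [h1, h2] with ξ h1 h2
  have h3 := h1.sub (tendsto_comp_natDiv (c := q) (by lia)
    (x := fun n => ∑ i ∈ Finset.range n, f (ξ (q * (i + 1)) j) (ξ (q * (i + 1)) (j + 1))) h2)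
  convert h3 using 1
  · funext n
    rw [sum_filter_not_dvd (by lia) n fun i => f (ξ i j) (ξ i (j + 1)), sum_Icc_one_eq_sum_range,
      sum_Icc_one_eq_sum_range, sub_div]
  · congr 1; ring

theorem ae_tendsto_pairAverage (hq : 2 ≤ q) (z : markovPairs m) (f : Fin m → Fin m → ℝ) :
    ∀ᵐ ξ ∂(chainsLaw z), Tendsto
      (fun n : ℕ => (∑ k ∈ Finset.Icc 1 n, f (interleave q ξ k) (interleave q ξ (q * k))) / n)
      atTop (𝓝 (pairMean q z.1 f)) := by
  have hall := ae_all_iff.2 fun j => ae_tendsto_average_not_dvd hq z f j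
  filter_upwards [hall] with ξ hξ
  set M := ∑ a, ∑ b, |f a b| with hM
  have hfM : ∀ a b, |f a b| ≤ M := fun a b =>
    (Finset.single_le_sum (f := fun b => |f a b|) (fun _ _ => abs_nonneg _)
      (Finset.mem_univ b)).trans
      (Finset.single_le_sum (f := fun a => ∑ b, |f a b|)
        (fun _ _ => Finset.sum_nonneg fun _ _ => abs_nonneg _) (Finset.mem_univ a))
  have hM0 : 0 ≤ M := (abs_nonneg _).trans (hfM 0 0)
  have h := tendsto_of_renormalisation hq (M := M)
    (F := fun j n => ∑ k ∈ Finset.Icc 1 n,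
      f (interleave q ξ (k * q ^ j)) (interleave q ξ (k * q ^ (j + 1))))
    (U := fun j n => ∑ i ∈ Finset.Icc 1 n with ¬ q ∣ i, f (ξ i j) (ξ i (j + 1)))
    (fun j => by simp) (fun j n => ?_) (fun j n => ?_) hξ
  · simp only [pow_zero, mul_one, zero_add, pow_one] at h
    simp_rw [mul_comm q]
    convert h using 2
    unfold pairMean stateMean
    rw [← tsum_mul_left]
    congr 1
    funext j
    ring
  · rw [← Finset.sum_filter_add_sum_filter_not (Finset.Icc 1 n) (q ∣ ·), add_comm]
    congr 1
    · refine Finset.sum_congr rfl fun i hi => ?_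
      have hi' := (Finset.mem_filter.1 hi).2
      rw [interleave_mul_pow hq hi', interleave_mul_pow hq hi']
    · rw [sum_filter_dvd (by lia)]
      refine Finset.sum_congr rfl fun i _ => ?_
      rw [show q * i * q ^ j = i * q ^ (j + 1) by ring,
        show q * i * q ^ (j + 1) = i * q ^ (j + 1 + 1) by ring]
  · calc _ ≤ ∑ i ∈ Finset.Icc 1 n with ¬ q ∣ i, |f (ξ i j) (ξ i (j + 1))| :=
        Finset.abs_sum_le_sum_abs _ _
      _ ≤ ∑ i ∈ Finset.Icc 1 n with ¬ q ∣ i, M := Finset.sum_le_sum fun i _ => hfM _ _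
      _ ≤ ∑ i ∈ Finset.Icc 1 n, M :=
        Finset.sum_le_sum_of_subset_of_nonneg (Finset.filter_subset _ _) fun _ _ _ => hM0
      _ = M * n := by simp [mul_comm]

end LawOfLargeNumbers

/-! ### Coding of the Cookie-Cutter set -/

/-- `α` is the limit of the averages of `Φ(ω_k, ω_{qk})`. -/
def HasPairAverage {m : ℕ} (q : ℕ) (Φ : Fin m → Fin m → ℝ) (ω : ℕ → Fin m) (α : ℝ) : Prop :=
  Tendsto (fun n : ℕ => (∑ k ∈ Finset.Icc 1 n, Φ (ω k) (ω (q * k))) / n) atTop (𝓝 α)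

namespace LinearCookieCutter

variable {m : ℕ} (C : LinearCookieCutter m)

/-- The left endpoint of the interval coded by a finite word. -/
noncomputable def wordLower : List (Fin m) → ℝ
  | [] => 0
  | i :: w => C.lower i + Real.exp (-C.lam i) * wordLower w

/-- The length of the interval coded by a finite word. -/
noncomputable def wordLength (w : List (Fin m)) : ℝ := Real.exp (-(w.map C.lam).sum)

theorem wordLength_pos (w : List (Fin m)) : 0 < C.wordLength w := Real.exp_pos _

theorem wordLength_cons (i : Fin m) (w : List (Fin m)) :
    C.wordLength (i :: w) = Real.exp (-C.lam i) * C.wordLength w := by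
  simp [wordLength, ← Real.exp_add, add_comm]

theorem wordInterval_bounds (w : List (Fin m)) :
    0 ≤ C.wordLower w ∧ C.wordLower w + C.wordLength w ≤ 1 := by
  induction w with
  | nil => simp [wordLower, wordLength]
  | cons i w ih =>
    rw [wordLength_cons, wordLower]
    have h1 := C.lower_nonneg i
    have h2 := C.upper_le_one i
    have h3 := Real.exp_pos (-C.lam i)
    constructor
    · have := mul_nonneg h3.le ih.1
      linarith
    · nlinarith [ih.2]

/-- The open intervals coded by two words, neither of which extends the other, are disjoint. -/
theorem disjoint_wordInterval : ∀ u v : List (Fin m), ¬ u <+: v → ¬ v <+: u →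
    Disjoint (Ioo (C.wordLower u) (C.wordLower u + C.wordLength u))
      (Ioo (C.wordLower v) (C.wordLower v + C.wordLength v))
  | [], _, h, _ => (h List.nil_prefix).elim
  | _ :: _, [], _, h => (h List.nil_prefix).elim
  | i :: u, j :: v, h1, h2 => by
    have hi := Real.exp_pos (-C.lam i)
    have hj := Real.exp_pos (-C.lam j)
    have hu := C.wordInterval_bounds u
    have hv := C.wordInterval_bounds v
    rw [Set.disjoint_left]
    rintro x ⟨hx1, hx2⟩ ⟨hy1, hy2⟩
    rw [wordLength_cons, wordLower] at hx2 hy2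
    rw [wordLower] at hx1 hy1
    by_cases hij : i = j
    · subst hij
      have hd := disjoint_wordInterval u v (fun h => h1 ((List.cons_prefix_cons).2 ⟨rfl, h⟩))
        (fun h => h2 ((List.cons_prefix_cons).2 ⟨rfl, h⟩))
      have key : ∀ a b : ℝ, C.lower i + Real.exp (-C.lam i) * a < x →
          x < C.lower i + Real.exp (-C.lam i) * a + Real.exp (-C.lam i) * b →
          (x - C.lower i) / Real.exp (-C.lam i) ∈ Ioo a (a + b) := by
        intro a b ha hb
        constructor
        · rw [lt_div_iff₀ hi]; linarith
        · rw [div_lt_iff₀ hi]; linarith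
      exact Set.disjoint_left.1 hd (key _ _ hx1 hx2) (key _ _ hy1 hy2)
    · have hxi : x ∈ Ioo (C.lower i) (C.lower i + Real.exp (-C.lam i)) :=
        ⟨by nlinarith [hu.1], by nlinarith [hu.2]⟩
      have hxj : x ∈ Ioo (C.lower j) (C.lower j + Real.exp (-C.lam j)) :=
        ⟨by nlinarith [hv.1], by nlinarith [hv.2]⟩
      exact Set.disjoint_left.1 (C.disjoint_interiors i j hij) hxi hxj

/-- The itinerary of a point. -/
noncomputable def itinerary (x : ℝ) (k : ℕ) : Fin m := C.index (C.T^[k] x)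

/-- The prefix of length `n` of a sequence. -/
def _root_.seqPrefix {m : ℕ} (ω : ℕ → Fin m) (n : ℕ) : List (Fin m) :=
  List.ofFn fun i : Fin n => ω i

theorem _root_.seqPrefix_succ {m : ℕ} (ω : ℕ → Fin m) (n : ℕ) :
    seqPrefix ω (n + 1) = ω 0 :: seqPrefix (fun k => ω (k + 1)) n := by
  simp [seqPrefix, List.ofFn_succ]

theorem wordLength_seqPrefix (ω : ℕ → Fin m) (n : ℕ) :
    C.wordLength (seqPrefix ω n) = Real.exp (-∑ k ∈ Finset.range n, C.lam (ω k)) := by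
  rw [wordLength, seqPrefix, List.map_ofFn, List.sum_ofFn, Finset.sum_range]
  rfl

theorem mem_I_index {x : ℝ} (hx : x ∈ C.domain) : x ∈ C.I (C.index x) := by
  obtain ⟨i, hi⟩ := mem_iUnion.1 hx
  exact C.mem_index i x hi

theorem eq_lower_add (x : ℝ) : x = C.lower (C.index x) + Real.exp (-C.lam (C.index x)) * C.T x := by
  rw [T, branch, ← mul_assoc, ← Real.exp_add]
  simp

theorem T_mem_J {x : ℝ} (hx : x ∈ C.J) : C.T x ∈ C.J := fun n => by
  have := hx (n + 1)
  rwa [Function.iterate_succ_apply] at this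

theorem mem_wordInterval_itinerary {x : ℝ} (hx : x ∈ C.J) (n : ℕ) :
    x ∈ Icc (C.wordLower (seqPrefix (C.itinerary x) n))
      (C.wordLower (seqPrefix (C.itinerary x) n) + C.wordLength (seqPrefix (C.itinerary x) n)) := by
  induction n generalizing x with
  | zero =>
    have h1 := C.mem_I_index (hx 0)
    have h2 := C.lower_nonneg (C.index x)
    have h3 := C.upper_le_one (C.index x)
    simp only [seqPrefix, List.ofFn_zero, wordLower, wordLength, List.map_nil, List.sum_nil,
      neg_zero, Real.exp_zero, zero_add]
    exact ⟨h2.trans h1.1, h1.2.trans h3⟩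
  | succ n ih =>
    obtain ⟨h1, h2⟩ := ih (C.T_mem_J hx)
    rw [seqPrefix_succ, wordLength_cons, wordLower]
    have h3 := C.eq_lower_add x
    have h4 := Real.exp_pos (-C.lam (C.index x))
    have h5 : (fun k => C.itinerary x (k + 1)) = C.itinerary (C.T x) := by
      funext k; simp [itinerary, Function.iterate_succ_apply]
    rw [h5]
    change x ∈ Icc (C.lower (C.index x) + Real.exp (-C.lam (C.index x)) * _)
      (C.lower (C.index x) + Real.exp (-C.lam (C.index x)) * _ +
        Real.exp (-C.lam (C.index x)) * _)
    constructor
    · nlinarith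
    · nlinarith

/-- The point coded by an infinite sequence of symbols. -/
noncomputable def coding (ω : ℕ → Fin m) : ℝ :=
  ∑' k, Real.exp (-∑ j ∈ Finset.range k, C.lam (ω j)) * C.lower (ω k)

theorem exists_pos_le_lam : ∃ c > 0, ∀ i, c ≤ C.lam i := by
  rcases isEmpty_or_nonempty (Fin m) with h | h
  · exact ⟨1, one_pos, fun i => h.elim i⟩
  · obtain ⟨i, hi⟩ := Finite.exists_min C.lam
    exact ⟨C.lam i, C.lam_pos i, hi⟩

theorem exists_geometric_bound : ∃ ρ : ℝ, 0 ≤ ρ ∧ ρ < 1 ∧ ∀ (ω : ℕ → Fin m) (k : ℕ),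
    ‖Real.exp (-∑ j ∈ Finset.range k, C.lam (ω j)) * C.lower (ω k)‖ ≤ ρ ^ k := by
  obtain ⟨c, hc, hle⟩ := C.exists_pos_le_lam
  refine ⟨Real.exp (-c), (Real.exp_pos _).le, by simpa using hc, fun ω k => ?_⟩
  have h0 := C.lower_nonneg (ω k)
  have h1 : C.lower (ω k) ≤ 1 := by
    have := C.upper_le_one (ω k)
    have := Real.exp_pos (-C.lam (ω k))
    linarith
  rw [norm_mul, Real.norm_of_nonneg (Real.exp_pos _).le, Real.norm_of_nonneg h0,
    ← Real.exp_nat_mul]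
  have h2 : ∑ j ∈ Finset.range k, C.lam (ω j) ≥ k * c := by
    calc (k : ℝ) * c = ∑ j ∈ Finset.range k, c := by simp
      _ ≤ _ := Finset.sum_le_sum fun j _ => hle _
  calc _ ≤ Real.exp (-∑ j ∈ Finset.range k, C.lam (ω j)) * 1 := by gcongr
    _ ≤ _ := by rw [mul_one]; exact Real.exp_le_exp.2 (by linarith)

theorem summable_coding (ω : ℕ → Fin m) :
    Summable fun k => Real.exp (-∑ j ∈ Finset.range k, C.lam (ω j)) * C.lower (ω k) := by
  obtain ⟨ρ, h0, h1, h2⟩ := C.exists_geometric_bound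
  exact Summable.of_norm_bounded (summable_geometric_of_lt_one h0 h1) (h2 ω)

theorem measurable_coding : Measurable C.coding := by
  obtain ⟨ρ, h0, h1, h2⟩ := C.exists_geometric_bound
  have : Continuous C.coding := by
    refine continuous_tsum (fun k => ?_) (summable_geometric_of_lt_one h0 h1) fun k ω => h2 ω k
    have hd : ∀ (f : Fin m → ℝ) (j : ℕ), Continuous fun ω : ℕ → Fin m => f (ω j) := fun f j =>
      continuous_of_discreteTopology.comp (continuous_apply j)
    exact (Real.continuous_exp.comp (continuous_finsetSum _ fun j _ => hd _ j).neg).mul (hd _ k)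
  exact this.measurable

theorem coding_eq (ω : ℕ → Fin m) :
    C.coding ω = C.lower (ω 0) + Real.exp (-C.lam (ω 0)) * C.coding fun k => ω (k + 1) := by
  rw [coding, (C.summable_coding ω).tsum_eq_zero_add, coding, ← tsum_mul_left]
  congr 1
  · simp
  · congr 1
    funext k
    rw [Finset.sum_range_succ', neg_add, Real.exp_add]
    ring

theorem coding_mem (ω : ℕ → Fin m) : C.coding ω ∈ Icc 0 1 := by
  refine ⟨tsum_nonneg fun k => mul_nonneg (Real.exp_pos _).le (C.lower_nonneg _),
    (C.summable_coding ω).tsum_le_of_sum_range_le fun n => ?_⟩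
  have h : ∑ k ∈ Finset.range n, Real.exp (-∑ j ∈ Finset.range k, C.lam (ω j)) * C.lower (ω k) +
      Real.exp (-∑ j ∈ Finset.range n, C.lam (ω j)) ≤ 1 := by
    induction n with
    | zero => simp
    | succ n ih =>
      rw [Finset.sum_range_succ, Finset.sum_range_succ _ n, neg_add, Real.exp_add]
      have := C.upper_le_one (ω n)
      have := Real.exp_pos (-∑ j ∈ Finset.range n, C.lam (ω j))
      nlinarith
  have := Real.exp_pos (-∑ j ∈ Finset.range n, C.lam (ω j))
  linarith

theorem coding_mem_I (ω : ℕ → Fin m) : C.coding ω ∈ C.I (ω 0) := by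
  have h1 := C.coding_mem fun k => ω (k + 1)
  have h2 := Real.exp_pos (-C.lam (ω 0))
  rw [C.coding_eq ω]
  constructor
  · nlinarith [h1.1]
  · nlinarith [h1.2]

theorem coding_mem_wordInterval (ω : ℕ → Fin m) (n : ℕ) :
    C.coding ω ∈ Icc (C.wordLower (seqPrefix ω n))
      (C.wordLower (seqPrefix ω n) + C.wordLength (seqPrefix ω n)) := by
  induction n generalizing ω with
  | zero => simpa [seqPrefix, wordLower, wordLength] using C.coding_mem ω
  | succ n ih =>
    obtain ⟨h1, h2⟩ := ih fun k => ω (k + 1)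
    have h4 := Real.exp_pos (-C.lam (ω 0))
    rw [seqPrefix_succ, wordLength_cons, wordLower, C.coding_eq ω]
    constructor
    · nlinarith
    · nlinarith

theorem eq_endpoint {i j : Fin m} (hij : i ≠ j) {x : ℝ} (hi : x ∈ C.I i) (hj : x ∈ C.I j) :
    x = C.lower i ∨ x = C.lower i + Real.exp (-C.lam i) := by
  by_contra! h
  have hx1 : C.lower i < x := lt_of_le_of_ne hi.1 h.1.symm
  have hx2 : x < C.lower i + Real.exp (-C.lam i) := lt_of_le_of_ne hi.2 h.2
  have hp := Real.exp_pos (-C.lam j)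
  -- a point of the open interval close to `x` lies in the interior of the other interval
  obtain ⟨y, hy1, hy2⟩ := exists_between (show max (C.lower i) (C.lower j) <
      min (C.lower i + Real.exp (-C.lam i)) (C.lower j + Real.exp (-C.lam j)) by
    have h3 := hj.1
    have h4 := hj.2
    rw [max_lt_iff, lt_min_iff, lt_min_iff]
    refine ⟨⟨?_, ?_⟩, ?_, ?_⟩ <;> linarith)
  rw [max_lt_iff] at hy1
  rw [lt_min_iff] at hy2
  exact Set.disjoint_left.1 (C.disjoint_interiors i j hij) ⟨hy1.1, hy2.1⟩ ⟨hy1.2, hy2.2⟩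

theorem lower_injective {i j : Fin m} (h : C.lower i = C.lower j) : i = j := by
  by_contra hij
  have hi := Real.exp_pos (-C.lam i)
  have hj := Real.exp_pos (-C.lam j)
  obtain ⟨y, hy1, hy2⟩ := exists_between (show C.lower i <
      min (C.lower i + Real.exp (-C.lam i)) (C.lower j + Real.exp (-C.lam j)) by
    rw [lt_min_iff]; constructor <;> linarith)
  rw [lt_min_iff] at hy2
  exact Set.disjoint_left.1 (C.disjoint_interiors i j hij) ⟨hy1, hy2.1⟩ ⟨h ▸ hy1, hy2.2⟩

theorem upper_injective {i j : Fin m}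
    (h : C.lower i + Real.exp (-C.lam i) = C.lower j + Real.exp (-C.lam j)) : i = j := by
  by_contra hij
  have hi := Real.exp_pos (-C.lam i)
  have hj := Real.exp_pos (-C.lam j)
  obtain ⟨y, hy1, hy2⟩ := exists_between (show max (C.lower i) (C.lower j) <
      C.lower i + Real.exp (-C.lam i) by
    rw [max_lt_iff]; constructor <;> linarith)
  rw [max_lt_iff] at hy1
  exact Set.disjoint_left.1 (C.disjoint_interiors i j hij) ⟨hy1.1, hy2⟩ ⟨hy1.2, h ▸ hy2⟩

theorem coding_eq_zero {ω : ℕ → Fin m} (h : C.coding ω = 0) :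
    C.lower (ω 0) = 0 ∧ C.coding (fun k => ω (k + 1)) = 0 := by
  have h1 := C.coding_eq ω
  have h2 := C.lower_nonneg (ω 0)
  have h3 := Real.exp_pos (-C.lam (ω 0))
  have h5 := mul_nonneg h3.le (C.coding_mem fun k => ω (k + 1)).1
  refine ⟨by linarith, ?_⟩
  have : Real.exp (-C.lam (ω 0)) * C.coding (fun k => ω (k + 1)) = 0 := by linarith
  exact (mul_eq_zero.1 this).resolve_left h3.ne'

theorem coding_eq_one {ω : ℕ → Fin m} (h : C.coding ω = 1) :
    C.lower (ω 0) + Real.exp (-C.lam (ω 0)) = 1 ∧ C.coding (fun k => ω (k + 1)) = 1 := by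
  have h1 := C.coding_eq ω
  have h2 := C.upper_le_one (ω 0)
  have h3 := Real.exp_pos (-C.lam (ω 0))
  have h5 := mul_nonneg h3.le (sub_nonneg.2 (C.coding_mem fun k => ω (k + 1)).2)
  refine ⟨by linarith, ?_⟩
  have : Real.exp (-C.lam (ω 0)) * (1 - C.coding (fun k => ω (k + 1))) = 0 := by linarith
  linarith [(mul_eq_zero.1 this).resolve_left h3.ne']

theorem lower_eq_zero_of_coding {ω : ℕ → Fin m} (h : C.coding ω = 0) (k : ℕ) :
    C.lower (ω k) = 0 := by
  induction k generalizing ω with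
  | zero => exact (C.coding_eq_zero h).1
  | succ k ih => exact ih (C.coding_eq_zero h).2

theorem upper_eq_one_of_coding {ω : ℕ → Fin m} (h : C.coding ω = 1) (k : ℕ) :
    C.lower (ω k) + Real.exp (-C.lam (ω k)) = 1 := by
  induction k generalizing ω with
  | zero => exact (C.coding_eq_one h).1
  | succ k ih => exact ih (C.coding_eq_one h).2

theorem index_mem_I (ω : ℕ → Fin m) : C.coding ω ∈ C.I (C.index (C.coding ω)) :=
  C.mem_I_index (mem_iUnion.2 ⟨ω 0, C.coding_mem_I ω⟩)

/-- A coded point attributed to another interval than its first symbol says is a common endpoint,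
so that its image is `0` or `1`. -/
theorem coding_shift_of_index_ne {ω : ℕ → Fin m} (h : C.index (C.coding ω) ≠ ω 0) :
    C.coding (fun k => ω (k + 1)) = 0 ∨ C.coding (fun k => ω (k + 1)) = 1 := by
  have h1 := C.coding_eq ω
  have h3 := Real.exp_pos (-C.lam (ω 0))
  rcases C.eq_endpoint h.symm (C.coding_mem_I ω) (C.index_mem_I ω) with h2 | h2
  · left
    have : Real.exp (-C.lam (ω 0)) * C.coding (fun k => ω (k + 1)) = 0 := by linarith
    exact (mul_eq_zero.1 this).resolve_left h3.ne'
  · right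
    have : Real.exp (-C.lam (ω 0)) * (1 - C.coding (fun k => ω (k + 1))) = 0 := by linarith
    linarith [(mul_eq_zero.1 this).resolve_left h3.ne']

/-- The sequences that are constant from some index on. -/
def _root_.eventuallyConstant (m : ℕ) : Set (ℕ → Fin m) := {ω | ∃ N, ∀ k, N ≤ k → ω k = ω N}

theorem index_coding {ω : ℕ → Fin m} (hω : ω ∉ eventuallyConstant m) :
    C.index (C.coding ω) = ω 0 := by
  by_contra h
  refine hω ⟨1, fun k hk => ?_⟩
  obtain ⟨k, rfl⟩ := Nat.exists_eq_add_of_le' hk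
  rcases C.coding_shift_of_index_ne h with h1 | h1
  · exact C.lower_injective
      ((C.lower_eq_zero_of_coding h1 k).trans (C.lower_eq_zero_of_coding h1 0).symm)
  · exact C.upper_injective
      ((C.upper_eq_one_of_coding h1 k).trans (C.upper_eq_one_of_coding h1 0).symm)

theorem index_coding_const (c : Fin m) : C.index (C.coding fun _ => c) = c := by
  by_contra h
  have hj := C.index_mem_I fun _ => c
  rcases C.coding_shift_of_index_ne h with h1 | h1
  · rw [h1] at hj h
    have h2 := C.lower_eq_zero_of_coding h1 0
    exact h (C.lower_injective ((le_antisymm hj.1 (C.lower_nonneg _)).trans h2.symm))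
  · rw [h1] at hj h
    have h2 := C.upper_eq_one_of_coding h1 0
    exact h (C.upper_injective ((le_antisymm (C.upper_le_one _) hj.2).trans h2.symm))

theorem T_coding {ω : ℕ → Fin m} (h : C.index (C.coding ω) = ω 0) :
    C.T (C.coding ω) = C.coding fun k => ω (k + 1) := by
  rw [T, h, branch]
  nth_rw 1 [C.coding_eq ω]
  rw [add_sub_cancel_left, ← mul_assoc, ← Real.exp_add]
  simp

/-- A sequence all of whose shifts code a point attributed to the first symbol is the itinerary of
the point it codes. -/
theorem itinerary_coding {ω : ℕ → Fin m}
    (h : ∀ n, C.index (C.coding fun k => ω (k + n)) = ω n) :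
    C.coding ω ∈ C.J ∧ C.itinerary (C.coding ω) = ω := by
  have hT : ∀ n, C.T^[n] (C.coding ω) = C.coding fun k => ω (k + n) := by
    intro n
    induction n with
    | zero => rfl
    | succ n ih =>
      rw [Function.iterate_succ_apply', ih, C.T_coding (by rw [h n, zero_add])]
      congr 1
      funext k
      rw [add_right_comm, add_assoc]
  refine ⟨fun n => ?_, ?_⟩
  · rw [hT]
    exact mem_iUnion.2 ⟨_, C.coding_mem_I _⟩
  · funext n
    rw [itinerary, hT, h]

theorem itinerary_coding_of_notMem {ω : ℕ → Fin m} (hω : ω ∉ eventuallyConstant m) :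
    C.coding ω ∈ C.J ∧ C.itinerary (C.coding ω) = ω := by
  refine C.itinerary_coding fun n => ?_
  rw [C.index_coding, zero_add]
  rintro ⟨N, hN⟩
  refine hω ⟨N + n, fun k hk => ?_⟩
  have := hN (k - n) (by lia)
  simpa [Nat.sub_add_cancel (show n ≤ k by lia)] using this

theorem itinerary_coding_const (c : Fin m) :
    C.coding (fun _ => c) ∈ C.J ∧ C.itinerary (C.coding fun _ => c) = fun _ => c :=
  C.itinerary_coding fun _ => C.index_coding_const c

theorem mem_levelSet_iff {q : ℕ} {φ : ℝ → ℝ → ℝ} {Φ : Fin m → Fin m → ℝ}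
    (hφ : C.LocallyConstantWith φ Φ) (α x : ℝ) :
    x ∈ C.levelSet q φ α ↔ x ∈ C.J ∧ HasPairAverage q Φ (C.itinerary x) α := by
  refine and_congr_right fun hx => ?_
  have : (fun n : ℕ => (1 / (n : ℝ)) * ∑ k ∈ Finset.Icc 1 n, φ (C.T^[k] x) (C.T^[q * k] x)) =
      fun n : ℕ => (∑ k ∈ Finset.Icc 1 n, Φ (C.itinerary x k) (C.itinerary x (q * k))) / n := by
    funext n
    rw [one_div_mul_eq_div]
    congr 1
    exact Finset.sum_congr rfl fun k _ => hφ _ (hx k) _ (hx (q * k))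
  rw [this]
  rfl

theorem levelSet_nonempty {q : ℕ} (hq : 1 ≤ q) {φ : ℝ → ℝ → ℝ} {Φ : Fin m → Fin m → ℝ}
    (hφ : C.LocallyConstantWith φ Φ) {α : ℝ} {ω : ℕ → Fin m} (h : HasPairAverage q Φ ω α) :
    (C.levelSet q φ α).Nonempty := by
  by_cases hω : ω ∈ eventuallyConstant m
  · -- the constant sequence with the same tail has the same averages
    obtain ⟨N, hN⟩ := hω
    have hlim : HasPairAverage q Φ ω (Φ (ω N) (ω N)) := by
      have h1 : Tendsto (fun n : ℕ => Φ (ω (n + 1)) (ω (q * (n + 1)))) atTop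
          (𝓝 (Φ (ω N) (ω N))) := by
        refine tendsto_const_nhds.congr' ?_
        filter_upwards [eventually_ge_atTop N] with n hn
        rw [hN (n + 1) (by lia), hN (q * (n + 1)) (by nlinarith)]
      refine h1.cesaro.congr fun n => ?_
      rw [sum_Icc_one_eq_sum_range, inv_mul_eq_div]
    obtain ⟨h1, h2⟩ := C.itinerary_coding_const (ω N)
    refine ⟨C.coding fun _ => ω N, (C.mem_levelSet_iff hφ _ _).2 ⟨h1, ?_⟩⟩
    rw [h2, tendsto_nhds_unique h hlim]
    refine tendsto_const_nhds.congr' ?_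
    filter_upwards [eventually_gt_atTop 0] with n hn
    have : (n : ℝ) ≠ 0 := by exact_mod_cast hn.ne'
    simp only [Finset.sum_const, Nat.card_Icc, Nat.add_sub_cancel, nsmul_eq_mul]
    field_simp
  · obtain ⟨h1, h2⟩ := C.itinerary_coding_of_notMem hω
    exact ⟨C.coding ω, (C.mem_levelSet_iff hφ _ _).2 ⟨h1, by rwa [h2]⟩⟩

theorem _root_.countable_eventuallyConstant (m : ℕ) : (eventuallyConstant m).Countable := by
  have : eventuallyConstant m ⊆ ⋃ N : ℕ, Set.range fun u : Fin (N + 1) → Fin m =>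
      fun k => u ⟨min k N, by lia⟩ := by
    rintro ω ⟨N, hN⟩
    refine mem_iUnion.2 ⟨N, fun i => ω i, ?_⟩
    funext k
    rcases le_total k N with h | h
    · simp [h]
    · simp [h, hN k h]
  exact (countable_iUnion fun N => countable_range _).mono this

end LinearCookieCutter

/-! ### Lower bound for the dimension: the mass distribution principle -/

section Entropy

variable {m : ℕ} {q : ℕ}

/-- With `Real.log 0 = 0` this also holds for words of weight zero. -/
theorem wordWeight_le_exp (z : markovPairs m) (n : ℕ) (u : ℕ → Fin m) :
    wordWeight q z.1 n u ≤ Real.exp (∑ k ∈ Finset.Icc 1 n with ¬ q ∣ k, Real.log (z.1.1 (u k)) +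
      ∑ k ∈ Finset.Icc 1 (n / q), Real.log (z.1.2 (u k) (u (q * k)))) := by
  rw [Real.exp_add, Real.exp_sum, Real.exp_sum]
  exact mul_le_mul
    (Finset.prod_le_prod (fun _ _ => z.2.1.1 _) fun _ _ => Real.le_exp_log _)
    (Finset.prod_le_prod (fun _ _ => (z.2.2 _ trivial).1 _) fun _ _ => Real.le_exp_log _)
    (Finset.prod_nonneg fun _ _ => (z.2.2 _ trivial).1 _)
    (Finset.prod_nonneg fun _ _ => (Real.exp_pos _).le)

/-- A one-sided Shannon–McMillan–Breiman theorem: if `d ⟨λ⟩` is less than the entropy, then the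
probability of the initial words of almost every sequence is at most `exp (-d ∑ λ)`. -/
theorem ae_eventually_wordWeight_le [NeZero m] (hq : 2 ≤ q) (z : markovPairs m) (lam : Fin m → ℝ) {d : ℝ}
    (hd : d * pairMean q z.1 (fun i _ => lam i) < entropyRate q z.1) :
    ∀ᵐ ξ ∂(chainsLaw z), ∀ᶠ n in atTop, wordWeight q z.1 n (interleave q ξ) ≤
      Real.exp (-(d * ∑ k ∈ Finset.Icc 1 n, lam (interleave q ξ k))) := by
  filter_upwards [ae_tendsto_average_not_dvd hq z (fun a _ => Real.log (z.1.1 a)) 0,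
    ae_tendsto_pairAverage hq z (fun a b => Real.log (z.1.2 a b)),
    ae_tendsto_pairAverage hq z (fun a _ => lam a)] with ξ h1 h2 h3
  have h4 := (h1.add (tendsto_comp_natDiv (c := q) (by lia)
    (x := fun n => ∑ k ∈ Finset.Icc 1 n,
      Real.log (z.1.2 (interleave q ξ k) (interleave q ξ (q * k)))) h2)).add (h3.const_mul d)
  have hneg : (1 - 1 / (q : ℝ)) * ∑ a, marginal z.1 0 a * ∑ b, z.1.2 a b * Real.log (z.1.1 a) +
      (pairMean q z.1 fun a b => Real.log (z.1.2 a b)) * (1 / q) +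
      d * pairMean q z.1 (fun i _ => lam i) < 0 := by
    have e : ∀ a, ∑ b, z.1.2 a b * Real.log (z.1.1 a) = Real.log (z.1.1 a) := fun a => by
      rw [← Finset.sum_mul, (z.2.2 a trivial).2, one_mul]
    simp_rw [e, marginal]
    unfold entropyRate at hd
    linarith
  filter_upwards [h4.eventually_lt_const hneg, eventually_gt_atTop 0] with n hn hn0
  refine (wordWeight_le_exp z n _).trans (Real.exp_le_exp.2 ?_)
  have hn' : (0 : ℝ) < n := by exact_mod_cast hn0
  have e2 : ∑ k ∈ Finset.Icc 1 n with ¬ q ∣ k, Real.log (z.1.1 (interleave q ξ k)) =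
      ∑ k ∈ Finset.Icc 1 n with ¬ q ∣ k, Real.log (z.1.1 (ξ k 0)) :=
    Finset.sum_congr rfl fun k hk => by
      rw [← interleave_mul_pow hq (Finset.mem_filter.1 hk).2 ξ 0, pow_zero, mul_one]
  rw [e2]
  rw [mul_div_assoc', ← add_div, ← add_div, div_lt_iff₀ hn', zero_mul] at hn
  linarith

end Entropy

namespace LinearCookieCutter

variable {m : ℕ} (C : LinearCookieCutter m)

theorem exists_lam_le : ∃ L > 0, ∀ i, C.lam i ≤ L := by
  rcases isEmpty_or_nonempty (Fin m) with h | h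
  · exact ⟨1, one_pos, fun i => h.elim i⟩
  · obtain ⟨i, hi⟩ := Finite.exists_max C.lam
    exact ⟨C.lam i, C.lam_pos i, hi⟩

theorem wordLength_le_one (w : List (Fin m)) : C.wordLength w ≤ 1 := by
  have := (C.wordInterval_bounds w)
  linarith

theorem wordLength_append (u v : List (Fin m)) :
    C.wordLength (u ++ v) = C.wordLength u * C.wordLength v := by
  simp [wordLength, ← Real.exp_add, add_comm]

theorem wordLength_antitone {u v : List (Fin m)} (h : u <+: v) :
    C.wordLength v ≤ C.wordLength u := by
  obtain ⟨w, rfl⟩ := h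
  rw [wordLength_append]
  exact mul_le_of_le_one_right (C.wordLength_pos u).le (C.wordLength_le_one w)

theorem exp_le_wordLength {L : ℝ} (hL : ∀ i, C.lam i ≤ L) (w : List (Fin m)) :
    Real.exp (-(w.length * L)) ≤ C.wordLength w := by
  induction w with
  | nil => simp [wordLength]
  | cons i w ih =>
    rw [wordLength_cons, List.length_cons, Nat.cast_succ, add_mul, one_mul, neg_add,
      Real.exp_add, mul_comm]
    exact mul_le_mul (Real.exp_le_exp.2 (neg_le_neg (hL i))) ih (Real.exp_pos _).le
      (Real.exp_pos _).le

/-- The words whose interval has length about `δ`: those of length at most `δ` whose proper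
prefixes have larger length. -/
def stoppingWords (δ : ℝ) : Set (List (Fin m)) :=
  {w | w ≠ [] ∧ C.wordLength w ≤ δ ∧ δ < C.wordLength w.dropLast}

theorem not_prefix_of_stoppingWords {δ : ℝ} {u v : List (Fin m)} (hu : u ∈ C.stoppingWords δ)
    (hv : v ∈ C.stoppingWords δ) (huv : u ≠ v) : ¬ u <+: v := by
  intro h
  obtain ⟨w, rfl⟩ := h
  have hw : w ≠ [] := by rintro rfl; simp at huv
  have h1 := hv.2.2
  rw [List.dropLast_append_of_ne_nil hw] at h1
  have h2 := C.wordLength_antitone (List.prefix_append u w.dropLast)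
  linarith [hu.2.1]

theorem mul_lt_wordLength_of_stopping {L δ : ℝ} (hL : ∀ i, C.lam i ≤ L) {w : List (Fin m)}
    (hw : w ∈ C.stoppingWords δ) : δ * Real.exp (-L) < C.wordLength w := by
  obtain ⟨h1, -, h3⟩ := hw
  rw [← List.dropLast_concat_getLast h1, wordLength_append]
  have h4 : Real.exp (-L) ≤ C.wordLength [w.getLast h1] := by
    simpa using C.exp_le_wordLength hL [w.getLast h1]
  exact mul_lt_mul h3 h4 (Real.exp_pos _) (C.wordLength_pos _).le

theorem exists_stopping_prefix (ω : ℕ → Fin m) {δ : ℝ} (h0 : 0 < δ) (h1 : δ < 1) :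
    ∃ n, seqPrefix ω n ∈ C.stoppingWords δ := by
  obtain ⟨c, hc, hle⟩ := C.exists_pos_le_lam
  have hex : ∃ n, C.wordLength (seqPrefix ω n) ≤ δ := by
    have hlim : Tendsto (fun n : ℕ => Real.exp (-(n * c))) atTop (𝓝 0) :=
      Real.tendsto_exp_neg_atTop_nhds_zero.comp
        (tendsto_natCast_atTop_atTop.atTop_mul_const hc)
    obtain ⟨n, hn⟩ := (hlim.eventually_lt_const h0).exists
    refine ⟨n, le_trans ?_ hn.le⟩
    rw [wordLength_seqPrefix]
    refine Real.exp_le_exp.2 (neg_le_neg ?_)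
    calc (n : ℝ) * c = ∑ j ∈ Finset.range n, c := by simp
      _ ≤ _ := Finset.sum_le_sum fun j _ => hle _
  classical
  have hn := Nat.find_spec hex
  set n := Nat.find hex with hndef
  have hn0 : n ≠ 0 := by
    intro h
    rw [h] at hn
    simp [seqPrefix, wordLength] at hn
    linarith
  obtain ⟨k, hk⟩ := Nat.exists_eq_succ_of_ne_zero hn0
  refine ⟨n, ?_, hn, ?_⟩
  · rw [hk]; simp [seqPrefix]
  · have hmin := Nat.find_min hex (m := k) (by lia)
    push Not at hmin
    have : (seqPrefix ω n).dropLast = seqPrefix ω k := by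
      rw [hk, seqPrefix, List.ofFn_succ_last, List.dropLast_concat]
      rfl
    rwa [this]

/-- The total length of the intervals of stopping words meeting an interval of length `δ` is at
most `3 δ`. -/
theorem tsum_wordLength_le {a δ : ℝ} :
    ∑' w : {w : List (Fin m) // w ∈ C.stoppingWords δ ∧
        (Icc (C.wordLower w) (C.wordLower w + C.wordLength w) ∩ Icc a (a + δ)).Nonempty},
      ENNReal.ofReal (C.wordLength w) ≤ ENNReal.ofReal (3 * δ) := by
  have h1 : ∀ w : List (Fin m), ENNReal.ofReal (C.wordLength w) =
      volume (Ioo (C.wordLower w) (C.wordLower w + C.wordLength w)) := fun w => by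
    rw [Real.volume_Ioo, add_sub_cancel_left]
  simp_rw [h1]
  rw [← measure_iUnion]
  · calc _ ≤ volume (Icc (a - δ) (a + 2 * δ)) := by
          refine measure_mono (iUnion_subset ?_)
          rintro ⟨w, hw, x, hx, hxa⟩ y hy
          have := hw.2.1
          exact ⟨by linarith [hy.1, hx.2, hxa.1], by linarith [hy.2, hx.1, hxa.2]⟩
      _ = _ := by rw [Real.volume_Icc]; congr 1; ring
  · rintro ⟨u, hu, _⟩ ⟨v, hv, _⟩ huv
    have huv' : u ≠ v := fun h => huv (Subtype.ext h)
    exact C.disjoint_wordInterval u v (C.not_prefix_of_stoppingWords hu hv huv')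
      (C.not_prefix_of_stoppingWords hv hu huv'.symm)
  · exact fun _ => measurableSet_Ioo

variable [NeZero m] {q : ℕ}

/-- The sequences whose initial words of length at least `N` have small probability. -/
def lightSequences (q : ℕ) (z : markovPairs m) (d : ℝ) (N : ℕ) : Set (ℕ → ℕ → Fin m) :=
  {ξ | ∀ n, N ≤ n → wordWeight q z.1 n (interleave q ξ) ≤
    Real.exp (-(d * ∑ k ∈ Finset.Icc 1 n, C.lam (interleave q ξ k)))}

theorem chainsLaw_prefix_le (hq : 2 ≤ q) (z : markovPairs m) {d L : ℝ} (hd : 0 < d)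
    (hL : ∀ i, C.lam i ≤ L) {N : ℕ} {w : List (Fin m)} (hw : N + 1 ≤ w.length) :
    chainsLaw z {ξ | ξ ∈ C.lightSequences q z d N ∧ seqPrefix (interleave q ξ) w.length = w} ≤
      ENNReal.ofReal (Real.exp (d * L) * C.wordLength w ^ d) := by
  rcases Set.eq_empty_or_nonempty
    {ξ | ξ ∈ C.lightSequences q z d N ∧ seqPrefix (interleave q ξ) w.length = w} with h | ⟨ξ₀, h₀, hw₀⟩
  · rw [h]; simp
  obtain ⟨n, hn⟩ := Nat.exists_eq_add_of_le' (show 1 ≤ w.length by lia)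
  calc _ ≤ chainsLaw z {ξ | ∀ k ∈ Finset.Icc 1 n, interleave q ξ k = interleave q ξ₀ k} := by
        refine measure_mono fun ξ hξ k hk => ?_
        have h1 : seqPrefix (interleave q ξ) w.length = seqPrefix (interleave q ξ₀) w.length :=
          hξ.2.trans hw₀.symm
        have h2 := congrFun (List.ofFn_injective h1) ⟨k, by have := Finset.mem_Icc.1 hk; lia⟩
        exact h2
    _ = ENNReal.ofReal (wordWeight q z.1 n (interleave q ξ₀)) := chainsLaw_cylinder hq z _ n
    _ ≤ _ := by
        refine ENNReal.ofReal_le_ofReal ((h₀ n (by lia)).trans ?_)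
        have h3 : C.wordLength w = Real.exp (-∑ k ∈ Finset.range w.length,
            C.lam (interleave q ξ₀ k)) := by
          rw [← C.wordLength_seqPrefix, hw₀]
        rw [h3, ← Real.exp_mul, ← Real.exp_add, hn, Finset.sum_range_succ',
          sum_Icc_one_eq_sum_range]
        refine Real.exp_le_exp.2 ?_
        have := mul_le_mul_of_nonneg_left (hL (interleave q ξ₀ 0)) hd.le
        linarith

/-- The law of the coded point satisfies the hypothesis of the mass distribution principle once it
is restricted to sequences with light initial words. -/
theorem chainsLaw_coding_Icc_le (hq : 2 ≤ q) (z : markovPairs m) {d L : ℝ} (hd : 0 < d)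
    (hL : ∀ i, C.lam i ≤ L) (N : ℕ) {a δ : ℝ} (hδ : 0 < δ) (hδ1 : δ < 1)
    (hδN : δ < Real.exp (-(N * L))) (hL0 : 0 < L) :
    chainsLaw z {ξ | ξ ∈ C.lightSequences q z d N ∧
        C.coding (interleave q ξ) ∈ Icc a (a + δ)} ≤
      ENNReal.ofReal (3 * Real.exp L * Real.exp (d * L) * δ ^ d) := by
  set W := {w : List (Fin m) // w ∈ C.stoppingWords δ ∧
        (Icc (C.wordLower w) (C.wordLower w + C.wordLength w) ∩ Icc a (a + δ)).Nonempty}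
  calc _ ≤ chainsLaw z (⋃ w : W, {ξ | ξ ∈ C.lightSequences q z d N ∧
        seqPrefix (interleave q ξ) w.1.length = w.1}) := by
        refine measure_mono fun ξ hξ => ?_
        obtain ⟨n, hn⟩ := C.exists_stopping_prefix (interleave q ξ) hδ hδ1
        refine mem_iUnion.2 ⟨⟨seqPrefix (interleave q ξ) n, hn, C.coding (interleave q ξ),
          C.coding_mem_wordInterval _ n, hξ.2⟩, hξ.1, ?_⟩
        simp [seqPrefix]
    _ ≤ ∑' w : W, chainsLaw z {ξ | ξ ∈ C.lightSequences q z d N ∧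
        seqPrefix (interleave q ξ) w.1.length = w.1} := measure_iUnion_le _
    _ ≤ ∑' w : W, ENNReal.ofReal (Real.exp (d * L) * (δ ^ d * Real.exp L / δ)) *
          ENNReal.ofReal (C.wordLength w.1) := by
        refine ENNReal.tsum_le_tsum fun w => ?_
        have hlen : N + 1 ≤ w.1.length := by
          by_contra h
          have h1 := C.exp_le_wordLength hL w.1
          have h2 : (w.1.length : ℝ) ≤ N := by exact_mod_cast (by lia : w.1.length ≤ N)
          have h3 : Real.exp (-(N * L)) ≤ Real.exp (-(w.1.length * L)) :=
            Real.exp_le_exp.2 (neg_le_neg (by gcongr))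
          linarith [w.2.1.2.1]
        refine (C.chainsLaw_prefix_le hq z hd hL hlen).trans ?_
        rw [← ENNReal.ofReal_mul (by positivity)]
        refine ENNReal.ofReal_le_ofReal ?_
        rw [mul_assoc]
        refine mul_le_mul_of_nonneg_left ?_ (Real.exp_pos _).le
        have h4 : C.wordLength w.1 ^ d ≤ δ ^ d :=
          Real.rpow_le_rpow (C.wordLength_pos _).le w.2.1.2.1 hd.le
        have h5 := C.mul_lt_wordLength_of_stopping hL w.2.1
        have h6 : 1 ≤ Real.exp L / δ * C.wordLength w.1 := by
          rw [div_mul_eq_mul_div, le_div_iff₀ hδ, one_mul]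
          rw [Real.exp_neg, ← div_eq_mul_inv, div_lt_iff₀ (Real.exp_pos _)] at h5
          linarith
        calc C.wordLength w.1 ^ d ≤ δ ^ d * 1 := by rwa [mul_one]
          _ ≤ δ ^ d * (Real.exp L / δ * C.wordLength w.1) := by gcongr
          _ = _ := by ring
    _ = ENNReal.ofReal (Real.exp (d * L) * (δ ^ d * Real.exp L / δ)) *
          ∑' w : W, ENNReal.ofReal (C.wordLength w.1) := ENNReal.tsum_mul_left
    _ ≤ ENNReal.ofReal (Real.exp (d * L) * (δ ^ d * Real.exp L / δ)) *
          ENNReal.ofReal (3 * δ) := by gcongr; exact C.tsum_wordLength_le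
    _ = _ := by
        rw [← ENNReal.ofReal_mul (by positivity)]
        congr 1
        field_simp

theorem chainsLaw_coding_singleton (hq : 2 ≤ q) (z : markovPairs m) {d : ℝ} (hd : 0 < d)
    (N : ℕ) (a : ℝ) :
    chainsLaw z {ξ | ξ ∈ C.lightSequences q z d N ∧ C.coding (interleave q ξ) = a} = 0 := by
  obtain ⟨L, hL0, hL⟩ := C.exists_lam_le
  have hlim : Tendsto (fun δ : ℝ => ENNReal.ofReal (3 * Real.exp L * Real.exp (d * L) * δ ^ d))
      (𝓝[>] 0) (𝓝 0) := by
    have h1 : Tendsto (fun δ : ℝ => 3 * Real.exp L * Real.exp (d * L) * δ ^ d) (𝓝 0) (𝓝 0) :=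
      ((Real.continuous_rpow_const hd.le).const_mul _).tendsto' _ _
        (by rw [Real.zero_rpow hd.ne', mul_zero])
    simpa using ENNReal.tendsto_ofReal (h1.mono_left nhdsWithin_le_nhds)
  refine le_antisymm (ge_of_tendsto hlim ?_) bot_le
  filter_upwards [Ioo_mem_nhdsGT (show (0 : ℝ) < min 1 (Real.exp (-(N * L))) from
    lt_min one_pos (Real.exp_pos _))] with δ hδ
  refine le_trans (measure_mono ?_) (C.chainsLaw_coding_Icc_le hq z hd hL N (a := a) hδ.1
    (hδ.2.trans_le (min_le_left _ _)) (hδ.2.trans_le (min_le_right _ _)) hL0)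
  rintro ξ ⟨h1, rfl⟩
  exact ⟨h1, le_rfl, by linarith [hδ.1]⟩

/-- The lower bound: the level set has dimension at least any `d` with `d ⟨λ⟩` less than the
entropy of a chain with the prescribed mean. -/
theorem le_dimH_levelSet (hq : 2 ≤ q) {φ : ℝ → ℝ → ℝ} {Φ : Fin m → Fin m → ℝ}
    (hφ : C.LocallyConstantWith φ Φ) (z : markovPairs m) {d : ℝ} (hd : 0 < d)
    (hent : d * pairMean q z.1 (fun i _ => C.lam i) < entropyRate q z.1) :
    ENNReal.ofReal d ≤ dimH (C.levelSet q φ (pairMean q z.1 Φ)) := by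
  obtain ⟨L, hL0, hL⟩ := C.exists_lam_le
  set α := pairMean q z.1 Φ with hα
  set ψ : (ℕ → ℕ → Fin m) → ℝ := fun ξ => C.coding (interleave q ξ) with hψ
  have hψm : Measurable ψ := C.measurable_coding.comp measurable_interleave
  have hae : ∀ᵐ ξ ∂(chainsLaw z), HasPairAverage q Φ (interleave q ξ) α ∧
      ∃ N, ξ ∈ C.lightSequences q z d N := by
    filter_upwards [ae_tendsto_pairAverage hq z Φ, ae_eventually_wordWeight_le hq z C.lam hent]
      with ξ h1 h2
    exact ⟨h1, eventually_atTop.1 h2⟩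
  obtain ⟨N, hN⟩ : ∃ N, chainsLaw z (C.lightSequences q z d N ∩
      {ξ | HasPairAverage q Φ (interleave q ξ) α}) ≠ 0 := by
    by_contra! h
    have h1 := measure_iUnion_null h
    have h2 : (⋃ N, C.lightSequences q z d N ∩
        {ξ | HasPairAverage q Φ (interleave q ξ) α}) ∈ ae (chainsLaw z) := by
      filter_upwards [hae] with ξ hξ
      obtain ⟨h3, N, h4⟩ := hξ
      exact mem_iUnion.2 ⟨N, h4, h3⟩
    have h3 := measure_eq_measure_of_null_sdiff (subset_univ _) (by
      rw [← compl_eq_univ_sdiff]; exact h2)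
    rw [h1, measure_univ] at h3
    exact zero_ne_one h3
  set E := C.lightSequences q z d N
  set ν := ((chainsLaw z).restrict E).map ψ with hν
  have hνapp : ∀ s, MeasurableSet s → ν s = chainsLaw z {ξ | ξ ∈ E ∧ ψ ξ ∈ s} := by
    intro s hs
    rw [hν, Measure.map_apply hψm hs, Measure.restrict_apply (hψm hs), inter_comm]
    rfl
  -- the coded points of eventually constant sequences carry no mass
  have hpos : ν (C.levelSet q φ α) ≠ 0 := by
    have hnull : chainsLaw z (E ∩ {ξ | interleave q ξ ∈ eventuallyConstant m}) = 0 := by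
      refine measure_mono_null (t := ⋃ ω ∈ eventuallyConstant m,
        {ξ | ξ ∈ E ∧ C.coding (interleave q ξ) = C.coding ω}) ?_ ?_
      · rintro ξ ⟨h1, h2⟩
        exact mem_iUnion₂.2 ⟨_, h2, h1, rfl⟩
      · exact (measure_biUnion_null_iff (countable_eventuallyConstant m)).2 fun ω _ =>
          C.chainsLaw_coding_singleton hq z hd N _
    intro h0
    refine hN (measure_mono_null (t := (ψ ⁻¹' (C.levelSet q φ α) ∩ E) ∪
      (E ∩ {ξ | interleave q ξ ∈ eventuallyConstant m})) ?_ (measure_union_null ?_ hnull))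
    · rintro ξ ⟨h1, h2⟩
      by_cases h3 : interleave q ξ ∈ eventuallyConstant m
      · exact Or.inr ⟨h1, h3⟩
      · obtain ⟨h4, h5⟩ := C.itinerary_coding_of_notMem h3
        exact Or.inl ⟨(C.mem_levelSet_iff hφ _ _).2 ⟨h4, by rw [h5]; exact h2⟩, h1⟩
    · exact le_antisymm ((Measure.le_restrict_apply _ _).trans
        ((Measure.le_map_apply hψm.aemeasurable _).trans h0.le)) bot_le
  set K := 3 * Real.exp L * Real.exp (d * L) with hK
  have hK0 : 0 < K := by positivity
  set δ₀ := min 1 (Real.exp (-(N * L))) / 2 with hδ₀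
  have hδ₀pos : 0 < δ₀ := half_pos (lt_min one_pos (Real.exp_pos _))
  have hδ₀lt : δ₀ < min 1 (Real.exp (-(N * L))) := half_lt_self (by linarith)
  have hle : (ENNReal.ofReal K)⁻¹ • ν ≤ μH[d] := by
    refine Measure.le_hausdorffMeasure d _ (ENNReal.ofReal δ₀) (by simpa using hδ₀pos) fun s hs => ?_
    rw [Measure.smul_apply, smul_eq_mul, mul_comm, ← div_eq_mul_inv]
    refine ENNReal.div_le_of_le_mul ?_
    rcases s.eq_empty_or_nonempty with rfl | hne
    · simp
    have hfin : Metric.ediam s ≠ ⊤ := ne_top_of_le_ne_top ENNReal.ofReal_ne_top hs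
    have hb : Bornology.IsBounded s := Metric.isBounded_iff_ediam_ne_top.2 hfin
    have hsub : s ⊆ Icc (sInf s) (sInf s + Metric.diam s) := by
      rw [Real.diam_eq hb]
      intro x hx
      exact ⟨csInf_le hb.bddBelow hx, by linarith [le_csSup hb.bddAbove hx]⟩
    have hediam : Metric.ediam s = ENNReal.ofReal (Metric.diam s) :=
      (ENNReal.ofReal_toReal hfin).symm
    refine (measure_mono hsub).trans ?_
    rcases (Metric.diam_nonneg (s := s)).eq_or_lt with h0 | h0
    · rw [← h0, add_zero, Icc_self, hνapp _ (measurableSet_singleton _)]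
      exact (C.chainsLaw_coding_singleton hq z hd N _).le.trans bot_le
    · have h1 : Metric.diam s ≤ δ₀ := by
        rw [hediam] at hs
        exact (ENNReal.ofReal_le_ofReal_iff hδ₀pos.le).1 hs
      rw [hνapp _ measurableSet_Icc, hediam, ENNReal.ofReal_rpow_of_pos h0,
        ← ENNReal.ofReal_mul (by positivity), mul_comm]
      have h2 := h1.trans_lt hδ₀lt
      exact C.chainsLaw_coding_Icc_le hq z hd hL N h0 (h2.trans_le (min_le_left _ _))
        (h2.trans_le (min_le_right _ _)) hL0
  have hH : μH[(d.toNNReal : ℝ)] (C.levelSet q φ α) ≠ 0 := by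
    rw [Real.coe_toNNReal d hd.le]
    intro h0
    have h1 := le_antisymm ((hle (C.levelSet q φ α)).trans h0.le) bot_le
    rw [Measure.smul_apply, smul_eq_mul] at h1
    rcases mul_eq_zero.1 h1 with h2 | h2
    · exact ENNReal.ofReal_ne_top (ENNReal.inv_eq_zero.1 h2)
    · exact hpos h2
  exact le_dimH_of_hausdorffMeasure_ne_zero hH

theorem levelSet_pairMean_nonempty (hq : 2 ≤ q) {φ : ℝ → ℝ → ℝ} {Φ : Fin m → Fin m → ℝ}
    (hφ : C.LocallyConstantWith φ Φ) (z : markovPairs m) :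
    (C.levelSet q φ (pairMean q z.1 Φ)).Nonempty := by
  obtain ⟨ξ, hξ⟩ := (ae_tendsto_pairAverage hq z Φ).exists
  exact C.levelSet_nonempty (by lia) hφ hξ

end LinearCookieCutter

/-! ### Upper bound for the dimension -/

theorem wordWeight_congr {m q : ℕ} {z : (Fin m → ℝ) × (Fin m → Fin m → ℝ)} (hq : 2 ≤ q) {n : ℕ}
    {u v : ℕ → Fin m} (h : ∀ k ≤ n, u k = v k) : wordWeight q z n u = wordWeight q z n v := by
  unfold wordWeight
  congr 1
  · refine Finset.prod_congr rfl fun k hk => ?_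
    rw [Finset.mem_filter, Finset.mem_Icc] at hk
    rw [h k hk.1.2]
  · refine Finset.prod_congr rfl fun k hk => ?_
    rw [Finset.mem_Icc, Nat.le_div_iff_mul_le (by lia)] at hk
    rw [h k (by nlinarith), h (q * k) (by lia)]

section GibbsWeight

variable {m : ℕ} [NeZero m] {q : ℕ}

/-- The Markov chain attached to a weight matrix. -/
noncomputable def gibbsPair (hq : 2 ≤ q) (a : Fin m → Fin m → ℝ) : markovPairs m :=
  ⟨(gibbsInit q a, gibbsTrans q a), gibbsInit_mem q a, fun i _ => gibbsTrans_mem hq a i⟩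

theorem wordWeight_gibbs (hq : 2 ≤ q) (lam : Fin m → ℝ) (Φ : Fin m → Fin m → ℝ)
    (s r : ℝ) {a : Fin m → Fin m → ℝ} (ha : a = fun i j => -(r * lam i) + s * Φ i j)
    (u : ℕ → Fin m) (N : ℕ) :
    wordWeight q (gibbsPair hq a).1 (q * N) u = Real.exp (
      ∑ k ∈ Finset.Icc 1 (q * N), logSolution q a (u k) -
        q * ∑ k ∈ Finset.Icc 1 N, logSolution q a (u k) +
        s * ∑ k ∈ Finset.Icc 1 N, Φ (u k) (u (q * k)) - r * ∑ k ∈ Finset.Icc 1 N, lam (u k) -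
        N * matrixPressure q a) := by
  have hN : q * N / q = N := Nat.mul_div_cancel_left N (by lia)
  have e1 : ∏ k ∈ Finset.Icc 1 (q * N) with ¬ q ∣ k, gibbsInit q a (u k) =
      Real.exp (∑ k ∈ Finset.Icc 1 (q * N),
        (logSolution q a (u k) - logSumExp (logSolution q a)) -
        ∑ k ∈ Finset.Icc 1 N, (logSolution q a (u (q * k)) - logSumExp (logSolution q a))) := by
    have := sum_filter_not_dvd (q := q) (by lia) (q * N)
      fun k => logSolution q a (u k) - logSumExp (logSolution q a)
    rw [hN] at this
    rw [← this, Real.exp_sum]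
    rfl
  have e2 : ∏ k ∈ Finset.Icc 1 N, gibbsTrans q a (u k) (u (q * k)) =
      Real.exp (∑ k ∈ Finset.Icc 1 N, (a (u k) (u (q * k)) + logSolution q a (u (q * k)) -
        q * logSolution q a (u k))) := by
    rw [Real.exp_sum]; rfl
  rw [wordWeight, hN]
  change (∏ k ∈ Finset.Icc 1 (q * N) with ¬ q ∣ k, gibbsInit q a (u k)) *
    (∏ k ∈ Finset.Icc 1 N, gibbsTrans q a (u k) (u (q * k))) = _
  rw [e1, e2, ← Real.exp_add]
  congr 1
  have e3 : ∀ k, a (u k) (u (q * k)) = -(r * lam (u k)) + s * Φ (u k) (u (q * k)) :=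
    fun k => by rw [ha]
  simp_rw [e3, Finset.sum_sub_distrib, Finset.sum_add_distrib, Finset.sum_neg_distrib,
    ← Finset.mul_sum, Finset.sum_const, Nat.card_Icc, Nat.add_sub_cancel, nsmul_eq_mul,
    matrixPressure]
  push_cast
  ring

theorem wordWeight_le_one (hq : 2 ≤ q) (z : markovPairs m) (n : ℕ) (u : ℕ → Fin m) :
    wordWeight q z.1 n u ≤ 1 := by
  have h := chainsLaw_cylinder hq z u n
  have h2 : chainsLaw z {ξ | ∀ k ∈ Finset.Icc 1 n, interleave q ξ k = u k} ≤ 1 := prob_le_one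
  rw [h] at h2
  exact ENNReal.ofReal_le_one.1 h2

/-- A bounded sequence cannot decrease by a fixed amount at every step. -/
theorem frequently_sub_lt_of_bounded {x : ℕ → ℝ} {M ε : ℝ} (hM : ∀ n, |x n| ≤ M) (hε : 0 < ε) :
    ∃ᶠ n in atTop, -ε < x (n + 1) - x n := by
  intro h
  obtain ⟨n₀, hn₀⟩ := eventually_atTop.1 h
  push Not at hn₀
  have h1 : ∀ k : ℕ, x (n₀ + k) ≤ x n₀ - k * ε := by
    intro k
    induction k with
    | zero => simp
    | succ k ih =>
      have := hn₀ (n₀ + k) (by lia)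
      rw [← add_assoc]
      push_cast
      linarith
  obtain ⟨k, hk⟩ := exists_nat_gt (2 * M / ε)
  rw [div_lt_iff₀ hε] at hk
  have h2 := h1 k
  have h3 := abs_le.1 (hM n₀)
  have h4 := abs_le.1 (hM (n₀ + k))
  linarith

/-- If the averages of `Φ` along `ω` converge to `α` and `P(s, r) ≤ α s`, then infinitely many
initial words of `ω` have large weight. The averages of `y + (r/q) λ` at times `qˡ` and `qˡ⁺¹`
are compared, which are often close because they are bounded. -/
theorem frequently_le_wordWeight (hq : 2 ≤ q) (lam : Fin m → ℝ) (Φ : Fin m → Fin m → ℝ)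
    {α s r : ℝ} {a : Fin m → Fin m → ℝ} (ha : a = fun i j => -(r * lam i) + s * Φ i j)
    (hP : matrixPressure q a ≤ α * s) {ω : ℕ → Fin m} (hω : HasPairAverage q Φ ω α)
    {ε : ℝ} (hε : 0 < ε) :
    ∃ᶠ l : ℕ in atTop, Real.exp (-(r / q * ∑ k ∈ Finset.Icc 1 (q ^ (l + 1)), lam (ω k)) -
      ε * (q : ℝ) ^ (l + 1)) ≤ wordWeight q (gibbsPair hq a).1 (q ^ (l + 1)) ω := by
  have hq' : (2 : ℝ) ≤ q := by exact_mod_cast hq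
  set V : Fin m → ℝ := fun i => logSolution q a i + r / q * lam i with hV
  set x : ℕ → ℝ := fun l => (∑ k ∈ Finset.Icc 1 (q ^ l), V (ω k)) / (q : ℝ) ^ l with hx
  have hxb : ∀ l, |x l| ≤ ‖V‖ := by
    intro l
    simp only [hx]
    rw [abs_div, abs_of_pos (by positivity : (0 : ℝ) < (q : ℝ) ^ l), div_le_iff₀ (by positivity)]
    calc _ ≤ ∑ k ∈ Finset.Icc 1 (q ^ l), |V (ω k)| := Finset.abs_sum_le_sum_abs _ _
      _ ≤ ∑ k ∈ Finset.Icc 1 (q ^ l), ‖V‖ := Finset.sum_le_sum fun k _ => norm_le_pi_norm V _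
      _ = _ := by simp [mul_comm]
  have hfreq := frequently_sub_lt_of_bounded hxb (half_pos hε)
  have hpow : Tendsto (fun l : ℕ => q ^ l) atTop atTop := tendsto_pow_atTop_atTop_of_one_lt (by lia)
  have hlim : Tendsto (fun l : ℕ => s * ((∑ k ∈ Finset.Icc 1 (q ^ l), Φ (ω k) (ω (q * k))) /
      (q ^ l : ℕ)) - s * α) atTop (𝓝 0) := by
    have := ((hω.comp hpow).const_mul s).sub_const (s * α)
    rwa [sub_self] at this
  have hev := hlim.eventually_const_lt (show -(ε * q / 2) < 0 by
    have : 0 < ε * q / 2 := by positivity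
    linarith)
  refine (hfreq.and_eventually hev).mono fun l hl => ?_
  obtain ⟨h1, h2⟩ := hl
  have hN : (0 : ℝ) < (q : ℝ) ^ l := by positivity
  have hw := wordWeight_gibbs hq lam Φ s r ha ω (q ^ l)
  rw [← pow_succ'] at hw
  rw [hw, Real.exp_le_exp]
  simp only [hx, hV, Finset.sum_add_distrib, ← Finset.mul_sum] at h1
  push_cast at h2 ⊢
  set S := ∑ k ∈ Finset.Icc 1 (q ^ l), Φ (ω k) (ω (q * k))
  set W₁ := ∑ k ∈ Finset.Icc 1 (q ^ (l + 1)), logSolution q a (ω k)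
  set W₀ := ∑ k ∈ Finset.Icc 1 (q ^ l), logSolution q a (ω k)
  set L₁ := ∑ k ∈ Finset.Icc 1 (q ^ (l + 1)), lam (ω k)
  set L₀ := ∑ k ∈ Finset.Icc 1 (q ^ l), lam (ω k)
  have hq0 : (q : ℝ) ≠ 0 := by linarith
  have h3 : -(ε / 2) * (q : ℝ) ^ (l + 1) < (W₁ + r / q * L₁) - q * (W₀ + r / q * L₀) := by
    have := mul_lt_mul_of_pos_right h1 (by positivity : (0 : ℝ) < (q : ℝ) ^ (l + 1))
    have e : ((W₁ + r / q * L₁) / (q : ℝ) ^ (l + 1) - (W₀ + r / q * L₀) / (q : ℝ) ^ l) *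
        (q : ℝ) ^ (l + 1) = (W₁ + r / q * L₁) - q * (W₀ + r / q * L₀) := by
      rw [pow_succ]; field_simp
    linarith
  have h4 : -(ε / 2) * (q : ℝ) ^ (l + 1) < s * S - s * α * (q : ℝ) ^ l := by
    have := mul_lt_mul_of_pos_right h2 hN
    have e : (s * (S / (q : ℝ) ^ l) - s * α) * (q : ℝ) ^ l = s * S - s * α * (q : ℝ) ^ l := by
      field_simp
    rw [e] at this
    rw [pow_succ]
    linarith
  have h5 : (q : ℝ) ^ l * matrixPressure q a ≤ (q : ℝ) ^ l * (α * s) := by gcongr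
  have e6 : q * (r / q * L₀) = r * L₀ := by field_simp
  linarith

end GibbsWeight

namespace LinearCookieCutter

variable {m : ℕ} (C : LinearCookieCutter m) [NeZero m] {q : ℕ}

/-- If the level set of `α` is not empty, then `P(s, r) ≤ α s` implies `0 ≤ r`: weights of words
are at most `1`. -/
theorem nonneg_of_matrixPressure_le (hq : 2 ≤ q) {Φ : Fin m → Fin m → ℝ}
    {α s r : ℝ} {a : Fin m → Fin m → ℝ} (ha : a = fun i j => -(r * C.lam i) + s * Φ i j)
    (hP : matrixPressure q a ≤ α * s) {ω : ℕ → Fin m} (hω : HasPairAverage q Φ ω α) : 0 ≤ r := by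
  have hq' : (2 : ℝ) ≤ q := by exact_mod_cast hq
  by_contra! hr
  obtain ⟨c, hc, hle⟩ := C.exists_pos_le_lam
  have hε : 0 < -(r / q) * c / 2 := by
    have : 0 < -(r / q) := by rw [neg_pos]; exact div_neg_of_neg_of_pos hr (by linarith)
    positivity
  obtain ⟨l, hl⟩ := (frequently_le_wordWeight hq C.lam Φ ha hP hω hε).exists
  have h1 := hl.trans (wordWeight_le_one hq _ _ _)
  rw [Real.exp_le_one_iff] at h1
  have h2 : c * (q : ℝ) ^ (l + 1) ≤ ∑ k ∈ Finset.Icc 1 (q ^ (l + 1)), C.lam (ω k) := by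
    calc c * (q : ℝ) ^ (l + 1) = ∑ k ∈ Finset.Icc 1 (q ^ (l + 1)), c := by simp [mul_comm]
      _ ≤ _ := Finset.sum_le_sum fun k _ => hle _
  have h3 : -(r / q) * (c * (q : ℝ) ^ (l + 1)) ≤
      -(r / q) * ∑ k ∈ Finset.Icc 1 (q ^ (l + 1)), C.lam (ω k) :=
    mul_le_mul_of_nonneg_left h2 (by rw [Left.nonneg_neg_iff]
                                     exact div_nonpos_of_nonpos_of_nonneg hr.le (by linarith))
  have h4 : 0 < (q : ℝ) ^ (l + 1) := by positivity
  nlinarith [mul_pos hε h4]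

/-- A finite word, continued arbitrarily. -/
def _root_.extendWord {m : ℕ} [NeZero m] {n : ℕ} (u : Fin n → Fin m) (k : ℕ) : Fin m :=
  if h : k < n then u ⟨k, h⟩ else 0

theorem _root_.sum_wordWeight_le (hq : 2 ≤ q) (z : markovPairs m) (n : ℕ) :
    ∑ u : Fin (n + 1) → Fin m, ENNReal.ofReal (wordWeight q z.1 n (extendWord u)) ≤ m := by
  have hm : ∀ u : Fin (n + 1) → Fin m,
      MeasurableSet {ξ | ∀ k ∈ Finset.Icc 1 n, interleave q ξ k = extendWord u k} := fun u => by
    simp only [ofPred_forall]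
    exact MeasurableSet.iInter fun k => MeasurableSet.iInter fun _ =>
      measurableSet_eq_fun ((measurable_pi_apply k).comp measurable_interleave) measurable_const
  simp_rw [← chainsLaw_cylinder hq z]
  rw [← Finset.sum_fiberwise Finset.univ fun u : Fin (n + 1) → Fin m => u 0]
  calc _ ≤ ∑ _a : Fin m, (1 : ENNReal) := Finset.sum_le_sum fun a _ => by
        rw [← measure_biUnion_finset _ fun u _ => hm u]
        · exact prob_le_one
        · intro u hu v hv huv
          refine Set.disjoint_left.2 fun ξ h1 h2 => huv ?_
          funext k
          rcases Fin.eq_zero_or_eq_succ k with rfl | ⟨k, rfl⟩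
          · exact (Finset.mem_filter.1 hu).2.trans (Finset.mem_filter.1 hv).2.symm
          · have hk : (k.succ : ℕ) ∈ Finset.Icc 1 n := by
              rw [Finset.mem_Icc, Fin.val_succ]; lia
            have := (h1 _ hk).symm.trans (h2 _ hk)
            rw [extendWord, extendWord, dif_pos k.succ.2, dif_pos k.succ.2] at this
            exact this
    _ = m := by simp

/-- The upper bound: `P(s, r) ≤ α s` implies `dim L(α) ≤ r / q`. The level set is covered by
the intervals of words of length `qˡ` of large weight, for all large `l`. -/
theorem dimH_levelSet_le (hq : 2 ≤ q) {φ : ℝ → ℝ → ℝ} {Φ : Fin m → Fin m → ℝ}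
    (hφ : C.LocallyConstantWith φ Φ) {α s r : ℝ} {a : Fin m → Fin m → ℝ}
    (ha : a = fun i j => -(r * C.lam i) + s * Φ i j) (hP : matrixPressure q a ≤ α * s) :
    dimH (C.levelSet q φ α) ≤ ENNReal.ofReal (r / q) := by
  have hq' : (2 : ℝ) ≤ q := by exact_mod_cast hq
  rcases (C.levelSet q φ α).eq_empty_or_nonempty with hem | ⟨x₀, hx₀⟩
  · rw [hem, dimH_empty]; exact bot_le
  have hr : 0 ≤ r :=
    C.nonneg_of_matrixPressure_le hq ha hP ((C.mem_levelSet_iff hφ _ _).1 hx₀).2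
  obtain ⟨c, hc, hle⟩ := C.exists_pos_le_lam
  refine dimH_le fun d htop => ?_
  by_contra! hlt
  have hd : r / q < d := by
    rw [← ENNReal.ofReal_coe_nnreal] at hlt
    exact (ENNReal.ofReal_lt_ofReal_iff_of_nonneg (by positivity)).1 hlt
  have hd0 : (0 : ℝ) < d := lt_of_le_of_lt (by positivity) hd
  set ε := (d - r / q) * c / 2 with hεdef
  have hε : 0 < ε := by
    have : 0 < d - r / q := by linarith
    positivity
  set z := gibbsPair hq a
  -- the words of length `qˡ + 1` that are counted
  set good : ∀ l : ℕ, Set (Fin (q ^ (l + 1) + 1) → Fin m) := fun l =>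
    {u | C.wordLength (List.ofFn u) ^ (d : ℝ) ≤
      Real.exp (-(ε * (q : ℝ) ^ (l + 1))) * wordWeight q z.1 (q ^ (l + 1)) (extendWord u)}
    with hgood
  have hlen : ∀ n (u : Fin n → Fin m), C.wordLength (List.ofFn u) ≤ Real.exp (-(c * n)) := by
    intro n u
    rw [wordLength, List.map_ofFn, List.sum_ofFn]
    refine Real.exp_le_exp.2 (neg_le_neg ?_)
    calc c * n = ∑ i : Fin n, c := by simp [mul_comm]
      _ ≤ _ := Finset.sum_le_sum fun i _ => hle _
  -- words of large weight are counted
  have hmem : ∀ (ω : ℕ → Fin m) (l : ℕ),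
      Real.exp (-(r / q * ∑ k ∈ Finset.Icc 1 (q ^ (l + 1)), C.lam (ω k)) -
        ε * (q : ℝ) ^ (l + 1)) ≤ wordWeight q z.1 (q ^ (l + 1)) ω →
      (fun i : Fin (q ^ (l + 1) + 1) => ω i) ∈ good l := by
    intro ω l h
    have h1 : wordWeight q z.1 (q ^ (l + 1)) (extendWord fun i : Fin (q ^ (l + 1) + 1) => ω i) =
        wordWeight q z.1 (q ^ (l + 1)) ω :=
      wordWeight_congr hq fun k hk => by simp [extendWord, Nat.lt_succ_of_le hk]
    change C.wordLength (seqPrefix ω (q ^ (l + 1) + 1)) ^ (d : ℝ) ≤ _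
    rw [h1, wordLength_seqPrefix, ← Real.exp_mul, Finset.sum_range_succ',
      ← sum_Icc_one_eq_sum_range _ fun k => C.lam (ω k)]
    refine le_trans ?_ (mul_le_mul_of_nonneg_left h (Real.exp_pos _).le)
    rw [← Real.exp_add, Real.exp_le_exp]
    set Λ := ∑ k ∈ Finset.Icc 1 (q ^ (l + 1)), C.lam (ω k)
    have h2 : c * (q : ℝ) ^ (l + 1) ≤ Λ := by
      calc c * (q : ℝ) ^ (l + 1) = ∑ k ∈ Finset.Icc 1 (q ^ (l + 1)), c := by simp [mul_comm]
        _ ≤ _ := Finset.sum_le_sum fun k _ => hle _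
    have h3 : (d - r / q) * (c * (q : ℝ) ^ (l + 1)) ≤ (d - r / q) * Λ :=
      mul_le_mul_of_nonneg_left h2 (by linarith)
    have h4 := mul_pos hd0 (C.lam_pos (ω 0))
    have h5 : 2 * (ε * (q : ℝ) ^ (l + 1)) = (d - r / q) * (c * (q : ℝ) ^ (l + 1)) := by
      rw [hεdef]; ring
    linarith
  set g : ℕ → ENNReal := fun l => ENNReal.ofReal (Real.exp (-ε) ^ l) * m with hg
  have hgsum : ∑' l, g l ≠ ⊤ := by
    simp only [hg]
    rw [ENNReal.tsum_mul_right, ← ENNReal.ofReal_tsum_of_nonneg (fun l => by positivity)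
      (summable_geometric_of_lt_one (Real.exp_pos _).le (by simpa using hε))]
    exact ENNReal.mul_ne_top ENNReal.ofReal_ne_top (ENNReal.natCast_ne_top m)
  have hlevel : ∀ l, ∑' u : good l, ENNReal.ofReal (C.wordLength (List.ofFn u.1) ^ (d : ℝ)) ≤ g l := by
    intro l
    calc _ ≤ ∑' u : good l, ENNReal.ofReal (Real.exp (-(ε * (q : ℝ) ^ (l + 1)))) *
          ENNReal.ofReal (wordWeight q z.1 (q ^ (l + 1)) (extendWord u.1)) :=
        ENNReal.tsum_le_tsum fun u => by
          rw [← ENNReal.ofReal_mul (Real.exp_pos _).le]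
          exact ENNReal.ofReal_le_ofReal u.2
      _ = ENNReal.ofReal (Real.exp (-(ε * (q : ℝ) ^ (l + 1)))) *
          ∑' u : good l, ENNReal.ofReal (wordWeight q z.1 (q ^ (l + 1)) (extendWord u.1)) :=
        ENNReal.tsum_mul_left
      _ ≤ ENNReal.ofReal (Real.exp (-(ε * (q : ℝ) ^ (l + 1)))) *
          ∑' u : Fin (q ^ (l + 1) + 1) → Fin m,
            ENNReal.ofReal (wordWeight q z.1 (q ^ (l + 1)) (extendWord u)) := by
        gcongr
        exact ENNReal.tsum_comp_le_tsum_of_injective Subtype.val_injective _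
      _ ≤ g l := by
        rw [tsum_fintype]
        refine mul_le_mul' (ENNReal.ofReal_le_ofReal ?_) (sum_wordWeight_le hq z _)
        rw [← Real.exp_nat_mul, Real.exp_le_exp]
        have h1 : (l : ℝ) ≤ (q : ℝ) ^ (l + 1) := by
          exact_mod_cast (Nat.le_succ l).trans (Nat.lt_pow_self (by lia)).le
        nlinarith
  have hH : μH[(d : ℝ)] (C.levelSet q φ α) = 0 := by
    refine le_antisymm ((Measure.hausdorffMeasure_le_liminf_tsum (ι := fun l₀ : ℕ =>
      Σ k : ℕ, good (k + l₀)) (d : ℝ) (C.levelSet q φ α) (l := atTop)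
      (fun l₀ : ℕ => ENNReal.ofReal (Real.exp (-(c * l₀)))) ?_
      (fun l₀ i => Icc (C.wordLower (List.ofFn i.2.1))
        (C.wordLower (List.ofFn i.2.1) + C.wordLength (List.ofFn i.2.1))) ?_ ?_).trans ?_) bot_le
    · have h1 : Tendsto (fun l₀ : ℕ => Real.exp (-(c * l₀))) atTop (𝓝 0) :=
        Real.tendsto_exp_neg_atTop_nhds_zero.comp
          (tendsto_natCast_atTop_atTop.const_mul_atTop hc)
      simpa using ENNReal.tendsto_ofReal h1
    · refine Eventually.of_forall fun l₀ i => ?_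
      rw [Real.ediam_Icc, add_sub_cancel_left]
      refine ENNReal.ofReal_le_ofReal ((hlen _ _).trans (Real.exp_le_exp.2 (neg_le_neg ?_)))
      have h1 : l₀ ≤ q ^ (i.1 + l₀ + 1) + 1 :=
        ((by lia : l₀ ≤ i.1 + l₀ + 1).trans (Nat.lt_pow_self (by lia)).le).trans (Nat.le_succ _)
      gcongr
    · refine Eventually.of_forall fun l₀ x hx => ?_
      rw [C.mem_levelSet_iff hφ] at hx
      obtain ⟨l, hl, hw⟩ := (frequently_atTop.1
        (frequently_le_wordWeight hq C.lam Φ ha hP hx.2 hε)) l₀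
      obtain ⟨k, rfl⟩ := Nat.exists_eq_add_of_le' hl
      exact mem_iUnion.2 ⟨⟨k, _, hmem _ _ hw⟩, C.mem_wordInterval_itinerary hx.1 _⟩
    · refine le_trans (liminf_le_liminf (v := fun l₀ => ∑' k, g (k + l₀))
        (Eventually.of_forall fun l₀ => ?_)) (ENNReal.tendsto_sum_nat_add g hgsum).liminf_eq.le
      rw [ENNReal.tsum_sigma']
      refine ENNReal.tsum_le_tsum fun k => le_trans (le_of_eq ?_) (hlevel (k + l₀))
      congr 1
      funext u
      rw [Real.ediam_Icc, add_sub_cancel_left,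
        ENNReal.ofReal_rpow_of_pos (C.wordLength_pos _)]
  rw [hH] at htop
  exact ENNReal.zero_ne_top htop

end LinearCookieCutter

/-! ### The pressure function -/

section Pressure

variable {m : ℕ} {q : ℕ} {lam : Fin m → ℝ} {Φ : Fin m → Fin m → ℝ}

/-- The matrix of exponents of the transfer system. -/
def transferExponent (lam : Fin m → ℝ) (Φ : Fin m → Fin m → ℝ) (s r : ℝ) :
    Fin m → Fin m → ℝ :=
  fun i j => -(r * lam i) + s * Φ i j

variable [NeZero m]

theorem isTransferSolution_exp_iff {s r : ℝ} {y : Fin m → ℝ} :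
    IsTransferSolution q lam Φ s r (fun i => Real.exp (y i)) ↔
      IsLogSolution q (transferExponent lam Φ s r) y := by
  have e : ∀ i, (Real.exp (y i) ^ q = ∑ j, Real.exp (s * Φ i j - r * lam i) * Real.exp (y j)) ↔
      q * y i = logSumExp fun j => transferExponent lam Φ s r i j + y j := fun i => by
    rw [eq_comm (a := (q : ℝ) * y i), logSumExp_eq_iff, Real.exp_nat_mul]
    simp_rw [transferExponent, Real.exp_add, Real.exp_sub, Real.exp_neg, div_eq_mul_inv,
      mul_comm (Real.exp (_ * lam _))⁻¹]
  exact ⟨fun h i => (e i).1 (h.2 i), fun h => ⟨fun i => Real.exp_pos _, fun i => (e i).2 (h i)⟩⟩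

theorem IsTransferSolution.eq_exp (hq : 2 ≤ q) {s r : ℝ} {t : Fin m → ℝ}
    (h : IsTransferSolution q lam Φ s r t) :
    t = fun i => Real.exp (logSolution q (transferExponent lam Φ s r) i) := by
  have ht : t = fun i => Real.exp (Real.log (t i)) := funext fun i => (Real.exp_log (h.1 i)).symm
  have h2 : IsLogSolution q (transferExponent lam Φ s r) fun i => Real.log (t i) :=
    isTransferSolution_exp_iff.1 (ht ▸ h)
  rw [← h2.unique hq (isLogSolution_logSolution hq _)]
  exact ht

theorem existsUnique_isTransferSolution (hq : 2 ≤ q) (lam : Fin m → ℝ) (Φ : Fin m → Fin m → ℝ)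
    (s r : ℝ) : ∃! t, IsTransferSolution q lam Φ s r t :=
  ⟨_, isTransferSolution_exp_iff.2 (isLogSolution_logSolution hq _), fun _ ht => ht.eq_exp hq⟩

theorem pressure_eq (hq : 2 ≤ q) (lam : Fin m → ℝ) (Φ : Fin m → Fin m → ℝ) (s r : ℝ) :
    pressure q lam Φ s r = matrixPressure q (transferExponent lam Φ s r) := by
  have h := (existsUnique_isTransferSolution hq lam Φ s r).exists
  have h2 : transferSolution q lam Φ s r =
      fun i => Real.exp (logSolution q (transferExponent lam Φ s r) i) := by
    rw [transferSolution, dif_pos h]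
    exact h.choose_spec.eq_exp hq
  rw [pressure, matrixPressure, h2, ← exp_logSumExp, Real.log_exp]

/-- The pressure is differentiable in `s`, and its derivative is the mean of the potential under
the Gibbs chain. -/
theorem hasDerivAt_pressure (hq : 2 ≤ q) (lam : Fin m → ℝ) (Φ : Fin m → Fin m → ℝ) (s r : ℝ) :
    HasDerivAt (fun s => pressure q lam Φ s r)
      (pairMean q (gibbsPair hq (transferExponent lam Φ s r)).1 Φ) s := by
  obtain ⟨w, hw, hw2⟩ := exists_hasDerivAt_logSolution hq (fun i _ => -(r * lam i)) Φ s
  have h := hasDerivAt_matrixPressure (q := q)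
    (Y := fun s => transferExponent lam Φ s r) hw
  rw [pairMean_eq_of_telescoping hq (gibbsPair hq (transferExponent lam Φ s r)).2 (w := w) hw2]
  simp_rw [pressure_eq hq]
  exact h

theorem pressureDeriv_eq (hq : 2 ≤ q) (lam : Fin m → ℝ) (Φ : Fin m → Fin m → ℝ) (s r : ℝ) :
    pressureDeriv q lam Φ s r =
      pairMean q (gibbsPair hq (transferExponent lam Φ s r)).1 Φ :=
  (hasDerivAt_pressure hq lam Φ s r).deriv

theorem differentiable_pressure (hq : 2 ≤ q) (lam : Fin m → ℝ) (Φ : Fin m → Fin m → ℝ) (r : ℝ) :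
    Differentiable ℝ fun s => pressure q lam Φ s r :=
  fun s => (hasDerivAt_pressure hq lam Φ s r).differentiableAt

theorem pressure_le_sub_mul (hq : 2 ≤ q) {c : ℝ} (hc : ∀ i, c ≤ lam i) (Φ : Fin m → Fin m → ℝ)
    (s r r' : ℝ) (h : r ≤ r') :
    pressure q lam Φ s r' ≤ pressure q lam Φ s r - c * (r' - r) := by
  rw [pressure_eq hq, pressure_eq hq, sub_eq_add_neg]
  refine matrixPressure_le_add hq fun i j => ?_
  have := mul_le_mul_of_nonneg_right (hc i) (sub_nonneg.2 h)
  simp only [transferExponent]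
  linarith

theorem pressure_le_add_mul (hq : 2 ≤ q) {L : ℝ} (hL : ∀ i, lam i ≤ L) (Φ : Fin m → Fin m → ℝ)
    (s r r' : ℝ) (h : r ≤ r') :
    pressure q lam Φ s r ≤ pressure q lam Φ s r' + L * (r' - r) := by
  rw [pressure_eq hq, pressure_eq hq]
  refine matrixPressure_le_add hq fun i j => ?_
  have := mul_le_mul_of_nonneg_right (hL i) (sub_nonneg.2 h)
  simp only [transferExponent]
  linarith

theorem pressure_le_add_norm (hq : 2 ≤ q) (lam : Fin m → ℝ) (Φ : Fin m → Fin m → ℝ)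
    (s r s' r' : ℝ) :
    pressure q lam Φ s r ≤ pressure q lam Φ s' r' + (‖lam‖ * |r - r'| + ‖Φ‖ * |s - s'|) := by
  rw [pressure_eq hq, pressure_eq hq]
  refine matrixPressure_le_add hq fun i j => ?_
  have h1 : |(r - r') * lam i| ≤ ‖lam‖ * |r - r'| := by
    rw [abs_mul, mul_comm]
    exact mul_le_mul_of_nonneg_right (norm_le_pi_norm lam i) (abs_nonneg _)
  have h2 : |(s - s') * Φ i j| ≤ ‖Φ‖ * |s - s'| := by
    rw [abs_mul, mul_comm]
    exact mul_le_mul_of_nonneg_right ((norm_le_pi_norm (Φ i) j).trans (norm_le_pi_norm Φ i))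
      (abs_nonneg _)
  have h3 := neg_abs_le ((r - r') * lam i)
  have h4 := le_abs_self ((s - s') * Φ i j)
  simp only [transferExponent]
  linarith

theorem continuous_pressure (hq : 2 ≤ q) (lam : Fin m → ℝ) (Φ : Fin m → Fin m → ℝ) :
    Continuous fun u : ℝ × ℝ => pressure q lam Φ u.1 u.2 := by
  rw [continuous_iff_continuousAt]
  intro u
  rw [ContinuousAt, tendsto_iff_dist_tendsto_zero]
  have hlim : Tendsto (fun v : ℝ × ℝ => ‖lam‖ * |v.2 - u.2| + ‖Φ‖ * |v.1 - u.1|) (𝓝 u) (𝓝 0) :=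
    Continuous.tendsto' (by fun_prop) _ _ (by simp)
  refine squeeze_zero (fun _ => dist_nonneg) (fun v => ?_) hlim
  have h1 := pressure_le_add_norm hq lam Φ v.1 v.2 u.1 u.2
  have h2 := pressure_le_add_norm hq lam Φ u.1 u.2 v.1 v.2
  rw [abs_sub_comm u.2, abs_sub_comm u.1] at h2
  rw [Real.dist_eq, abs_le]
  constructor <;> linarith

theorem convexOn_pressure (hq : 2 ≤ q) (lam : Fin m → ℝ) (Φ : Fin m → Fin m → ℝ) (r : ℝ) :
    ConvexOn ℝ univ fun s => pressure q lam Φ s r := by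
  refine convexOn_iff_forall_pos.2 ⟨convex_univ, fun x _ y _ θ θ' h0 h1 h => ?_⟩
  obtain rfl : θ' = 1 - θ := by linarith
  have := matrixPressure_convex hq (transferExponent lam Φ x r) (transferExponent lam Φ y r)
    h0.le (by linarith)
  simp only [pressure_eq hq, smul_eq_mul]
  refine le_trans (le_of_eq ?_) this
  congr 1
  funext i j
  simp only [transferExponent]
  ring

/-- The graph of `P(·, r)` lies above its tangents. -/
theorem tangent_le_pressure (hq : 2 ≤ q) (lam : Fin m → ℝ) (Φ : Fin m → Fin m → ℝ)
    (s s' r : ℝ) :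
    pressure q lam Φ s r + pressureDeriv q lam Φ s r * (s' - s) ≤ pressure q lam Φ s' r := by
  have hd := hasDerivAt_pressure hq lam Φ s r
  rw [← pressureDeriv_eq] at hd
  have hcv := convexOn_pressure hq lam Φ r
  rcases lt_trichotomy s s' with h | rfl | h
  · have := hcv.le_slope_of_hasDerivAt (mem_univ s) (mem_univ s') h hd
    rw [slope_def_field, le_div_iff₀ (sub_pos.2 h)] at this
    linarith
  · simp
  · have := hcv.slope_le_of_hasDerivAt (mem_univ s') (mem_univ s) h hd
    rw [slope_def_field, div_le_iff₀ (sub_pos.2 h)] at this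
    linarith

theorem strictMono_pressureDeriv (hq : 2 ≤ q) (lam : Fin m → ℝ) (hΦ : ¬ ∃ c, ∀ i j, Φ i j = c)
    (r : ℝ) : StrictMono fun s => pressureDeriv q lam Φ s r := by
  have hs : StrictConvexOn ℝ univ fun s => pressure q lam Φ s r := by
    refine ⟨convex_univ, fun x _ y _ hxy θ θ' h0 h1 h => ?_⟩
    obtain rfl : θ' = 1 - θ := by linarith
    by_contra! hle
    simp only [pressure_eq hq, smul_eq_mul] at hle
    obtain ⟨c, hc⟩ := sub_eq_const_of_matrixPressure_eq hq (transferExponent lam Φ x r)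
      (transferExponent lam Φ y r) h0 (by linarith) (hle.trans (le_of_eq (by
        congr 1
        funext i j
        simp only [transferExponent]
        ring)))
    refine hΦ ⟨c / (x - y), fun i j => ?_⟩
    rw [eq_div_iff (sub_ne_zero.2 hxy), ← hc i j]
    simp only [transferExponent]
    ring
  intro s s' hss
  exact hs.strictMonoOn_deriv (fun s _ => differentiable_pressure hq lam Φ r s)
    (mem_univ s) (mem_univ s') hss

theorem abs_pressureDeriv_le (hq : 2 ≤ q) (lam : Fin m → ℝ) (Φ : Fin m → Fin m → ℝ) (s r : ℝ) :
    |pressureDeriv q lam Φ s r| ≤ ‖Φ‖ := by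
  have h1 := tangent_le_pressure hq lam Φ s (s + 1) r
  have h2 := tangent_le_pressure hq lam Φ s (s - 1) r
  have h3 := pressure_le_add_norm hq lam Φ (s + 1) r s r
  have h4 := pressure_le_add_norm hq lam Φ (s - 1) r s r
  simp at h1 h2 h3 h4
  rw [abs_le]
  constructor <;> linarith

theorem bddBelow_slopeSet (hq : 2 ≤ q) (lam : Fin m → ℝ)
    (Φ : Fin m → Fin m → ℝ) : BddBelow (slopeSet q lam Φ) :=
  ⟨-‖Φ‖, fun _ ⟨s, r, h⟩ => h ▸ (abs_le.1 (abs_pressureDeriv_le hq lam Φ s r)).1⟩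

theorem bddAbove_slopeSet (hq : 2 ≤ q) (lam : Fin m → ℝ)
    (Φ : Fin m → Fin m → ℝ) : BddAbove (slopeSet q lam Φ) :=
  ⟨‖Φ‖, fun _ ⟨s, r, h⟩ => h ▸ (abs_le.1 (abs_pressureDeriv_le hq lam Φ s r)).2⟩

theorem isCritical_iff (hq : 2 ≤ q) (lam : Fin m → ℝ) (Φ : Fin m → Fin m → ℝ) (α s r : ℝ) :
    IsCritical q lam Φ α s r ↔
      pressure q lam Φ s r = α * s ∧ ∀ s', α * s' ≤ pressure q lam Φ s' r := by
  refine ⟨fun ⟨h1, h2⟩ => ⟨h1, fun s' => ?_⟩, fun ⟨h1, h2⟩ => ⟨h1, ?_⟩⟩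
  · have := tangent_le_pressure hq lam Φ s s' r
    rw [h1, h2] at this
    linarith
  · have hd := (hasDerivAt_pressure hq lam Φ s r).sub ((hasDerivAt_id s).const_mul α)
    have hmin : IsLocalMin ((fun s => pressure q lam Φ s r) - fun s => α * id s) s :=
      Eventually.of_forall fun s' => by
        have := h2 s'
        simp only [Pi.sub_apply, id]
        linarith
    have := hmin.hasDerivAt_eq_zero hd
    rw [pressureDeriv_eq hq]
    linarith

theorem pressure_eq_of_const (hq : 2 ≤ q) (lam : Fin m → ℝ) {c : ℝ}
    (hc : ∀ i j, Φ i j = c) (s r : ℝ) :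
    pressure q lam Φ s r = pressure q lam Φ 0 r + c * s := by
  simp only [pressure_eq hq]
  refine le_antisymm (matrixPressure_le_add hq fun i j => ?_) ?_
  · simp only [transferExponent, hc]
    linarith
  · rw [← le_sub_iff_add_le, sub_eq_add_neg]
    refine matrixPressure_le_add hq fun i j => ?_
    simp only [transferExponent, hc]
    linarith

theorem pressureDeriv_eq_of_const (hq : 2 ≤ q) (lam : Fin m → ℝ) {c : ℝ}
    (hc : ∀ i j, Φ i j = c) (s r : ℝ) : pressureDeriv q lam Φ s r = c := by
  have h : (fun s => pressure q lam Φ s r) = fun s => pressure q lam Φ 0 r + c * s :=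
    funext fun s => pressure_eq_of_const hq lam hc s r
  rw [pressureDeriv, h]
  simp

/-- The Gibbs chain at a critical point realises the pair `(α, r)`. -/
theorem IsCritical.mem_chainSpectrum (hq : 2 ≤ q) {α s r : ℝ}
    (h : IsCritical q lam Φ α s r) : (α, r) ∈ chainSpectrum q lam Φ := by
  obtain ⟨h1, h2⟩ := h
  rw [pressureDeriv_eq hq] at h2
  rw [pressure_eq hq] at h1
  have h := entropyRate_gibbs hq lam Φ s r (a := transferExponent lam Φ s r) rfl
  rw [h1] at h
  refine ⟨_, (gibbsPair hq (transferExponent lam Φ s r)).2, h2, h.trans ?_⟩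
  rw [← h2, gibbsPair]
  ring

end Pressure

/-! ### Level sets and the pressure -/

namespace LinearCookieCutter

variable {m : ℕ} [NeZero m] (C : LinearCookieCutter m) {q : ℕ} {φ : ℝ → ℝ → ℝ}
  {Φ : Fin m → Fin m → ℝ}

theorem nonneg_of_pressure_le (hq : 2 ≤ q) (hφ : C.LocallyConstantWith φ Φ) {α s r : ℝ}
    (hne : (C.levelSet q φ α).Nonempty) (hP : pressure q C.lam Φ s r ≤ α * s) : 0 ≤ r := by
  obtain ⟨x, hx⟩ := hne
  rw [pressure_eq hq] at hP
  exact C.nonneg_of_matrixPressure_le hq rfl hP ((C.mem_levelSet_iff hφ α x).1 hx).2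

theorem dimH_levelSet_le_of_pressure_le (hq : 2 ≤ q) (hφ : C.LocallyConstantWith φ Φ) {α s r : ℝ}
    (hP : pressure q C.lam Φ s r ≤ α * s) :
    dimH (C.levelSet q φ α) ≤ ENNReal.ofReal (r / q) := by
  rw [pressure_eq hq] at hP
  exact C.dimH_levelSet_le hq hφ rfl hP

theorem mul_le_pressure_zero (hq : 2 ≤ q) (hφ : C.LocallyConstantWith φ Φ) {α : ℝ}
    (hne : (C.levelSet q φ α).Nonempty) (s : ℝ) : α * s ≤ pressure q C.lam Φ s 0 := by
  by_contra! h
  obtain ⟨L, hL0, hL⟩ := C.exists_lam_le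
  set η := (α * s - pressure q C.lam Φ s 0) / L with hη
  have hη0 : 0 < η := div_pos (by linarith) hL0
  have h1 := pressure_le_add_mul hq hL Φ s (-η) 0 (by linarith)
  have h2 : L * (0 - -η) = α * s - pressure q C.lam Φ s 0 := by
    rw [hη]; field_simp; ring
  have := C.nonneg_of_pressure_le hq hφ hne (s := s) (r := -η) (by linarith)
  linarith

theorem levelSet_nonempty_of_mem_chainSpectrum (hq : 2 ≤ q) (hφ : C.LocallyConstantWith φ Φ)
    {α r : ℝ} (h : (α, r) ∈ chainSpectrum q C.lam Φ) : (C.levelSet q φ α).Nonempty := by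
  obtain ⟨z, hz, h1, -⟩ := h
  obtain rfl : pairMean q z Φ = α := h1
  exact C.levelSet_pairMean_nonempty hq hφ ⟨z, hz⟩

theorem le_dimH_levelSet_of_mem_chainSpectrum (hq : 2 ≤ q) (hφ : C.LocallyConstantWith φ Φ)
    {α r : ℝ} (h : (α, r) ∈ chainSpectrum q C.lam Φ) :
    ENNReal.ofReal (r / q) ≤ dimH (C.levelSet q φ α) := by
  obtain ⟨z, hz, rfl, h2⟩ := h
  obtain ⟨c, hc, hle⟩ := C.exists_pos_le_lam
  have hlm := hc.trans_le (le_pairMean hq hz hle)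
  have hq0 : (0 : ℝ) < q := by exact_mod_cast (by lia : 0 < q)
  refine le_of_forall_lt fun b hb => ?_
  obtain ⟨d, hd1, hd2⟩ := ENNReal.lt_iff_exists_nnreal_btwn.1 hb
  rw [ENNReal.lt_ofReal_iff_toReal_lt ENNReal.coe_ne_top, ENNReal.coe_toReal] at hd2
  have hd0 : (0 : ENNReal) < d := bot_le.trans_lt hd1
  replace hd0 : (0 : ℝ) < d := by exact_mod_cast hd0
  refine hd1.trans_le ?_
  rw [← ENNReal.ofReal_coe_nnreal]
  refine C.le_dimH_levelSet hq hφ ⟨z, hz⟩ hd0 ?_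
  simp only [] at h2 ⊢
  rw [lt_div_iff₀ hq0] at hd2
  nlinarith [mul_lt_mul_of_pos_right hd2 hlm]

variable {A B : ℝ}

/-- If `L(α)` is not empty, then `α s ≤ P(s, 0)`, while the derivative of `P(·, 0)` stays between
`A` and `B`: comparing growth at `±∞` gives `A ≤ α ≤ B`. -/
theorem levelSet_nonempty_subset (hq : 2 ≤ q) (hφ : C.LocallyConstantWith φ Φ)
    (hA : IsGLB (slopeSet q C.lam Φ) A) (hB : IsLUB (slopeSet q C.lam Φ) B) :
    {α : ℝ | (C.levelSet q φ α).Nonempty} ⊆ Icc A B := by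
  intro α hα
  have h1 : ∀ s, A ≤ pressureDeriv q C.lam Φ s 0 := fun s => hA.1 ⟨s, 0, rfl⟩
  have h2 : ∀ s, pressureDeriv q C.lam Φ s 0 ≤ B := fun s => hB.1 ⟨s, 0, rfl⟩
  have key : ∀ s, α * s ≤ pressure q C.lam Φ 0 0 + pressureDeriv q C.lam Φ s 0 * s := fun s => by
    have := C.mul_le_pressure_zero hq hφ hα s
    have := tangent_le_pressure hq C.lam Φ s 0 0
    linarith
  set p := pressure q C.lam Φ 0 0
  have hp := key 0
  simp only [mul_zero, add_zero] at hp
  constructor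
  · by_contra! h
    have hA' : 0 < A - α := by linarith
    set s := (p + 1) / (A - α) with hs
    have hs0 : 0 ≤ s := by positivity
    have e : (A - α) * s = p + 1 := by rw [hs]; field_simp
    have := key (-s)
    have := mul_le_mul_of_nonneg_right (h1 (-s)) hs0
    linarith
  · by_contra! h
    have hB' : 0 < α - B := by linarith
    set s := (p + 1) / (α - B) with hs
    have hs0 : 0 ≤ s := by positivity
    have e : (α - B) * s = p + 1 := by rw [hs]; field_simp
    have := key s
    have := mul_le_mul_of_nonneg_right (h2 s) hs0
    linarith

theorem exists_isCritical (hq : 2 ≤ q) (hA : IsGLB (slopeSet q C.lam Φ) A)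
    (hB : IsLUB (slopeSet q C.lam Φ) B) {α : ℝ} (hα : α ∈ Ioo A B) :
    ∃ s r, IsCritical q C.lam Φ α s r := by
  obtain ⟨c, hc, hle⟩ := C.exists_pos_le_lam
  obtain ⟨L, hL0, hL⟩ := C.exists_lam_le
  have line : ∀ s₀ r₀ : ℝ, ∃ k, ∀ s,
      pressureDeriv q C.lam Φ s₀ r₀ * s - k ≤ pressure q C.lam Φ s 0 := fun s₀ r₀ => by
    refine ⟨-pressure q C.lam Φ s₀ r₀ + pressureDeriv q C.lam Φ s₀ r₀ * s₀ + ‖C.lam‖ * |r₀ - 0|,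
      fun s => ?_⟩
    have h1 := tangent_le_pressure hq C.lam Φ s₀ s r₀
    have h2 := pressure_le_add_norm hq C.lam Φ s r₀ s 0
    rw [sub_self, abs_zero, mul_zero] at h2
    linarith
  obtain ⟨_, ⟨s₁, r₁, rfl⟩, h1⟩ := (isGLB_lt_iff hA).1 hα.1
  obtain ⟨_, ⟨s₂, r₂, rfl⟩, h2⟩ := (lt_isLUB_iff hB).1 hα.2
  obtain ⟨k₁, hk₁⟩ := line s₁ r₁
  obtain ⟨k₂, hk₂⟩ := line s₂ r₂
  obtain ⟨s, r, h⟩ := exists_touching hc hL0 (continuous_pressure hq C.lam Φ)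
    (pressure_le_sub_mul hq hle Φ) (pressure_le_add_mul hq hL Φ) h1 h2 hk₁ hk₂
  exact ⟨s, r, (isCritical_iff hq C.lam Φ α s r).2 h⟩

theorem nonneg_of_pressure_le_of_mem_Icc (hq : 2 ≤ q) (hφ : C.LocallyConstantWith φ Φ)
    (hA : IsGLB (slopeSet q C.lam Φ) A) (hB : IsLUB (slopeSet q C.lam Φ) B) (hAB : A < B)
    {α : ℝ} (hα : α ∈ Icc A B) {s r : ℝ} (hP : pressure q C.lam Φ s r ≤ α * s) : 0 ≤ r := by
  obtain ⟨c, hc, hle⟩ := C.exists_pos_le_lam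
  have h0 : α * s ≤ pressure q C.lam Φ s 0 := by
    have hcl : IsClosed {α : ℝ | α * s ≤ pressure q C.lam Φ s 0} :=
      isClosed_le (by fun_prop) continuous_const
    have hsub : Ioo A B ⊆ {α : ℝ | α * s ≤ pressure q C.lam Φ s 0} := fun α hα => by
      obtain ⟨s₁, r₁, h⟩ := C.exists_isCritical hq hA hB hα
      exact C.mul_le_pressure_zero hq hφ
        (C.levelSet_nonempty_of_mem_chainSpectrum hq hφ (h.mem_chainSpectrum hq)) s
    have := closure_minimal hsub hcl
    rw [closure_Ioo hAB.ne] at this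
    exact this hα
  by_contra! hr
  have := pressure_le_sub_mul hq hle Φ s r 0 hr.le
  nlinarith

theorem touchingValue_eq_of_isCritical (hq : 2 ≤ q) {α s r : ℝ}
    (h : IsCritical q C.lam Φ α s r) : touchingValue (pressure q C.lam Φ) α = r := by
  obtain ⟨c, hc, hle⟩ := C.exists_pos_le_lam
  obtain ⟨h1, h2⟩ := (isCritical_iff hq C.lam Φ α s r).1 h
  exact touchingValue_eq hc (pressure_le_sub_mul hq hle Φ) h1.le h2

theorem tendsto_touchingValue_pressure (hq : 2 ≤ q) (hφ : C.LocallyConstantWith φ Φ)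
    (hA : IsGLB (slopeSet q C.lam Φ) A) (hB : IsLUB (slopeSet q C.lam Φ) B) (hAB : A < B) :
    Tendsto (touchingValue (pressure q C.lam Φ)) (𝓝[>] A)
        (𝓝 (touchingValue (pressure q C.lam Φ) A)) ∧
      Tendsto (touchingValue (pressure q C.lam Φ)) (𝓝[<] B)
        (𝓝 (touchingValue (pressure q C.lam Φ) B)) := by
  obtain ⟨c, hc, hle⟩ := C.exists_pos_le_lam
  obtain ⟨L, hL0, hL⟩ := C.exists_lam_le
  have hlo := pressure_le_sub_mul hq hle Φ
  have hhi := pressure_le_add_mul hq hL Φ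
  have hnn : ∀ α ∈ Icc A B, ∀ s r, pressure q C.lam Φ s r ≤ α * s → 0 ≤ r :=
    fun α hα s r => C.nonneg_of_pressure_le_of_mem_Icc hq hφ hA hB hAB hα
  have hex : ∀ α ∈ Ioo A B, ∃ s r, pressure q C.lam Φ s r = α * s ∧
      ∀ s', α * s' ≤ pressure q C.lam Φ s' r := fun α hα => by
    obtain ⟨s, r, h⟩ := C.exists_isCritical hq hA hB hα
    exact ⟨s, r, (isCritical_iff hq C.lam Φ α s r).1 h⟩
  exact ⟨tendsto_touchingValue_right hc hL0 hlo hhi hAB hnn hex,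
    tendsto_touchingValue_left hc hL0 hlo hhi hAB hnn hex⟩

/-- The end points are limits of interior ones, and the spectrum of the Markov chains is closed. -/
theorem touchingValue_mem_chainSpectrum (hq : 2 ≤ q) (hφ : C.LocallyConstantWith φ Φ)
    (hA : IsGLB (slopeSet q C.lam Φ) A) (hB : IsLUB (slopeSet q C.lam Φ) B) (hAB : A < B)
    {α : ℝ} (hα : α ∈ Icc A B) :
    (α, touchingValue (pressure q C.lam Φ) α) ∈ chainSpectrum q C.lam Φ := by
  have hin : ∀ α ∈ Ioo A B,
      (α, touchingValue (pressure q C.lam Φ) α) ∈ chainSpectrum q C.lam Φ := fun α hα => by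
    obtain ⟨s, r, h⟩ := C.exists_isCritical hq hA hB hα
    rw [C.touchingValue_eq_of_isCritical hq h]
    exact h.mem_chainSpectrum hq
  have hcl := isClosed_chainSpectrum hq C.lam Φ
  obtain ⟨hlA, hlB⟩ := C.tendsto_touchingValue_pressure hq hφ hA hB hAB
  rcases eq_or_lt_of_le hα.1 with rfl | h1
  · refine hcl.mem_of_tendsto ((tendsto_nhdsWithin_of_tendsto_nhds tendsto_id).prodMk_nhds hlA) ?_
    filter_upwards [Ioo_mem_nhdsGT hAB] using hin
  rcases eq_or_lt_of_le hα.2 with rfl | h2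
  · refine hcl.mem_of_tendsto ((tendsto_nhdsWithin_of_tendsto_nhds tendsto_id).prodMk_nhds hlB) ?_
    filter_upwards [Ioo_mem_nhdsLT hAB] using hin
  · exact hin α ⟨h1, h2⟩

theorem dimH_levelSet_eq (hq : 2 ≤ q) (hφ : C.LocallyConstantWith φ Φ)
    (hA : IsGLB (slopeSet q C.lam Φ) A) (hB : IsLUB (slopeSet q C.lam Φ) B) (hAB : A < B)
    {α : ℝ} (hα : α ∈ Icc A B) :
    0 ≤ touchingValue (pressure q C.lam Φ) α ∧ dimH (C.levelSet q φ α) =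
      ENNReal.ofReal (touchingValue (pressure q C.lam Φ) α / q) := by
  have hq0 : (0 : ℝ) < q := by exact_mod_cast (by lia : 0 < q)
  have hnn : ∀ r ∈ {r | ∃ s, pressure q C.lam Φ s r ≤ α * s}, 0 ≤ r := fun r ⟨s, hs⟩ =>
    C.nonneg_of_pressure_le_of_mem_Icc hq hφ hA hB hAB hα hs
  have hne : {r | ∃ s, pressure q C.lam Φ s r ≤ α * s}.Nonempty := by
    obtain ⟨c, hc, hle⟩ := C.exists_pos_le_lam
    refine ⟨max (pressure q C.lam Φ 0 0 / c) 0, 0, ?_⟩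
    have h := pressure_le_sub_mul hq hle Φ 0 0 _ (le_max_right (pressure q C.lam Φ 0 0 / c) 0)
    have h2 := (div_le_iff₀' hc).1 (le_max_left (pressure q C.lam Φ 0 0 / c) 0)
    linarith
  refine ⟨Real.sInf_nonneg hnn, le_antisymm ?_ (C.le_dimH_levelSet_of_mem_chainSpectrum hq hφ
    (C.touchingValue_mem_chainSpectrum hq hφ hA hB hAB hα))⟩
  obtain ⟨u, -, hu, hmem⟩ := exists_seq_tendsto_sInf hne ⟨0, hnn⟩
  refine ge_of_tendsto' (ENNReal.tendsto_ofReal (hu.div_const (q : ℝ))) fun n => ?_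
  obtain ⟨s, hs⟩ := hmem n
  exact C.dimH_levelSet_le_of_pressure_le hq hφ hs

/-- The pressure at `s = 0` decreases strictly from `+∞` to `-∞`. -/
theorem exists_pressure_zero_eq_zero_iff (hq : 2 ≤ q) (Φ : Fin m → Fin m → ℝ) :
    ∃ r, ∀ r', pressure q C.lam Φ 0 r' = 0 ↔ r' = r := by
  obtain ⟨l, hl, hle⟩ := C.exists_pos_le_lam
  have hlo := pressure_le_sub_mul hq hle Φ 0
  have hcont := continuous_pressure hq C.lam Φ
  generalize pressure q C.lam Φ = Q at *
  replace hcont : Continuous (Q 0) := hcont.comp (Continuous.prodMk_right (0 : ℝ))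
  generalize Q 0 = P at *
  have hR : 0 ≤ |P 0| / l := by positivity
  have e : l * (|P 0| / l) = |P 0| := by field_simp
  have h1 : P (|P 0| / l) ≤ 0 := by
    have h := hlo 0 _ hR
    rw [sub_zero, e] at h
    exact h.trans (sub_nonpos.2 (le_abs_self _))
  have h2 : 0 ≤ P (-(|P 0| / l)) := by
    have h := hlo (-(|P 0| / l)) 0 (neg_nonpos.2 hR)
    rw [zero_sub, neg_neg, e] at h
    have h' := neg_abs_le (P 0)
    linarith
  obtain ⟨r, hr⟩ := mem_range_of_exists_le_of_exists_ge hcont ⟨_, h1⟩ ⟨_, h2⟩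
  have hanti : StrictAnti P := fun x y hxy => by
    have := hlo x y hxy.le
    nlinarith
  exact ⟨r, fun r' => ⟨fun h => hanti.injective (h.trans hr.symm), fun h => h ▸ hr⟩⟩

end LinearCookieCutter

theorem theorem1 (m q : ℕ) (hm : 2 ≤ m) (hq : 2 ≤ q) (C : LinearCookieCutter m)
    (φ : ℝ → ℝ → ℝ) (Φ : Fin m → Fin m → ℝ) (hφ : C.LocallyConstantWith φ Φ) :
    -- the positive solution of the transfer system exists and is unique,
    -- and the pressure is differentiable in `s`
    (∀ s r : ℝ, ∃! t : Fin m → ℝ, IsTransferSolution q C.lam Φ s r t) ∧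
    (∀ r : ℝ, Differentiable ℝ (fun s => pressure q C.lam Φ s r)) ∧
    ∃ A B : ℝ, IsGLB (slopeSet q C.lam Φ) A ∧ IsLUB (slopeSet q C.lam Φ) B ∧
      {α : ℝ | (C.levelSet q φ α).Nonempty} = Icc A B ∧
      -- non-constant potential
      ((¬ ∃ c : ℝ, ∀ i j, Φ i j = c) → A < B ∧
        ∃ r : ℝ → ℝ,
          (∀ α ∈ Ioo A B, ∃ s : ℝ, ∀ s' r' : ℝ,
            IsCritical q C.lam Φ α s' r' ↔ s' = s ∧ r' = r α) ∧
          Tendsto r (𝓝[>] A) (𝓝 (r A)) ∧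
          Tendsto r (𝓝[<] B) (𝓝 (r B)) ∧
          ∀ α ∈ Icc A B, 0 ≤ r α ∧
            dimH (C.levelSet q φ α) = ENNReal.ofReal (r α / (q : ℝ))) ∧
      -- constant potential: `s` is arbitrary and only `r` is determined
      (∀ c : ℝ, (∀ i j, Φ i j = c) → A = c ∧ B = c ∧
        ∃ r : ℝ, (∀ s' r' : ℝ, IsCritical q C.lam Φ c s' r' ↔ r' = r) ∧ 0 ≤ r ∧
          dimH (C.levelSet q φ c) = ENNReal.ofReal (r / (q : ℝ))) := by
  have : NeZero m := ⟨by lia⟩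
  refine ⟨existsUnique_isTransferSolution hq C.lam Φ, differentiable_pressure hq C.lam Φ, ?_⟩
  have hne : (slopeSet q C.lam Φ).Nonempty := ⟨_, 0, 0, rfl⟩
  obtain ⟨A, hA⟩ : ∃ A, IsGLB (slopeSet q C.lam Φ) A :=
    ⟨_, isGLB_csInf hne (bddBelow_slopeSet hq C.lam Φ)⟩
  obtain ⟨B, hB⟩ : ∃ B, IsLUB (slopeSet q C.lam Φ) B :=
    ⟨_, isLUB_csSup hne (bddAbove_slopeSet hq C.lam Φ)⟩
  have hlt : (¬ ∃ c : ℝ, ∀ i j, Φ i j = c) → A < B := fun hΦ =>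
    (hA.1 ⟨0, 0, rfl⟩).trans_lt
      ((strictMono_pressureDeriv hq C.lam hΦ 0 zero_lt_one).trans_le (hB.1 ⟨1, 0, rfl⟩))
  have hconst : ∀ c : ℝ, (∀ i j, Φ i j = c) → A = c ∧ B = c ∧
      (C.levelSet q φ c).Nonempty ∧ ∃ r : ℝ, (∀ s' r' : ℝ, IsCritical q C.lam Φ c s' r' ↔ r' = r) ∧
        0 ≤ r ∧ dimH (C.levelSet q φ c) = ENNReal.ofReal (r / (q : ℝ)) := by
    intro c hc
    have hD := pressureDeriv_eq_of_const hq C.lam hc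
    obtain ⟨r, hr⟩ := C.exists_pressure_zero_eq_zero_iff hq Φ
    replace hr : ∀ s' r', IsCritical q C.lam Φ c s' r' ↔ r' = r := fun s' r' => by
      rw [IsCritical, hD, and_iff_left rfl, pressure_eq_of_const hq C.lam hc, add_eq_right, hr]
    have hset : slopeSet q C.lam Φ = {c} := by
      ext a
      refine ⟨fun ⟨s, r, h⟩ => by rw [← h, hD]; rfl, fun h => ⟨0, 0, by rw [hD, h]⟩⟩
    have hcrit := (hr 0 r).2 rfl
    have hmem := hcrit.mem_chainSpectrum hq
    have hL := C.levelSet_nonempty_of_mem_chainSpectrum hq hφ hmem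
    rw [hset] at hA hB
    exact ⟨hA.unique isGLB_singleton, hB.unique isLUB_singleton, hL, r, hr,
      C.nonneg_of_pressure_le hq hφ hL hcrit.1.le,
      le_antisymm (C.dimH_levelSet_le_of_pressure_le hq hφ hcrit.1.le)
        (C.le_dimH_levelSet_of_mem_chainSpectrum hq hφ hmem)⟩
  refine ⟨A, B, hA, hB, (C.levelSet_nonempty_subset hq hφ hA hB).antisymm fun α hα => ?_,
    fun hΦ => ⟨hlt hΦ, touchingValue (pressure q C.lam Φ), fun α hα => ?_,
      (C.tendsto_touchingValue_pressure hq hφ hA hB (hlt hΦ)).1,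
      (C.tendsto_touchingValue_pressure hq hφ hA hB (hlt hΦ)).2,
      fun α hα => C.dimH_levelSet_eq hq hφ hA hB (hlt hΦ) hα⟩,
    fun c hc => ⟨(hconst c hc).1, (hconst c hc).2.1, (hconst c hc).2.2.2⟩⟩
  · by_cases hΦ : ∃ c : ℝ, ∀ i j, Φ i j = c
    · obtain ⟨c, hc⟩ := hΦ
      obtain ⟨rfl, hBA, hL, -⟩ := hconst c hc
      rw [hBA] at hα
      rwa [mem_ofPred_eq, le_antisymm hα.2 hα.1]
    · exact C.levelSet_nonempty_of_mem_chainSpectrum hq hφ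
        (C.touchingValue_mem_chainSpectrum hq hφ hA hB (hlt hΦ) hα)
  · obtain ⟨s, r, h⟩ := C.exists_isCritical hq hA hB hα
    have hr := C.touchingValue_eq_of_isCritical hq h
    refine ⟨s, fun s' r' => ⟨fun h' => ?_, fun ⟨h1, h2⟩ => by rwa [h1, h2, hr]⟩⟩
    have hr' := C.touchingValue_eq_of_isCritical hq h'
    refine ⟨?_, hr'.symm⟩
    obtain rfl : r = r' := hr.symm.trans hr'
    exact (strictMono_pressureDeriv hq C.lam hΦ r).injective (h'.2.trans h.2.symm)
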